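/- Let $n\ge 1$, let $\Omega\subset\mathbb R^n$ be a bounded open set (for instance a bounded Lipschitz domain), let $\omega\subset\Omega$ be open and nonempty with characteristic function $\chi_\omega$, and let $T>0$, $y_0,y_d\in L^2(\Omega)$. Let $a\in W^{1,\infty}(\Omega)$, $b\in L^\infty(\Omega)^n$, $p\in L^\infty(\Omega)$, with $a\ge a_0$ a.e. in $\Omega$ for some constant $a_0>0$, and put $$\mathcal A u=-\operatorname{div}(a\nabla u)+b\cdot\nabla u+p\,u,\qquad \mathcal A^*\psi=-\operatorname{div}(a\nabla \psi)-\operatorname{div}(b\,\psi)+p\,\psi ,$$ with homogeneous Dirichlet conditions (weakly, in $H^1_0(\Omega)$). Assume $\operatorname{Ker}\mathcal A^*=\{0\}$. Parabolic solutions are weak solutions in $C([0,T];L^2(\Omega))\cap L^2(0,T;H^1_0(\Omega))$. Let $(y,f)$ be the optimal pair for $$\min_{f\in L^2(0,T;L^2(\Omega))}\ \frac12\int_0^T\big(\|f(t)\|_{L^2(\Omega)}^2+\|y(t)-y_d\|_{L^2(\Omega)}^2\big)\,dt,\qquad y_t+\mathcal A y=\chi_\omega f,\quad y(0)=y_0,$$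 let $(\bar y,\bar f)\in H^1_0(\Omega)\times L^2(\Omega)$ be the optimal pair for $$\min_{\bar f\in L^2(\Omega)}\ \frac12\big(\|\bar f\|_{L^2(\Omega)}^2+\|\bar y-y_d\|_{L^2(\Omega)}^2\big),\qquad \mathcal A\bar y=\chi_\omega\bar f,$$ and let $\bar\psi\in H^1_0(\Omega)$ be the stationary adjoint state, $\mathcal A^*\bar\psi=\bar y-y_d$. For $\tau>0$ and $\eta\in L^2(\Omega)$ let $\mathcal E(\tau)\eta=\psi(0)$, where $-\psi_t+\mathcal A^*\psi=y^\eta$ on $(0,\tau)$, $\psi(\tau)=0$, and $y^\eta$ is the optimal state of the evolution problem on $(0,\tau)$ with initial datum $\eta$ and target $0$. Then all these objects exist; the optimal controls $f$ and $\bar f$, the function $\bar\psi$ and the value $\mathcal E(\tau)\eta$ are unique; and there is a unique weak solution $h$ of $$-h_t+\mathcal A^*h+\mathcal E(T-t)(\chi_\omega h)=0\ \text{ in }\Omega\times(0,T),\qquad h=0\ \text{ on }\partial\Omega\times(0,T),\qquad h(T)=-\bar\psi .$$ Moreover, the optimal control is given by the affine feedback law $$f(t)=\bar f-\chi_\omega\big[\mathcal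 E(T-t)\,(y(t)-\bar y)+h(t)\big]\quad\text{in }L^2(\Omega),\ \text{for a.e. }t\in(0,T).$$ -/

import Mathlib

open MeasureTheory Set
open scoped ENNReal

noncomputable section

namespace ParabolicControl

/-- The Euclidean space `ℝⁿ`. -/
abbrev E (n : ℕ) : Type := EuclideanSpace ℝ (Fin n)

/-- The Hilbert space `L²(Ω)`. -/
abbrev L2 {n : ℕ} (Ω : Set (E n)) : Type := Lp ℝ 2 ((volume : Measure (E n)).restrict Ω)

/-- The Hilbert space `L²(Ω)ⁿ` of square integrable vector fields. -/
abbrev L2V {n : ℕ} (Ω : Set (E n)) : Type := Lp (E n) 2 ((volume : Measure (E n)).restrict Ω)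

/-- Test functions: `φ ∈ C_c^∞(Ω)`. -/
structure IsTestFunction {n : ℕ} (Ω : Set (E n)) (φ : E n → ℝ) : Prop where
  smooth : ContDiff ℝ ((⊤ : ℕ∞) : WithTop ℕ∞) φ
  compactSupport : HasCompactSupport φ
  tsupport_subset : tsupport φ ⊆ Ω

/-- The subspace `{(φ, ∇φ) : φ ∈ C_c^∞(Ω)}` of `L²(Ω) × L²(Ω)ⁿ`. -/
def testGraph {n : ℕ} (Ω : Set (E n)) : Submodule ℝ (WithLp 2 (L2 Ω × L2V Ω)) where
  carrier := {w | ∃ φ : E n → ℝ, IsTestFunction Ω φ ∧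
    w.fst =ᵐ[volume.restrict Ω] φ ∧ w.snd =ᵐ[volume.restrict Ω] gradient φ}
  zero_mem' := by
    refine ⟨fun _ => 0, ⟨contDiff_const, HasCompactSupport.zero, ?_⟩, ?_, ?_⟩
    · simp [tsupport]
    · exact Lp.coeFn_zero _ _ _
    · filter_upwards [Lp.coeFn_zero (E n) 2 (volume.restrict Ω)] with x hx
      rw [gradient_fun_const]
      exact hx
  add_mem' := by
    rintro w z ⟨φ, hφ, h1, h2⟩ ⟨ψ, hψ, h3, h4⟩
    refine ⟨φ + ψ, ⟨hφ.smooth.add hψ.smooth, hφ.compactSupport.add hψ.compactSupport,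
      (tsupport_add φ ψ).trans (union_subset hφ.tsupport_subset hψ.tsupport_subset)⟩, ?_, ?_⟩
    · filter_upwards [Lp.coeFn_add w.fst z.fst, h1, h3] with x hx h1 h3
      have : (w + z).fst = w.fst + z.fst := rfl
      rw [this, hx]
      simp [h1, h3]
    · filter_upwards [Lp.coeFn_add w.snd z.snd, h2, h4] with x hx h2 h4
      have : (w + z).snd = w.snd + z.snd := rfl
      rw [this, hx]
      have d1 : DifferentiableAt ℝ φ x := hφ.smooth.differentiable (by simp) x
      have d2 : DifferentiableAt ℝ ψ x := hψ.smooth.differentiable (by simp) x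
      simp [h2, h4, gradient, fderiv_add d1 d2]
  smul_mem' := by
    rintro c w ⟨φ, hφ, h1, h2⟩
    refine ⟨c • φ, ⟨hφ.smooth.const_smul c, ?_, ?_⟩, ?_, ?_⟩
    · exact hφ.compactSupport.smul_left (f := fun _ => c)
    · exact (tsupport_smul_subset_right (fun _ => c) φ).trans hφ.tsupport_subset
    · filter_upwards [Lp.coeFn_smul c w.fst, h1] with x hx h1
      have : (c • w).fst = c • w.fst := rfl
      rw [this, hx]
      simp [h1]
    · filter_upwards [Lp.coeFn_smul c w.snd, h2] with x hx h2
      have : (c • w).snd = c • w.snd := rfl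
      rw [this, hx]
      have d1 : DifferentiableAt ℝ φ x := hφ.smooth.differentiable (by simp) x
      simp [h2, gradient, fderiv_const_smul d1]

/-- The Sobolev space `H¹₀(Ω)`, the closure of `C_c^∞(Ω)` in the `H¹` norm. A function `u` is
stored together with its weak gradient: an element `w` is the pair `(u, ∇u)`, so that
`w.1.fst = u ∈ L²(Ω)` and `w.1.snd = ∇u ∈ L²(Ω)ⁿ`, and the norm inherited from the Hilbert
product is `(‖u‖² + ‖∇u‖²)^(1/2)`. -/
abbrev H10 {n : ℕ} (Ω : Set (E n)) : Type := (testGraph Ω).topologicalClosure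

/-- The function `u` underlying an element of `H¹₀(Ω)`. -/
def H10.val {n : ℕ} {Ω : Set (E n)} (w : H10 Ω) : L2 Ω := w.1.fst

/-- The weak gradient of an element of `H¹₀(Ω)`. -/
def H10.grad {n : ℕ} {Ω : Set (E n)} (w : H10 Ω) : L2V Ω := w.1.snd

/-- `a ∈ W^{1,∞}(Ω)`: `a` is essentially bounded and has an essentially bounded weak gradient. -/
def MemW1Infty {n : ℕ} (Ω : Set (E n)) (a : E n → ℝ) : Prop :=
  MemLp a ∞ (volume.restrict Ω) ∧
    ∃ G : E n → E n, MemLp G ∞ (volume.restrict Ω) ∧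
      ∀ φ : E n → ℝ, IsTestFunction Ω φ →
        ∫ x in Ω, a x • gradient φ x = -∫ x in Ω, φ x • G x

/-- The coefficients of `𝒜 = -div(a ∇·) + b·∇ + p`. -/
structure Coeffs (n : ℕ) where
  /-- the diffusion coefficient -/
  a : E n → ℝ
  /-- the drift -/
  b : E n → E n
  /-- the potential -/
  p : E n → ℝ

/-- The class `𝒞 = W^{1,∞}(Ω) × L^∞(Ω)ⁿ × L^∞(Ω)`. -/
structure Coeffs.MemClass {n : ℕ} (c : Coeffs n) (Ω : Set (E n)) : Prop where
  a_mem : MemW1Infty Ω c.a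
  b_mem : MemLp c.b ∞ (volume.restrict Ω)
  p_mem : MemLp c.p ∞ (volume.restrict Ω)

/-- The bilinear form of `𝒜` on `H¹₀(Ω)`:
`⟨𝒜 u, v⟩ = ∫_Ω a ∇u·∇v + (b·∇u) v + p u v`.
The adjoint `𝒜* = -div(a ∇·) - div(b ·) + p` has the form
`⟨𝒜* ψ, v⟩ = ∫_Ω a ∇ψ·∇v + ψ b·∇v + p ψ v = form v ψ`. -/
def Coeffs.form {n : ℕ} {Ω : Set (E n)} (c : Coeffs n) (u v : H10 Ω) : ℝ :=
  ∫ x in Ω, (c.a x * inner ℝ (u.grad x) (v.grad x) + inner ℝ (c.b x) (u.grad x) * v.val x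
    + c.p x * u.val x * v.val x)

/-- `Ker 𝒜* = {0}` (in `H¹₀(Ω)`). -/
def Coeffs.AdjointKernelTrivial {n : ℕ} (c : Coeffs n) (Ω : Set (E n)) : Prop :=
  ∀ ψ : H10 Ω, (∀ v : H10 Ω, c.form v ψ = 0) → ψ = 0

/-- Multiplication by the characteristic function of `ω` on `L²(Ω)`. -/
def chi {n : ℕ} {Ω ω : Set (E n)} (hω : MeasurableSet ω) (u : L2 Ω) : L2 Ω :=
  ((Lp.memLp u).indicator hω).toLp (ω.indicator u)

/-- Lebesgue measure on the time interval `(0,T)`. -/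
abbrev timeMeasure (T : ℝ) : Measure ℝ := volume.restrict (Ioc 0 T)

/-- The space `L²(0,T;L²(Ω))` of controls. -/
abbrev Control {n : ℕ} (Ω : Set (E n)) (T : ℝ) : Type := Lp (L2 Ω) 2 (timeMeasure T)

/-- `y` is the weak solution on `[0,T]` of `y_t + 𝒜 y = g` in `Ω`, `y = 0` on `∂Ω`, `y(0) = y₀`:
`g ∈ L²(0,T;L²(Ω))`, `y ∈ C([0,T];L²(Ω)) ∩ L²(0,T;H¹₀(Ω))`, and the equation holds in `H⁻¹(Ω)`,
integrated from `0` to `t`, for every `t`. -/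
structure IsForwardSol {n : ℕ} {Ω : Set (E n)} (c : Coeffs n) (T : ℝ) (g : ℝ → L2 Ω)
    (y₀ : L2 Ω) (y : ℝ → L2 Ω) : Prop where
  source_memLp : MemLp g 2 (timeMeasure T)
  continuousOn : ContinuousOn y (Icc 0 T)
  initial : y 0 = y₀
  weak : ∃ Y : Lp (H10 Ω) 2 (timeMeasure T), (∀ᵐ t ∂timeMeasure T, (Y t).val = y t) ∧
    ∀ v : H10 Ω, ∀ t ∈ Icc 0 T,
      inner ℝ (y t) v.val - inner ℝ y₀ v.val + ∫ s in (0 : ℝ)..t, c.form (Y s) v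
        = ∫ s in (0 : ℝ)..t, inner ℝ (g s) v.val

/-- `ψ` is the weak solution on `[0,T]` of `-ψ_t + 𝒜* ψ = g` in `Ω`, `ψ = 0` on `∂Ω`,
`ψ(T) = ψ₁`, in the same sense. -/
structure IsBackwardSol {n : ℕ} {Ω : Set (E n)} (c : Coeffs n) (T : ℝ) (g : ℝ → L2 Ω)
    (ψ₁ : L2 Ω) (ψ : ℝ → L2 Ω) : Prop where
  source_memLp : MemLp g 2 (timeMeasure T)
  continuousOn : ContinuousOn ψ (Icc 0 T)
  terminal : ψ T = ψ₁
  weak : ∃ Y : Lp (H10 Ω) 2 (timeMeasure T), (∀ᵐ t ∂timeMeasure T, (Y t).val = ψ t) ∧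
    ∀ v : H10 Ω, ∀ t ∈ Icc 0 T,
      inner ℝ (ψ t) v.val - inner ℝ ψ₁ v.val + ∫ s in t..T, c.form v (Y s)
        = ∫ s in t..T, inner ℝ (g s) v.val

/-- The state equation `y_t + 𝒜 y = χ_ω f`, `y(0) = y₀`. -/
def IsState {n : ℕ} {Ω ω : Set (E n)} (c : Coeffs n) (hω : MeasurableSet ω) (T : ℝ)
    (y₀ : L2 Ω) (f : Control Ω T) (y : ℝ → L2 Ω) : Prop :=
  IsForwardSol c T (fun t => chi hω (f t)) y₀ y

/-- The cost `½ ∫₀ᵀ ‖f(t)‖² + ‖y(t) - y_d‖² dt`. -/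
def cost {n : ℕ} {Ω : Set (E n)} (T : ℝ) (yd : L2 Ω) (f : Control Ω T) (y : ℝ → L2 Ω) : ℝ :=
  1 / 2 * ∫ t, (‖f t‖ ^ 2 + ‖y t - yd‖ ^ 2) ∂timeMeasure T

/-- `(y, f)` is an optimal pair of the evolution problem with initial datum `y₀`, target `y_d`. -/
def IsOptimalPair {n : ℕ} {Ω ω : Set (E n)} (c : Coeffs n) (hω : MeasurableSet ω) (T : ℝ)
    (y₀ yd : L2 Ω) (y : ℝ → L2 Ω) (f : Control Ω T) : Prop :=
  IsState c hω T y₀ f y ∧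
    ∀ (f' : Control Ω T) (y' : ℝ → L2 Ω), IsState c hω T y₀ f' y' →
      cost T yd f y ≤ cost T yd f' y'

/-- The stationary state equation `𝒜 ȳ = χ_ω f̄`, `ȳ ∈ H¹₀(Ω)`. -/
def IsStationaryState {n : ℕ} {Ω ω : Set (E n)} (c : Coeffs n) (hω : MeasurableSet ω)
    (f : L2 Ω) (y : H10 Ω) : Prop :=
  ∀ v : H10 Ω, c.form y v = inner ℝ (chi hω f) v.val

/-- The stationary cost `½ (‖f̄‖² + ‖ȳ - y_d‖²)`. -/
def stationaryCost {n : ℕ} {Ω : Set (E n)} (yd : L2 Ω) (f : L2 Ω) (y : H10 Ω) : ℝ :=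
  1 / 2 * (‖f‖ ^ 2 + ‖y.val - yd‖ ^ 2)

/-- `(ȳ, f̄)` is an optimal pair of the stationary problem with target `y_d`. -/
def IsStationaryOptimalPair {n : ℕ} {Ω ω : Set (E n)} (c : Coeffs n) (hω : MeasurableSet ω)
    (yd : L2 Ω) (y : H10 Ω) (f : L2 Ω) : Prop :=
  IsStationaryState c hω f y ∧
    ∀ (f' : L2 Ω) (y' : H10 Ω), IsStationaryState c hω f' y' →
      stationaryCost yd f y ≤ stationaryCost yd f' y'

/-- The stationary adjoint state: `𝒜* ψ̄ = ȳ - y_d`, `ψ̄ ∈ H¹₀(Ω)`. -/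
def IsStationaryAdjoint {n : ℕ} {Ω : Set (E n)} (c : Coeffs n) (yd : L2 Ω) (y ψ : H10 Ω) : Prop :=
  ∀ v : H10 Ω, c.form v ψ = inner ℝ (y.val - yd) v.val

/-- `ξ = ψ(0)`, where `ψ` is the adjoint state (`-ψ_t + 𝒜* ψ = y`, `ψ(τ) = 0`) of an optimal pair
`(y, f)` of the problem on `(0,τ)` with initial datum `η` and target `0`. -/
def IsRiccatiValue {n : ℕ} {Ω ω : Set (E n)} (c : Coeffs n) (hω : MeasurableSet ω) (τ : ℝ)
    (η ξ : L2 Ω) : Prop :=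
  ∃ (y : ℝ → L2 Ω) (f : Control Ω τ) (ψ : ℝ → L2 Ω),
    IsOptimalPair c hω τ η 0 y f ∧ IsBackwardSol c τ y 0 ψ ∧ ψ 0 = ξ

/-- The Riccati operator `𝓔(τ) : L²(Ω) → L²(Ω)`, `𝓔(τ) η = ψ(0)`. -/
def riccati {n : ℕ} {Ω ω : Set (E n)} (c : Coeffs n) (hω : MeasurableSet ω) (τ : ℝ)
    (η : L2 Ω) : L2 Ω :=
  Classical.epsilon fun ξ => IsRiccatiValue c hω τ η ξ

/-- `h` is the weak solution of `-h_t + 𝒜* h + 𝓔(T-t)(χ_ω h) = 0` in `Ω × (0,T)`, `h = 0` on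
`∂Ω × (0,T)`, `h(T) = h₁`. -/
def IsFeedbackSol {n : ℕ} {Ω ω : Set (E n)} (c : Coeffs n) (hω : MeasurableSet ω) (T : ℝ)
    (h₁ : L2 Ω) (h : ℝ → L2 Ω) : Prop :=
  IsBackwardSol c T (fun t => -riccati c hω (T - t) (chi hω (h t))) h₁ h

end ParabolicControl

end

/-! The problem is moved to an abstract setting. Let V = H¹₀(Ω), H = L²(Ω), let ι : V → H be the
embedding and C multiplication by χ_ω. The form of 𝒜 is represented, by Riesz, by a bounded operator
A on V; V' is identified with V, so that a source in H enters through ι*. The evolution part uses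
only that ι has dense range, that A satisfies a Gårding inequality, that C is a symmetric idempotent
and, for one measurability question, that H is separable.

Linear theory. For regular paths y = η + ∫₀ᵗ w with values in V, the energy estimate bounds y in
C([0,T];H) ∩ L²(0,T;V) by its data (y(0), y' + 𝔸y), and these data are dense (`denseRange_source`,
`energy_estimate`). Extension by continuity gives a solution operator (`exists_solution_operator`).
It allows an operator 𝔸 on L²(0,T;V) that varies in time, which is needed for the equation of h.
Pairing an arbitrary solution with regular solutions of the adjoint equation gives uniqueness and
the duality formula (`IsMild.unique`, `IsMild.duality`).

Control. The cost is a quadratic functional ‖f‖² + ‖Lf - b‖², so the optimal control exists, is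
unique, and by duality equals -Cψ with ψ the adjoint state (`isOptimal_iff`). For target 0 the
duality formula makes ⟪ζ, 𝓔(τ)η⟫ a symmetric expression in the two optimal trajectories
(`IsRiccatiSystem.inner_eq`). Hence 𝓔(τ) is symmetric and nonnegative; it is increasing in τ because
the optimal cost is. Symmetry yields linearity and boundedness, monotonicity yields uniform bounds
and measurability in τ. With these, the equation of h is a bounded perturbation of the adjoint
equation and can be solved.

Feedback law. The differences z = y - ȳ and q = ψ - ψ̄ solve the optimality system without y_d, with
q(T) = -ψ̄. Testing this system, and the equation of h, against the optimal trajectories with target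
0 that start at time t gives q(t) = 𝓔(T-t)z(t) + h(t) (`IsFeedback.decouple`). Since f = -Cψ and f̄
= -Cψ̄, one has f = f̄ - Cq.

The stationary problem needs A to be invertible. Rellich's theorem and the Fredholm alternative turn
Ker 𝒜* = {0} into invertibility of A*, hence of A (`isCompactOperator_valL`, `isUnit_of_garding`).
-/

set_option linter.unusedSectionVars false

noncomputable section

namespace ParabolicControl

open scoped RealInnerProductSpace BoundedContinuousFunction
open ContinuousLinearMap (adjoint)

/-! ### Hilbert space operators: coercivity, least squares, Fredholm alternative -/

section Operators

variable {V H : Type*} [NormedAddCommGroup V] [InnerProductSpace ℝ V] [CompleteSpace V]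
  [NormedAddCommGroup H] [InnerProductSpace ℝ H] [CompleteSpace H]

/-- The Lax–Milgram theorem for an operator. -/
theorem isUnit_of_coercive (A : V →L[ℝ] V) {c : ℝ} (hc : 0 < c)
    (h : ∀ v, c * ‖v‖ ^ 2 ≤ ⟪A v, v⟫) : IsUnit A := by
  set B : V →L[ℝ] V →L[ℝ] ℝ := (innerSL ℝ).comp A with hB
  have hco : IsCoercive B := ⟨c, hc, fun v => by
    have := h v
    simp only [hB, ContinuousLinearMap.comp_apply, innerSL_apply_apply]
    nlinarith⟩
  have : A = (hco.continuousLinearEquivOfBilin : V →L[ℝ] V) := by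
    ext v
    exact hco.unique_continuousLinearEquivOfBilin fun w => by simp [hB]
  rw [this]
  exact ⟨ContinuousLinearEquiv.toUnit _, rfl⟩

/-- If `S` is accretive with dense range, the Yosida approximations `S (ε + S)⁻¹ φ`
converge to `φ`. -/
theorem exists_resolvent_near (S : V →L[ℝ] V) (hS : ∀ w, 0 ≤ ⟪S w, w⟫) (hd : DenseRange S)
    (φ : V) {δ : ℝ} (hδ : 0 < δ) :
    ∃ ε : ℝ, 0 < ε ∧ ∃ w, ε • w + S w = φ ∧ ‖S w - φ‖ < δ := by
  obtain ⟨w₀, hw₀⟩ := hd.exists_dist_lt φ (half_pos hδ)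
  obtain ⟨ε, hε, hεw⟩ : ∃ ε : ℝ, 0 < ε ∧ 2 * ε * ‖w₀‖ < δ / 2 := by
    refine ⟨δ / (8 * (‖w₀‖ + 1)), by positivity, ?_⟩
    have : 0 ≤ ‖w₀‖ := norm_nonneg _
    rw [show 2 * (δ / (8 * (‖w₀‖ + 1))) * ‖w₀‖ = (2 * δ * ‖w₀‖) / (8 * (‖w₀‖ + 1)) by ring,
      div_lt_iff₀ (by positivity)]
    nlinarith
  have hu : IsUnit (ε • (1 : V →L[ℝ] V) + S) := isUnit_of_coercive _ hε fun v => by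
    have := hS v
    simp only [add_apply, smul_apply,
      one_apply_eq_self, inner_add_left, inner_smul_left, real_inner_self_eq_norm_sq]
    simpa using this
  obtain ⟨w, hw⟩ := (ContinuousLinearMap.isUnit_iff_bijective.1 hu).2 φ
  have hw : ε • w + S w = φ := by simpa using hw
  refine ⟨ε, hε, w, hw, ?_⟩
  -- S w - φ = -ε w, so ε‖w‖ must be small. Accretivity bounds ε‖w - w₀‖ by ‖φ - S w₀‖ + ε‖w₀‖,
  -- whence ε‖w‖ ≤ ‖φ - S w₀‖ + 2ε‖w₀‖ < δ.
  have h1 : ε • (w - w₀) + S (w - w₀) = φ - S w₀ - ε • w₀ := by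
    rw [← hw, map_sub, smul_sub]; abel
  have h2 : ε * ‖w - w₀‖ ≤ ‖φ - S w₀ - ε • w₀‖ := by
    have h3 : ε * ‖w - w₀‖ ^ 2 ≤ ‖φ - S w₀ - ε • w₀‖ * ‖w - w₀‖ := by
      calc ε * ‖w - w₀‖ ^ 2 ≤ ⟪ε • (w - w₀) + S (w - w₀), w - w₀⟫ := by
            rw [inner_add_left, inner_smul_left, real_inner_self_eq_norm_sq]
            simpa using hS (w - w₀)
        _ ≤ _ := by rw [h1]; exact real_inner_le_norm _ _
    rcases (norm_nonneg (w - w₀)).eq_or_lt with h0 | h0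
    · rw [← h0]; simp
    · exact le_of_mul_le_mul_right (by nlinarith) h0
  have h4 : S w - φ = -(ε • w) := by rw [← hw]; abel
  rw [h4, norm_neg, norm_smul, Real.norm_of_nonneg hε.le]
  have h5 : ‖w‖ ≤ ‖w - w₀‖ + ‖w₀‖ := by simpa using norm_add_le (w - w₀) w₀
  have h6 : ‖φ - S w₀ - ε • w₀‖ ≤ ‖φ - S w₀‖ + ε * ‖w₀‖ := by
    refine (norm_sub_le _ _).trans ?_
    rw [norm_smul, Real.norm_of_nonneg hε.le]
  rw [dist_eq_norm] at hw₀
  nlinarith [mul_le_mul_of_nonneg_left h5 hε.le]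

/-- First order condition for the quadratic functional `‖f‖² + ‖L f - b‖²`. -/
theorem quadratic_min_iff (L : V →L[ℝ] H) (b : H) (f : V) :
    (∀ f', ‖f‖ ^ 2 + ‖L f - b‖ ^ 2 ≤ ‖f'‖ ^ 2 + ‖L f' - b‖ ^ 2) ↔
      ∀ g, ⟪f, g⟫ + ⟪L f - b, L g⟫ = 0 := by
  have key : ∀ (g : V) (s : ℝ), ‖f + s • g‖ ^ 2 + ‖L (f + s • g) - b‖ ^ 2
      = ‖f‖ ^ 2 + ‖L f - b‖ ^ 2 + 2 * s * (⟪f, g⟫ + ⟪L f - b, L g⟫)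
        + s ^ 2 * (‖g‖ ^ 2 + ‖L g‖ ^ 2) := by
    intro g s
    have : L (f + s • g) - b = (L f - b) + s • L g := by rw [map_add, map_smul]; abel
    rw [this, norm_add_sq_real, norm_add_sq_real, norm_smul, norm_smul, inner_smul_right,
      inner_smul_right, mul_pow, mul_pow, Real.norm_eq_abs, sq_abs]
    ring
  constructor
  · intro h g
    set d := ⟪f, g⟫ + ⟪L f - b, L g⟫
    set q := ‖g‖ ^ 2 + ‖L g‖ ^ 2
    have hq : 0 ≤ q := by positivity
    -- The increment along s g is 2sd + s²q, minimal at s = -d/q; the denominator q + 1 avoids the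
    -- case q = 0 and still gives a negative value unless d = 0.
    have h1 := h (f + (-(d / (q + 1))) • g)
    rw [key] at h1
    have h2 : 0 ≤ 2 * (-(d / (q + 1))) * d + (-(d / (q + 1))) ^ 2 * q := by linarith
    have h3 : 2 * (-(d / (q + 1))) * d + (-(d / (q + 1))) ^ 2 * q
        = -(d ^ 2 * (q + 2)) / (q + 1) ^ 2 := by
      field_simp
      ring
    rw [h3, le_div_iff₀ (by positivity)] at h2
    by_contra hd
    have : 0 < d ^ 2 := by positivity
    nlinarith
  · intro h f'
    have h1 := key (f' - f) 1
    rw [h] at h1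
    simp only [one_smul, add_sub_cancel] at h1
    rw [h1]
    have : 0 ≤ ‖f' - f‖ ^ 2 + ‖L (f' - f)‖ ^ 2 := by positivity
    linarith

/-- The Euler equation reads (1 + L*L) f = L*b, and 1 + L*L is coercive with constant 1. -/
theorem existsUnique_quadratic_min (L : V →L[ℝ] H) (b : H) :
    ∃! f : V, ∀ g, ⟪f, g⟫ + ⟪L f - b, L g⟫ = 0 := by
  have hu : IsUnit (1 + (adjoint L).comp L) := isUnit_of_coercive _ one_pos fun v => by
    simp only [add_apply, one_apply_eq_self, inner_add_left,
      ContinuousLinearMap.comp_apply, ContinuousLinearMap.adjoint_inner_left,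
      real_inner_self_eq_norm_sq]
    nlinarith [sq_nonneg ‖L v‖]
  have hb := ContinuousLinearMap.isUnit_iff_bijective.1 hu
  have hiff : ∀ f : V, (∀ g, ⟪f, g⟫ + ⟪L f - b, L g⟫ = 0) ↔
      (1 + (adjoint L).comp L) f = adjoint L b := by
    intro f
    have : ∀ g, ⟪f, g⟫ + ⟪L f - b, L g⟫ = ⟪(1 + (adjoint L).comp L) f - adjoint L b, g⟫ := by
      intro g
      simp only [add_apply, one_apply_eq_self, inner_add_left,
        ContinuousLinearMap.comp_apply, ContinuousLinearMap.adjoint_inner_left, inner_sub_left]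
      ring
    simp only [this]
    constructor
    · intro h
      exact sub_eq_zero.1 (inner_self_eq_zero.1 (h _))
    · intro h g
      rw [h, sub_self, inner_zero_left]
  obtain ⟨f, hf⟩ := hb.2 (adjoint L b)
  exact ⟨f, (hiff f).2 hf, fun f' hf' => hb.1 (((hiff f').1 hf').trans hf.symm)⟩

/-- Fredholm alternative for an operator satisfying a Gårding inequality relative to a compact
embedding. -/
theorem isUnit_of_garding (ι : V →L[ℝ] H) (hι : IsCompactOperator ι) (A : V →L[ℝ] V)
    {α β : ℝ} (hα : 0 < α) (hβ : 0 < β) (hA : ∀ v, α * ‖v‖ ^ 2 ≤ ⟪A v, v⟫ + β * ‖ι v‖ ^ 2)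
    (hinj : ∀ v, A v = 0 → v = 0) : IsUnit A := by
  set K : V →L[ℝ] V := (adjoint ι).comp ι with hK
  have hKv : ∀ v, ⟪K v, v⟫ = ‖ι v‖ ^ 2 := fun v => by
    rw [hK, ContinuousLinearMap.comp_apply, ContinuousLinearMap.adjoint_inner_left,
      real_inner_self_eq_norm_sq]
  have hM : IsUnit (A + β • K) := isUnit_of_coercive _ hα fun v => by
    rw [add_apply, smul_apply, inner_add_left,
      inner_smul_left, hKv]
    exact hA v
  obtain ⟨M, hM⟩ := hM
  have hT : IsCompactOperator ((↑M⁻¹ : V →L[ℝ] V).comp K) :=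
    (hι.clm_comp (adjoint ι)).clm_comp (↑M⁻¹ : V →L[ℝ] V)
  have hβ' : β⁻¹ ≠ 0 := by positivity
  -- M = A + βK is coercive, hence invertible. Since M⁻¹K is compact, β⁻¹ is either an eigenvalue,
  -- which would give a kernel vector of A, or a point of the resolvent set.
  have hfac : A = (-β) • ((M : V →L[ℝ] V) * ((↑M⁻¹ : V →L[ℝ] V).comp K - β⁻¹ • 1)) := by
    have h1 : (M : V →L[ℝ] V) * ((↑M⁻¹ : V →L[ℝ] V).comp K) = K := by
      change (M : V →L[ℝ] V) * ((↑M⁻¹ : V →L[ℝ] V) * K) = K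
      rw [← mul_assoc, Units.mul_inv, one_mul]
    rw [mul_sub, h1, hM, mul_smul_comm, mul_one, smul_sub, smul_smul]
    rw [neg_mul, mul_inv_cancel₀ hβ.ne']
    simp
  rcases hT.hasEigenvalue_or_mem_resolventSet hβ' with h | h
  · obtain ⟨v, hv⟩ := h.exists_hasEigenvector
    exfalso
    apply hv.2
    apply hinj
    have := hv.apply_eq_smul
    rw [hfac]
    have h2 : ((↑M⁻¹ : V →L[ℝ] V).comp K) v = β⁻¹ • v := this
    simp only [smul_apply, mul_apply_eq_comp,
      sub_apply, one_apply_eq_self]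
    rw [h2]
    simp
  · rw [hfac]
    rw [spectrum.mem_resolventSet_iff] at h
    have h3 : IsUnit ((↑M⁻¹ : V →L[ℝ] V).comp K - β⁻¹ • 1) := by
      rw [← neg_sub, IsUnit.neg_iff]
      simpa [Algebra.algebraMap_eq_smul_one] using h
    exact (M.isUnit.mul h3).smul (Units.mk0 (-β) (neg_ne_zero.2 hβ.ne'))

/-- A bounded operator is invertible as soon as its adjoint is. -/
theorem isUnit_of_adjoint (A : V →L[ℝ] V) (h : IsUnit (adjoint A)) : IsUnit A := by
  have := h.star
  rwa [ContinuousLinearMap.star_eq_adjoint, ContinuousLinearMap.adjoint_adjoint] at this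

end Operators

/-! ### Weak measurability, density by orthogonality, pointwise operators on L² -/

/-- Weak measurability implies strong measurability in a separable Hilbert space. -/
theorem aestronglyMeasurable_of_inner {α H : Type*} [MeasurableSpace α] {μ : Measure α}
    [NormedAddCommGroup H] [InnerProductSpace ℝ H] [CompleteSpace H] [SecondCountableTopology H]
    {f : α → H} (h : ∀ x, AEStronglyMeasurable (fun t => ⟪x, f t⟫) μ) :
    AEStronglyMeasurable f μ := by
  obtain ⟨w, b, -⟩ := exists_hilbertBasis ℝ H
  -- Distinct orthonormal vectors are at distance √2, so the balls of radius 1/2 around them are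
  -- disjoint; a separable space has room for only countably many.
  have hcount : Countable w := by
    refine Pairwise.countable_of_isOpen_disjoint (s := fun i : w => Metric.ball (b i) (1 / 2)) ?_
      (fun i => Metric.isOpen_ball) (fun i => ⟨b i, Metric.mem_ball_self (by norm_num)⟩)
    intro i j hij
    refine Metric.ball_disjoint_ball ?_
    have h1 : ‖b i - b j‖ ^ 2 = 2 := by
      rw [norm_sub_sq_real, b.orthonormal.1, b.orthonormal.1, b.orthonormal.2 hij]
      norm_num
    rw [dist_eq_norm]
    nlinarith [norm_nonneg (b i - b j)]
  have hlim : ∀ t, Filter.Tendsto (fun s : Finset w => ∑ i ∈ s, ⟪b i, f t⟫ • b i) Filter.atTop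
      (nhds (f t)) := fun t => by
    have := b.hasSum_repr (f t)
    simpa only [b.repr_apply_apply] using! this
  refine aestronglyMeasurable_of_tendsto_ae Filter.atTop
    (f := fun (s : Finset w) t => ∑ i ∈ s, ⟪b i, f t⟫ • b i) (fun s => ?_)
    (Filter.Eventually.of_forall hlim)
  exact Finset.aestronglyMeasurable_fun_sum _ fun i _ => (h (b i)).smul_const _

theorem denseRange_of_orthogonal {V W : Type*} [NormedAddCommGroup V] [NormedSpace ℝ V]
    [NormedAddCommGroup W] [InnerProductSpace ℝ W] [CompleteSpace W] (S : V →L[ℝ] W)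
    (h : ∀ φ, (∀ w, ⟪S w, φ⟫ = 0) → φ = 0) : DenseRange S := by
  change Dense (LinearMap.range (S : V →ₗ[ℝ] W) : Set W)
  rw [Submodule.dense_iff_topologicalClosure_eq_top, Submodule.topologicalClosure_eq_top_iff,
    Submodule.eq_bot_iff]
  exact fun φ hφ => h φ fun w => hφ _ ⟨w, rfl⟩

section Pointwise

variable {α V W : Type*} [MeasurableSpace α] {μ : Measure α}
  [NormedAddCommGroup V] [NormedSpace ℝ V] [NormedAddCommGroup W] [NormedSpace ℝ W]

theorem memLp_pointwise {P : α → V →L[ℝ] W} {M : ℝ}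
    (hm : ∀ u : Lp V 2 μ, AEStronglyMeasurable (fun t => P t (u t)) μ)
    (hb : ∀ᵐ t ∂μ, ‖P t‖ ≤ M) (u : Lp V 2 μ) : MemLp (fun t => P t (u t)) 2 μ := by
  refine (Lp.memLp u).of_le_mul (c := M) (hm u) ?_
  filter_upwards [hb] with t ht
  exact (P t).le_of_opNorm_le ht _

/-- The multiplication operator on `L²` by an essentially bounded family of operators. -/
def pointwiseL (P : α → V →L[ℝ] W) (M : ℝ)
    (hm : ∀ u : Lp V 2 μ, AEStronglyMeasurable (fun t => P t (u t)) μ)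
    (hb : ∀ᵐ t ∂μ, ‖P t‖ ≤ M) : Lp V 2 μ →L[ℝ] Lp W 2 μ :=
  LinearMap.mkContinuous
    { toFun := fun u => (memLp_pointwise hm hb u).toLp _
      map_add' := fun u v => by
        ext1
        filter_upwards [MemLp.coeFn_toLp (memLp_pointwise hm hb u),
          MemLp.coeFn_toLp (memLp_pointwise hm hb v),
          MemLp.coeFn_toLp (memLp_pointwise hm hb (u + v)), Lp.coeFn_add u v,
          Lp.coeFn_add ((memLp_pointwise hm hb u).toLp _) ((memLp_pointwise hm hb v).toLp _)]
          with t h1 h2 h3 h4 h5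
        rw [h3, h5, Pi.add_apply, h1, h2, h4, Pi.add_apply, map_add]
      map_smul' := fun c u => by
        ext1
        filter_upwards [MemLp.coeFn_toLp (memLp_pointwise hm hb u),
          MemLp.coeFn_toLp (memLp_pointwise hm hb (c • u)), Lp.coeFn_smul c u,
          Lp.coeFn_smul c ((memLp_pointwise hm hb u).toLp _)] with t h1 h2 h3 h4
        rw [RingHom.id_apply, h2, h4, Pi.smul_apply, h1, h3, Pi.smul_apply, map_smul] }
    M fun u => by
      refine Lp.norm_le_mul_norm_of_ae_le_mul ?_
      filter_upwards [MemLp.coeFn_toLp (memLp_pointwise hm hb u), hb] with t h1 h2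
      change ‖((memLp_pointwise hm hb u).toLp _) t‖ ≤ _
      rw [h1]
      exact (P t).le_of_opNorm_le h2 _

theorem coeFn_pointwiseL (P : α → V →L[ℝ] W) (M : ℝ)
    (hm : ∀ u : Lp V 2 μ, AEStronglyMeasurable (fun t => P t (u t)) μ)
    (hb : ∀ᵐ t ∂μ, ‖P t‖ ≤ M) (u : Lp V 2 μ) :
    pointwiseL P M hm hb u =ᵐ[μ] fun t => P t (u t) :=
  MemLp.coeFn_toLp (memLp_pointwise hm hb u)

end Pointwise

theorem setIntegral_timeMeasure {V : Type*} [NormedAddCommGroup V] [NormedSpace ℝ V]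
    {T a b : ℝ} (ha : 0 ≤ a) (hab : a ≤ b) (hb : b ≤ T) (f : ℝ → V) :
    ∫ s in a..b, f s ∂timeMeasure T = ∫ s in a..b, f s := by
  rw [intervalIntegral.integral_of_le hab, intervalIntegral.integral_of_le hab,
    Measure.restrict_restrict measurableSet_Ioc, inter_eq_left.2]
  exact Ioc_subset_Ioc ha hb

theorem integral_timeMeasure {V : Type*} [NormedAddCommGroup V] [NormedSpace ℝ V]
    {T : ℝ} (hT : 0 ≤ T) (f : ℝ → V) :
    ∫ s, f s ∂timeMeasure T = ∫ s in (0 : ℝ)..T, f s :=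
  (intervalIntegral.integral_of_le hT).symm

/-! ### Primitives in time, the weighted product rule and the Volterra operator -/

section Primitive

variable {V : Type*} [NormedAddCommGroup V] [InnerProductSpace ℝ V] [CompleteSpace V] {T : ℝ}

theorem Lp_integrable (w : Lp V 2 (timeMeasure T)) : Integrable w (timeMeasure T) :=
  (Lp.memLp w).integrable one_le_two

/-- Cauchy–Schwarz on (0,T]. The bound is uniform in the endpoints, so primitives are bounded on all
of ℝ. -/
theorem norm_integral_Lp_le (w : Lp V 2 (timeMeasure T)) (a b : ℝ) :
    ‖∫ s in a..b, w s ∂timeMeasure T‖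
      ≤ (timeMeasure T univ ^ (1 / 2 : ℝ)).toReal * ‖w‖ := by
  have h1 : ‖∫ s in a..b, w s ∂timeMeasure T‖ ≤ ∫ s, ‖w s‖ ∂timeMeasure T := by
    refine (intervalIntegral.norm_integral_le_integral_norm_uIoc).trans ?_
    exact setIntegral_le_integral (Lp_integrable w).norm (Filter.Eventually.of_forall
      fun _ => norm_nonneg _)
  refine h1.trans ?_
  rw [integral_norm_eq_lintegral_enorm (Lp.aestronglyMeasurable w), ← eLpNorm_one_eq_lintegral_enorm,
    Lp.norm_def, ← ENNReal.toReal_mul]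
  refine ENNReal.toReal_mono ?_ ?_
  · exact ENNReal.mul_ne_top (ENNReal.rpow_ne_top_of_nonneg (by norm_num) (measure_ne_top _ _))
      (Lp.eLpNorm_ne_top w)
  · have := eLpNorm_le_eLpNorm_mul_rpow_measure_univ (μ := timeMeasure T) (p := 1) (q := 2)
      one_le_two (Lp.aestronglyMeasurable w)
    rw [mul_comm]
    convert this using 3
    norm_num

/-- The primitive `t ↦ ∫₀ᵗ w` of an element of `L²(0,T;V)`. -/
def prim (T : ℝ) : Lp V 2 (timeMeasure T) →L[ℝ] (ℝ →ᵇ V) :=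
  LinearMap.mkContinuous
    { toFun := fun w => BoundedContinuousFunction.ofNormedAddCommGroup
        (fun t => ∫ s in (0 : ℝ)..t, w s ∂timeMeasure T)
        (intervalIntegral.continuous_primitive
          (fun _ _ => (Lp_integrable w).intervalIntegrable) 0) _
        (fun t => norm_integral_Lp_le w 0 t)
      map_add' := fun u v => by
        ext t
        simp only [BoundedContinuousFunction.coe_ofNormedAddCommGroup,
          BoundedContinuousFunction.coe_add, Pi.add_apply]
        rw [← intervalIntegral.integral_add (Lp_integrable u).intervalIntegrable
          (Lp_integrable v).intervalIntegrable]
        refine intervalIntegral.integral_congr_ae ?_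
        filter_upwards [Lp.coeFn_add u v] with s hs _ using hs
      map_smul' := fun c u => by
        ext t
        simp only [BoundedContinuousFunction.coe_ofNormedAddCommGroup,
          BoundedContinuousFunction.coe_smul, RingHom.id_apply]
        rw [← intervalIntegral.integral_smul]
        refine intervalIntegral.integral_congr_ae ?_
        filter_upwards [Lp.coeFn_smul c u] with s hs _ using hs }
    (timeMeasure T univ ^ (1 / 2 : ℝ)).toReal fun w => by
      refine (BoundedContinuousFunction.norm_le (by positivity)).2 fun t => ?_
      exact norm_integral_Lp_le w 0 t

theorem prim_apply (w : Lp V 2 (timeMeasure T)) (t : ℝ) :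
    prim T w t = ∫ s in (0 : ℝ)..t, w s ∂timeMeasure T := rfl

theorem prim_apply_of_mem (w : Lp V 2 (timeMeasure T)) {t : ℝ} (ht : t ∈ Icc 0 T) :
    prim T w t = ∫ s in (0 : ℝ)..t, w s := by
  rw [prim_apply, setIntegral_timeMeasure le_rfl ht.1 ht.2]

theorem prim_zero (w : Lp V 2 (timeMeasure T)) : prim T w 0 = 0 := by
  rw [prim_apply, intervalIntegral.integral_same]

/-- The primitive is constant outside `[0,T]`. -/
theorem prim_projIcc (hT : 0 ≤ T) (w : Lp V 2 (timeMeasure T)) (t : ℝ) :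
    prim T w t = prim T w (projIcc 0 T hT t) := by
  rcases le_total t 0 with h | h
  · rw [projIcc_of_le_left hT h, prim_zero, prim_apply, intervalIntegral.integral_of_ge h,
      Measure.restrict_restrict measurableSet_Ioc, Ioc_inter_Ioc]
    simp [h]
  · rcases le_total t T with h' | h'
    · rw [projIcc_of_mem hT ⟨h, h'⟩]
    · rw [projIcc_of_right_le hT h', prim_apply, prim_apply, intervalIntegral.integral_of_le h,
        intervalIntegral.integral_of_le hT, Measure.restrict_restrict measurableSet_Ioc,
        Measure.restrict_restrict measurableSet_Ioc, inter_eq_right.2, inter_self]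
      exact Ioc_subset_Ioc_right h'

/-- A bounded continuous function as an element of `L²(0,T;V)`. -/
def bcfLp (T : ℝ) : (ℝ →ᵇ V) →L[ℝ] Lp V 2 (timeMeasure T) :=
  BoundedContinuousFunction.toLp 2 (timeMeasure T) ℝ

theorem coeFn_bcfLp (f : ℝ →ᵇ V) : bcfLp T f =ᵐ[timeMeasure T] f :=
  BoundedContinuousFunction.coeFn_toLp 2 (timeMeasure T) ℝ f

/-- Constant functions. -/
def constB : V →L[ℝ] (ℝ →ᵇ V) :=
  LinearMap.mkContinuous
    { toFun := BoundedContinuousFunction.const ℝ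
      map_add' := fun _ _ => by ext; simp
      map_smul' := fun _ _ => by ext; simp } 1 fun v => by
    rw [one_mul]
    exact (BoundedContinuousFunction.norm_le (norm_nonneg _)).2 fun _ => le_rfl

@[simp] theorem constB_apply (v : V) (t : ℝ) : constB v t = v := rfl

/-- The path `t ↦ c + ∫₀ᵗ w`. -/
def path (T : ℝ) (c : V) (w : Lp V 2 (timeMeasure T)) : ℝ →ᵇ V := constB c + prim T w

@[simp] theorem path_apply (c : V) (w : Lp V 2 (timeMeasure T)) (t : ℝ) :
    path T c w t = c + prim T w t := rfl

theorem continuous_path (c : V) : Continuous (path T c) :=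
  continuous_const.add (prim T).continuous

/-- Multiplication by the weight `exp (-k t)`. -/
def expWeight (T k : ℝ) : Lp V 2 (timeMeasure T) →L[ℝ] Lp V 2 (timeMeasure T) :=
  pointwiseL (fun t => Real.exp (-(k * t)) • ContinuousLinearMap.id ℝ V) (Real.exp (|k| * T))
    (fun u => by
      simp only [smul_apply, ContinuousLinearMap.id_apply]
      exact (by fun_prop : Continuous fun t : ℝ => Real.exp (-(k * t))).aestronglyMeasurable.smul
        (Lp.aestronglyMeasurable u))
    (by
      filter_upwards [ae_restrict_mem measurableSet_Ioc] with t ht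
      rw [norm_smul, Real.norm_of_nonneg (Real.exp_pos _).le]
      refine (mul_le_of_le_one_right (Real.exp_pos _).le ContinuousLinearMap.norm_id_le).trans ?_
      refine Real.exp_le_exp.2 ?_
      calc -(k * t) ≤ |k| * t := by nlinarith [neg_abs_le k, ht.1]
        _ ≤ |k| * T := mul_le_mul_of_nonneg_left ht.2 (abs_nonneg _))

theorem coeFn_expWeight (k : ℝ) (u : Lp V 2 (timeMeasure T)) :
    expWeight T k u =ᵐ[timeMeasure T] fun t => Real.exp (-(k * t)) • u t :=
  coeFn_pointwiseL _ _ _ _ u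

/-- Written with L² inner products, the integral is visibly continuous in (m, w); this is what the
density argument for `product_rule` requires. -/
theorem product_rule_inner (c d : V) (k : ℝ) (m w : Lp V 2 (timeMeasure T)) :
    ∫ s, Real.exp (-(k * s)) * (⟪m s, path T d w s⟫ + ⟪path T c m s, w s⟫
        - k * ⟪path T c m s, path T d w s⟫) ∂timeMeasure T
      = ⟪expWeight T k m, bcfLp T (path T d w)⟫ + ⟪expWeight T k (bcfLp T (path T c m)), w⟫
        - k * ⟪expWeight T k (bcfLp T (path T c m)), bcfLp T (path T d w)⟫ := by
  have hi : ∀ f g : Lp V 2 (timeMeasure T), Integrable (fun t => ⟪f t, g t⟫) (timeMeasure T) :=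
    fun f g => L2.integrable_inner (𝕜 := ℝ) f g
  rw [L2.inner_def, L2.inner_def, L2.inner_def, ← integral_const_mul,
    ← integral_add (hi _ _) (hi _ _),
    ← integral_sub (Integrable.fun_add (hi _ _) (hi _ _)) ((hi _ _).const_mul k)]
  refine integral_congr_ae ?_
  filter_upwards [coeFn_expWeight k m, coeFn_expWeight k (bcfLp T (path T c m)),
    coeFn_bcfLp (T := T) (path T c m), coeFn_bcfLp (T := T) (path T d w)] with s h1 h2 h3 h4
  simp only [h1, h2, h3, h4, inner_smul_left]
  simp
  ring

theorem prim_bcfLp (f : ℝ →ᵇ V) {t : ℝ} (ht : t ∈ Icc 0 T) :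
    prim T (bcfLp T f) t = ∫ s in (0 : ℝ)..t, f s := by
  rw [← setIntegral_timeMeasure le_rfl ht.1 ht.2, prim_apply]
  exact intervalIntegral.integral_congr_ae ((coeFn_bcfLp f).mono fun s hs _ => hs)

/-- The weighted product rule for primitives of square integrable functions. -/
theorem product_rule (hT : 0 ≤ T) (k : ℝ) (c d : V) (m w : Lp V 2 (timeMeasure T)) :
    Real.exp (-(k * T)) * ⟪path T c m T, path T d w T⟫ - ⟪c, d⟫
      = ∫ s, Real.exp (-(k * s)) * (⟪m s, path T d w s⟫ + ⟪path T c m s, w s⟫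
        - k * ⟪path T c m s, path T d w s⟫) ∂timeMeasure T := by
  rw [product_rule_inner]
  have hcl : IsClosed {p : Lp V 2 (timeMeasure T) × Lp V 2 (timeMeasure T) |
      Real.exp (-(k * T)) * ⟪path T c p.1 T, path T d p.2 T⟫ - ⟪c, d⟫
      = ⟪expWeight T k p.1, bcfLp T (path T d p.2)⟫
        + ⟪expWeight T k (bcfLp T (path T c p.1)), p.2⟫
        - k * ⟪expWeight T k (bcfLp T (path T c p.1)), bcfLp T (path T d p.2)⟫} := by
    have hc := continuous_path (T := T) c
    have hd := continuous_path (T := T) d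
    have hev : Continuous fun f : ℝ →ᵇ V => f T := continuous_eval_const T
    refine isClosed_eq ?_ ?_
    · exact (continuous_const.mul ((hev.comp (hc.comp continuous_fst)).inner
        (hev.comp (hd.comp continuous_snd)))).sub continuous_const
    · have h1 : Continuous fun p : Lp V 2 (timeMeasure T) × Lp V 2 (timeMeasure T) =>
          bcfLp T (path T c p.1) := (bcfLp (V := V) T).continuous.comp (hc.comp continuous_fst)
      have h2 : Continuous fun p : Lp V 2 (timeMeasure T) × Lp V 2 (timeMeasure T) =>
          bcfLp T (path T d p.2) := (bcfLp (V := V) T).continuous.comp (hd.comp continuous_snd)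
      fun_prop
  -- Both sides are continuous in (m, w), so continuous m and w suffice. Their paths are C¹, and the
  -- fundamental theorem of calculus applies.
  have hdense : DenseRange (bcfLp (V := V) T) :=
    BoundedContinuousFunction.toLp_denseRange V (timeMeasure T) ℝ (by norm_num)
  refine hdense.induction_on₂ (p := fun m w => Real.exp (-(k * T)) * ⟪path T c m T, path T d w T⟫
      - ⟪c, d⟫ = ⟪expWeight T k m, bcfLp T (path T d w)⟫
        + ⟪expWeight T k (bcfLp T (path T c m)), w⟫
        - k * ⟪expWeight T k (bcfLp T (path T c m)), bcfLp T (path T d w)⟫) hcl ?_ m w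
  intro f g
  rw [← product_rule_inner]
  set F : ℝ → V := fun t => c + ∫ s in (0 : ℝ)..t, f s
  set G : ℝ → V := fun t => d + ∫ s in (0 : ℝ)..t, g s
  have hF : ∀ t, HasDerivAt F (f t) t := fun t =>
    (f.continuous.integral_hasStrictDerivAt 0 t).hasDerivAt.const_add c
  have hG : ∀ t, HasDerivAt G (g t) t := fun t =>
    (g.continuous.integral_hasStrictDerivAt 0 t).hasDerivAt.const_add d
  have hFc : Continuous F := continuous_iff_continuousAt.2 fun t => (hF t).continuousAt
  have hGc : Continuous G := continuous_iff_continuousAt.2 fun t => (hG t).continuousAt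
  have hderiv : ∀ t ∈ uIcc 0 T, HasDerivAt (fun t => Real.exp (-(k * t)) * ⟪F t, G t⟫)
      (Real.exp (-(k * t)) * (⟪f t, G t⟫ + ⟪F t, g t⟫ - k * ⟪F t, G t⟫)) t := by
    intro t _
    have h1 : HasDerivAt (fun t => Real.exp (-(k * t))) (Real.exp (-(k * t)) * (-(k * 1))) t :=
      ((hasDerivAt_id t).const_mul k).neg.exp
    refine (h1.mul ((hF t).inner ℝ (hG t))).congr_deriv ?_
    ring
  have hint := intervalIntegral.integral_eq_sub_of_hasDerivAt hderiv
    (Continuous.intervalIntegrable (by fun_prop) _ _)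
  have hFT : ∀ t ∈ Icc 0 T, path T c (bcfLp T f) t = F t := fun t ht => by
    rw [path_apply, prim_bcfLp f ht]
  have hGT : ∀ t ∈ Icc 0 T, path T d (bcfLp T g) t = G t := fun t ht => by
    rw [path_apply, prim_bcfLp g ht]
  have h0 : F 0 = c ∧ G 0 = d := by simp [F, G]
  rw [hFT T ⟨hT, le_rfl⟩, hGT T ⟨hT, le_rfl⟩]
  have hl : Real.exp (-(k * T)) * ⟪F T, G T⟫ - ⟪c, d⟫ = ∫ t in (0 : ℝ)..T,
      Real.exp (-(k * t)) * (⟪f t, G t⟫ + ⟪F t, g t⟫ - k * ⟪F t, G t⟫) := by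
    rw [hint, h0.1, h0.2]
    simp
  rw [hl, ← integral_timeMeasure hT]
  refine integral_congr_ae ?_
  filter_upwards [coeFn_bcfLp (T := T) f, coeFn_bcfLp (T := T) g,
    ae_restrict_mem measurableSet_Ioc] with s h1 h2 h3
  rw [hFT s (Ioc_subset_Icc_self h3), hGT s (Ioc_subset_Icc_self h3), h1, h2]

theorem timeMeasure_mono {t : ℝ} (ht : t ≤ T) : timeMeasure t ≤ timeMeasure T :=
  Measure.restrict_mono (Ioc_subset_Ioc_right ht) le_rfl

/-- On [0,t] the paths see only the restrictions of m and w to (0,t], so the product rule on the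
shorter interval applies to these. -/
theorem product_rule_upTo (k : ℝ) (c d : V) (m w : Lp V 2 (timeMeasure T)) {t : ℝ}
    (ht : t ∈ Icc 0 T) :
    Real.exp (-(k * t)) * ⟪path T c m t, path T d w t⟫ - ⟪c, d⟫
      = ∫ s in (0 : ℝ)..t, Real.exp (-(k * s)) * (⟪m s, path T d w s⟫ + ⟪path T c m s, w s⟫
        - k * ⟪path T c m s, path T d w s⟫) := by
  have hle := timeMeasure_mono ht.2
  set m' := ((Lp.memLp m).mono_measure hle).toLp m
  set w' := ((Lp.memLp w).mono_measure hle).toLp w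
  have hm : m' =ᵐ[timeMeasure t] m := MemLp.coeFn_toLp _
  have hw : w' =ᵐ[timeMeasure t] w := MemLp.coeFn_toLp _
  have hp : ∀ {u : Lp V 2 (timeMeasure T)} {u' : Lp V 2 (timeMeasure t)} (e : V),
      u' =ᵐ[timeMeasure t] u → ∀ s ∈ Icc 0 t, path T e u s = path t e u' s := by
    intro u u' e h s hs
    rw [path_apply, path_apply, prim_apply_of_mem u ⟨hs.1, hs.2.trans ht.2⟩,
      prim_apply_of_mem u' hs]
    congr 1
    refine intervalIntegral.integral_congr_ae ?_
    have h1 := (ae_restrict_iff' measurableSet_Ioc).1 h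
    filter_upwards [h1] with r hr hr'
    rw [uIoc_of_le hs.1] at hr'
    exact (hr ⟨hr'.1, hr'.2.trans hs.2⟩).symm
  rw [hp c hm t ⟨ht.1, le_rfl⟩, hp d hw t ⟨ht.1, le_rfl⟩, product_rule ht.1 k c d m' w',
    ← integral_timeMeasure ht.1]
  refine integral_congr_ae ?_
  filter_upwards [hm, hw, ae_restrict_mem measurableSet_Ioc] with s h1 h2 h3
  rw [hp c hm s (Ioc_subset_Icc_self h3), hp d hw s (Ioc_subset_Icc_self h3), h1, h2]

/-- The Volterra operator `w ↦ ∫₀ᵗ w` on `L²(0,T;V)`. -/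
def volterra (T : ℝ) : Lp V 2 (timeMeasure T) →L[ℝ] Lp V 2 (timeMeasure T) :=
  (bcfLp T).comp (prim T)

theorem coeFn_volterra (w : Lp V 2 (timeMeasure T)) :
    volterra T w =ᵐ[timeMeasure T] prim T w := coeFn_bcfLp _

/-- The integrand is the derivative of e^{-ks}‖∫₀ˢ u‖², which vanishes at s = 0 and is nonnegative
at s = T. -/
theorem volterra_weighted_nonneg (hT : 0 ≤ T) (k : ℝ) (u : Lp V 2 (timeMeasure T)) :
    0 ≤ ∫ s, Real.exp (-(k * s)) * (2 * ⟪u s, prim T u s⟫ - k * ‖prim T u s‖ ^ 2)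
      ∂timeMeasure T := by
  have h := product_rule hT k 0 0 u u
  simp only [path_apply, zero_add, inner_zero_left, sub_zero, real_inner_self_eq_norm_sq] at h
  have h2 : ∫ s, Real.exp (-(k * s)) * (2 * ⟪u s, prim T u s⟫ - k * ‖prim T u s‖ ^ 2)
      ∂timeMeasure T = Real.exp (-(k * T)) * ‖prim T u T‖ ^ 2 := by
    rw [h]
    congr 1
    ext s
    rw [real_inner_comm (u s) (prim T u s)]
    ring
  rw [h2]
  positivity

theorem volterra_accretive (hT : 0 ≤ T) (u : Lp V 2 (timeMeasure T)) : 0 ≤ ⟪volterra T u, u⟫ := by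
  have h := volterra_weighted_nonneg hT 0 u
  have h2 : ∫ s, Real.exp (-(0 * s)) * (2 * ⟪u s, prim T u s⟫ - 0 * ‖prim T u s‖ ^ 2)
      ∂timeMeasure T = 2 * ⟪volterra T u, u⟫ := by
    rw [L2.inner_def, ← integral_const_mul]
    refine integral_congr_ae ?_
    filter_upwards [coeFn_volterra u] with s hs
    rw [hs, real_inner_comm]
    simp
  linarith

/-- For a scalar test function g on (0,T), g v is the primitive of g' v. A vector orthogonal to the
range is therefore orthogonal to all g v and vanishes by the fundamental lemma of the calculus of
variations. -/
theorem denseRange_volterra :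
    DenseRange (volterra T : Lp V 2 (timeMeasure T) →L[ℝ] Lp V 2 (timeMeasure T)) := by
  refine denseRange_of_orthogonal _ fun φ hφ => ?_
  have h0 : ∀ᵐ s ∂timeMeasure T, s ∈ Ioo 0 T → φ s = 0 := by
    refine IsOpen.ae_eq_zero_of_integral_contDiff_smul_eq_zero isOpen_Ioo
      ((Lp_integrable φ).locallyIntegrable.locallyIntegrableOn _) ?_
    intro g hg hgc hgs
    have hg1 : ContDiff ℝ 1 g := hg.of_le (by exact_mod_cast le_top)
    have hdc : Continuous (deriv g) := hg1.continuous_deriv le_rfl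
    have hdsupp : HasCompactSupport (deriv g) := hgc.deriv
    refine ext_inner_left ℝ fun v => ?_
    rw [inner_zero_right]
    obtain ⟨C, hC⟩ := hdsupp.exists_bound_of_continuous hdc
    set f : ℝ →ᵇ V := BoundedContinuousFunction.ofNormedAddCommGroup (fun s => deriv g s • v)
      (by fun_prop) (C * ‖v‖) (fun s => by
        rw [norm_smul]; exact mul_le_mul_of_nonneg_right (hC s) (norm_nonneg _))
    have hf : ∀ s ∈ Icc 0 T, prim T (bcfLp T f) s = g s • v := by
      intro s hs
      rw [prim_bcfLp f hs]
      change ∫ r in (0 : ℝ)..s, deriv g r • v = _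
      rw [intervalIntegral.integral_smul_const, intervalIntegral.integral_deriv_eq_sub
        (fun x _ => hg1.differentiable one_ne_zero x) (hdc.intervalIntegrable _ _)]
      have : g 0 = 0 := image_eq_zero_of_notMem_tsupport fun h => by
        have := (hgs h).1; simp at this
      rw [this, sub_zero]
    have h1 : ⟪volterra T (bcfLp T f), φ⟫ = 0 := hφ _
    rw [L2.inner_def] at h1
    have hgi : Integrable (fun s => g s • φ s) (timeMeasure T) := by
      obtain ⟨C', hC'⟩ := hgc.exists_bound_of_continuous hg.continuous
      exact (Lp_integrable φ).bdd_smul _ hg.continuous.aestronglyMeasurable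
        (Filter.Eventually.of_forall hC')
    rw [← integral_inner hgi]
    rw [← h1]
    refine integral_congr_ae ?_
    filter_upwards [coeFn_volterra (bcfLp T f), ae_restrict_mem measurableSet_Ioc] with s h2 h3
    rw [h2, hf s (Ioc_subset_Icc_self h3), inner_smul_left, inner_smul_right]
    simp
  refine Lp.ext ?_
  have hne : ∀ᵐ s ∂timeMeasure T, s ≠ T := ae_restrict_of_ae (Measure.ae_ne volume T)
  filter_upwards [h0, hne, ae_restrict_mem measurableSet_Ioc, Lp.coeFn_zero V 2 (timeMeasure T)]
    with s h1 h2 h3 h4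
  rw [h4, h1 ⟨h3.1, lt_of_le_of_ne h3.2 h2⟩]
  rfl

theorem map_prim {W : Type*} [NormedAddCommGroup W] [InnerProductSpace ℝ W] [CompleteSpace W]
    (L : V →L[ℝ] W) (w : Lp V 2 (timeMeasure T)) (t : ℝ) :
    L (prim T w t) = prim T (L.compLpL 2 (timeMeasure T) w) t := by
  rw [prim_apply, prim_apply, ← L.intervalIntegral_comp_comm (Lp_integrable w).intervalIntegrable]
  exact intervalIntegral.integral_congr_ae ((L.coeFn_compLpL w).mono fun s hs _ => hs.symm)

end Primitive

theorem continuous_quadratic_add {X : Type*} [NormedAddCommGroup X] [InnerProductSpace ℝ X]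
    (c : ℝ) (G W A : X →L[ℝ] X) (z : X) :
    Continuous fun x => c * ⟪G x, W x⟫ + ⟪A x, z⟫ := by
  fun_prop

/-! ### Existence for the abstract evolution equation by density and energy estimates -/

section Existence

variable {V H : Type*} [NormedAddCommGroup V] [InnerProductSpace ℝ V] [CompleteSpace V]
  [NormedAddCommGroup H] [InnerProductSpace ℝ H] [CompleteSpace H] {T : ℝ}

theorem Lp_norm_sq (u : Lp V 2 (timeMeasure T)) : ‖u‖ ^ 2 = ∫ s, ‖u s‖ ^ 2 ∂timeMeasure T := by
  rw [← real_inner_self_eq_norm_sq, L2.inner_def]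
  simp only [real_inner_self_eq_norm_sq]

theorem Lp_integrable_norm_sq (u : Lp V 2 (timeMeasure T)) :
    Integrable (fun s => ‖u s‖ ^ 2) (timeMeasure T) := by
  simpa only [real_inner_self_eq_norm_sq] using L2.integrable_inner (𝕜 := ℝ) u u

theorem expWeight_cancel (k : ℝ) (u : Lp V 2 (timeMeasure T)) :
    expWeight T k (expWeight T (-k) u) = u := by
  refine Lp.ext ?_
  filter_upwards [coeFn_expWeight k (expWeight T (-k) u), coeFn_expWeight (-k) u] with s h1 h2
  rw [h1, h2, smul_smul, ← Real.exp_add]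
  simp

theorem exp_le_of_mem {k s : ℝ} (hk : 0 ≤ k) (hs : s ∈ Ioc 0 T) :
    Real.exp (-(k * T)) ≤ Real.exp (-(k * s)) ∧ Real.exp (-(k * s)) ≤ 1 := by
  constructor
  · exact Real.exp_le_exp.2 (by nlinarith [hs.2])
  · exact Real.exp_le_one_iff.2 (by nlinarith [hs.1])

/-- `∫ e^{-ks} ⟪u, v⟫` as an inner product. -/
theorem inner_expWeight (k : ℝ) (u v : Lp V 2 (timeMeasure T)) :
    ⟪u, expWeight T k v⟫ = ∫ s, Real.exp (-(k * s)) * ⟪u s, v s⟫ ∂timeMeasure T := by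
  rw [L2.inner_def]
  refine integral_congr_ae ?_
  filter_upwards [coeFn_expWeight k v] with s h1
  rw [h1, inner_smul_right]

theorem integrable_expWeight (k : ℝ) (u v : Lp V 2 (timeMeasure T)) :
    Integrable (fun s => Real.exp (-(k * s)) * ⟪u s, v s⟫) (timeMeasure T) := by
  refine (L2.integrable_inner (𝕜 := ℝ) u (expWeight T k v)).congr ?_
  filter_upwards [coeFn_expWeight k v] with s h1
  rw [h1, inner_smul_right]

/-- The Gram operator `ι* ι` of the embedding. -/
def gram (ι : V →L[ℝ] H) : V →L[ℝ] V := (adjoint ι).comp ι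

theorem gram_inner (ι : V →L[ℝ] H) (u v : V) : ⟪gram ι u, v⟫ = ⟪ι u, ι v⟫ := by
  rw [gram, ContinuousLinearMap.comp_apply, ContinuousLinearMap.adjoint_inner_left]

variable (ι : V →L[ℝ] H) (𝔸 : Lp V 2 (timeMeasure T) →L[ℝ] Lp V 2 (timeMeasure T))

/-- The Gram operator acting on `L²(0,T;V)`. -/
def gramLp (T : ℝ) : Lp V 2 (timeMeasure T) →L[ℝ] Lp V 2 (timeMeasure T) :=
  (gram ι).compLpL 2 (timeMeasure T)

theorem coeFn_gramLp (u : Lp V 2 (timeMeasure T)) :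
    gramLp ι T u =ᵐ[timeMeasure T] fun s => gram ι (u s) := (gram ι).coeFn_compLpL u

/-- A Gårding inequality for an operator on `L²(0,T;V)`. -/
def Garding (α γ : ℝ) : Prop :=
  ∀ u : Lp V 2 (timeMeasure T), ∀ᵐ s ∂timeMeasure T,
    α * ‖u s‖ ^ 2 ≤ ⟪𝔸 u s, u s⟫ + γ * ‖ι (u s)‖ ^ 2

variable {ι 𝔸} {α γ : ℝ}

/-- Integrating the Gårding inequality against e^{-2γs}, which is at least e^{-2γT}, bounds the left
side of the hypothesis below by a positive multiple of ‖φ‖². -/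
theorem garding_weighted (hα : 0 < α) (hγ : 0 ≤ γ) (h𝔸 : Garding ι 𝔸 α γ)
    (φ : Lp V 2 (timeMeasure T))
    (hφ : γ * ⟪gramLp ι T φ, expWeight T (2 * γ) φ⟫ + ⟪𝔸 φ, expWeight T (2 * γ) φ⟫ ≤ 0) :
    φ = 0 := by
  have h1 : α * Real.exp (-(2 * γ * T)) * ‖φ‖ ^ 2 ≤
      γ * ⟪gramLp ι T φ, expWeight T (2 * γ) φ⟫ + ⟪𝔸 φ, expWeight T (2 * γ) φ⟫ := by
    rw [inner_expWeight, inner_expWeight, Lp_norm_sq, ← integral_const_mul, ← integral_const_mul,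
      ← integral_add ((integrable_expWeight _ _ _).const_mul _) (integrable_expWeight _ _ _)]
    refine integral_mono_ae ((Lp_integrable_norm_sq φ).const_mul _)
      (((integrable_expWeight _ _ _).const_mul _).fun_add (integrable_expWeight _ _ _)) ?_
    filter_upwards [h𝔸 φ, coeFn_gramLp ι φ, ae_restrict_mem measurableSet_Ioc] with s h1 h2 h3
    rw [h2, gram_inner, real_inner_self_eq_norm_sq]
    have h4 := (exp_le_of_mem (by positivity : 0 ≤ 2 * γ) h3).1
    have h5 : 0 ≤ α * ‖φ s‖ ^ 2 := by positivity
    have h6 := Real.exp_pos (-(2 * γ * s))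
    nlinarith [mul_le_mul_of_nonneg_right h4 h5, mul_le_mul_of_nonneg_left h1 h6.le]
  have h2 : ‖φ‖ ^ 2 ≤ 0 := by
    have h3 : 0 < α * Real.exp (-(2 * γ * T)) := by positivity
    by_contra! h
    nlinarith [mul_pos h3 h]
  exact norm_eq_zero.1 (pow_eq_zero_iff two_ne_zero |>.1 (le_antisymm h2 (by positivity)))

/-- This is `volterra_weighted_nonneg` for the path ι w. Taken with k = 2γ, the weight pays for the
γ-term of the Gårding inequality. -/
theorem gram_volterra_ge (hT : 0 ≤ T) (k : ℝ) (w : Lp V 2 (timeMeasure T)) :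
    k * ⟪gramLp ι T (volterra T w), expWeight T k (volterra T w)⟫
      ≤ 2 * ⟪gramLp ι T w, expWeight T k (volterra T w)⟫ := by
  have h := volterra_weighted_nonneg hT k (ι.compLpL 2 (timeMeasure T) w)
  rw [inner_expWeight, inner_expWeight, ← integral_const_mul, ← integral_const_mul, ← sub_nonneg,
    ← integral_sub ((integrable_expWeight _ _ _).const_mul _)
    ((integrable_expWeight _ _ _).const_mul _)]
  refine h.trans_eq (integral_congr_ae ?_)
  filter_upwards [coeFn_gramLp ι w, coeFn_gramLp ι (volterra T w), coeFn_volterra w,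
    ι.coeFn_compLpL w] with s h1 h2 h3 h4
  rw [h1, h2, h3, h4, gram_inner, gram_inner, ← map_prim, real_inner_self_eq_norm_sq]
  ring

theorem gram_weighted_nonneg (k : ℝ) (w : Lp V 2 (timeMeasure T)) :
    0 ≤ ⟪gramLp ι T w, expWeight T k w⟫ := by
  rw [inner_expWeight]
  refine integral_nonneg_of_ae ?_
  filter_upwards [coeFn_gramLp ι w] with s h1
  rw [h1, gram_inner, real_inner_self_eq_norm_sq]
  change 0 ≤ _
  positivity

/-- The sources `K w + 𝔸 (∫₀ᵗ w)` are dense in `L²(0,T;V)`. -/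
theorem denseRange_source (hT : 0 ≤ T) (hα : 0 < α) (hγ : 0 ≤ γ) (h𝔸 : Garding ι 𝔸 α γ) :
    DenseRange (gramLp ι T + 𝔸.comp (volterra T)) := by
  refine denseRange_of_orthogonal _ fun φ hφ => ?_
  -- Let S be the Volterra operator, K the Gram operator and e the weight e^{-2γs}, so that φ = eψ.
  -- If ψ were S w, orthogonality tested on w would give γ⟪Kψ, eψ⟫ + ⟪𝔸ψ, eψ⟫ ≤ 0 and hence ψ = 0.
  -- In general w solves εw + Sw = ψ with Sw close to ψ; the extra term ε⟪Kw, ew⟫ is nonnegative, so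
  -- γ⟪KSw, eSw⟫ + ⟪𝔸Sw, eψ⟫ ≤ 0, and this closed condition passes to the limit Sw → ψ.
  set ψ := expWeight T (-(2 * γ)) φ with hψ
  have hφψ : φ = expWeight T (2 * γ) ψ := (expWeight_cancel _ φ).symm
  have hcl := (isClosed_Iic (a := (0 : ℝ))).preimage
    (continuous_quadratic_add γ (gramLp ι T) (expWeight T (2 * γ)) 𝔸 (expWeight T (2 * γ) ψ))
  have hmem : ψ ∈ closure ((fun x => γ * ⟪gramLp ι T x, expWeight T (2 * γ) x⟫
      + ⟪𝔸 x, expWeight T (2 * γ) ψ⟫) ⁻¹' Iic 0) := by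
    refine Metric.mem_closure_iff.2 fun δ hδ => ?_
    have hd : DenseRange (volterra (V := V) T) := denseRange_volterra
    have hacc : ∀ u, 0 ≤ ⟪volterra (V := V) T u, u⟫ := fun u => volterra_accretive hT u
    obtain ⟨ε, hε, w, hw, hwδ⟩ := exists_resolvent_near (volterra (V := V) T) hacc hd ψ hδ
    refine ⟨volterra T w, ?_, by rwa [dist_comm, dist_eq_norm]⟩
    have h0 := hφ w
    rw [add_apply, ContinuousLinearMap.comp_apply, inner_add_left, hφψ] at h0
    have h1 : ⟪gramLp ι T w, expWeight T (2 * γ) ψ⟫ = ε * ⟪gramLp ι T w, expWeight T (2 * γ) w⟫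
        + ⟪gramLp ι T w, expWeight T (2 * γ) (volterra T w)⟫ := by
      rw [← hw, map_add, map_smul, inner_add_right, inner_smul_right]
    have h2 := gram_volterra_ge (ι := ι) hT (2 * γ) w
    have h3 := mul_nonneg hε.le (gram_weighted_nonneg (ι := ι) (2 * γ) w)
    rw [mem_preimage, mem_Iic]
    linarith
  rw [hcl.closure_eq] at hmem
  have := garding_weighted hα hγ h𝔸 ψ hmem
  rw [hφψ, this, map_zero]

/-- The path operator `(η, w) ↦ (t ↦ η + ∫₀ᵗ w)`. -/
def pathL (T : ℝ) : V × Lp V 2 (timeMeasure T) →L[ℝ] (ℝ →ᵇ V) :=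
  constB.comp (ContinuousLinearMap.fst ℝ _ _) + (prim T).comp (ContinuousLinearMap.snd ℝ _ _)

theorem pathL_apply (p : V × Lp V 2 (timeMeasure T)) : pathL T p = path T p.1 p.2 := rfl

variable (ι 𝔸)

/-- The data `(y(0), y' + 𝔸 y)` of the regular path `y = η + ∫₀ᵗ w`. -/
def dataL : V × Lp V 2 (timeMeasure T) →L[ℝ] H × Lp V 2 (timeMeasure T) :=
  (ι.comp (ContinuousLinearMap.fst ℝ _ _)).prod
    ((gramLp ι T).comp (ContinuousLinearMap.snd ℝ _ _) + 𝔸.comp ((bcfLp T).comp (pathL T)))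

/-- A regular path as an element of `C([0,T];H) × L²(0,T;V)`. -/
def solL (T : ℝ) : V × Lp V 2 (timeMeasure T) →L[ℝ] (ℝ →ᵇ H) × Lp V 2 (timeMeasure T) :=
  ((ι.compLeftContinuousBounded ℝ).comp (pathL T)).prod ((bcfLp T).comp (pathL T))

variable {ι 𝔸}

/-- The datum y(0) is approximated by the choice of η. The constant path η then only shifts the
source by 𝔸η, which is corrected by w using `denseRange_source`. -/
theorem denseRange_dataL (hT : 0 ≤ T) (hι : DenseRange ι) (hα : 0 < α) (hγ : 0 ≤ γ)
    (h𝔸 : Garding ι 𝔸 α γ) : DenseRange (dataL ι 𝔸) := by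
  rw [Metric.denseRange_iff]
  rintro ⟨y, F⟩ r hr
  obtain ⟨η, hη⟩ := Metric.denseRange_iff.1 hι y r hr
  obtain ⟨w, hw⟩ := Metric.denseRange_iff.1 (denseRange_source hT hα hγ h𝔸)
    (F - 𝔸 (bcfLp T (constB η))) r hr
  refine ⟨(η, w), ?_⟩
  rw [Prod.dist_eq]
  refine max_lt hη ?_
  refine lt_of_eq_of_lt ?_ hw
  rw [dist_eq_norm, dist_eq_norm]
  congr 1
  simp only [dataL, ContinuousLinearMap.prod_apply, add_apply, ContinuousLinearMap.comp_apply,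
    pathL, map_add, volterra, ContinuousLinearMap.coe_fst', ContinuousLinearMap.coe_snd']
  abel

/-- The energy estimate for regular paths. -/
theorem energy_estimate (hα : 0 < α) (hγ : 0 ≤ γ) (h𝔸 : Garding ι 𝔸 α γ)
    (p : V × Lp V 2 (timeMeasure T)) {t : ℝ} (ht : t ∈ Icc 0 T) :
    Real.exp (-(2 * γ * T)) * (‖ι (pathL T p t)‖ ^ 2 + α * ∫ s in (0 : ℝ)..t, ‖pathL T p s‖ ^ 2)
      ≤ ‖(dataL ι 𝔸 p).1‖ ^ 2 + α⁻¹ * ‖(dataL ι 𝔸 p).2‖ ^ 2 := by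
  obtain ⟨η, w⟩ := p
  set F := (dataL ι 𝔸 (η, w)).2 with hF
  set Y := bcfLp T (path T η w) with hY
  have hFeq : F = gramLp ι T w + 𝔸 Y := rfl
  have hpath : ∀ s, path T (gram ι η) (gramLp ι T w) s = gram ι (path T η w s) := fun s => by
    rw [path_apply, path_apply, map_add, map_prim]; rfl
  -- The pairing of ι*ι y with y is ‖ι y‖², so this is the balance of e^{-2γs}‖ι y(s)‖². The term
  -- -2γ‖ι y‖² produced by the weight cancels the defect in the Gårding inequality, and Young's
  -- inequality for 2⟪F, y⟫ uses up one of the two copies of α‖y‖².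
  have hpr := product_rule_upTo (2 * γ) (gram ι η) η (gramLp ι T w) w ht
  simp only [hpath, gram_inner, real_inner_self_eq_norm_sq] at hpr
  have hle := timeMeasure_mono ht.2
  have hint : ∀ u : Lp V 2 (timeMeasure T), IntervalIntegrable (fun s => ‖u s‖ ^ 2) volume 0 t :=
    fun u => (intervalIntegrable_iff_integrableOn_Ioc_of_le ht.1).2
      ((Lp_integrable_norm_sq u).mono_measure hle)
  have hpc : IntervalIntegrable (fun s => ‖path T η w s‖ ^ 2) volume 0 t :=
    Continuous.intervalIntegrable (by fun_prop) _ _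
  have hI : Integrable (fun s => Real.exp (-(2 * γ * s)) * (⟪gramLp ι T w s, path T η w s⟫
      + ⟪ι (path T η w s), ι (w s)⟫ - 2 * γ * ‖ι (path T η w s)‖ ^ 2)) (timeMeasure T) := by
    refine (((integrable_expWeight (2 * γ) (gramLp ι T w) Y).fun_add
      (integrable_expWeight (2 * γ) (gramLp ι T Y) w)).sub
      ((integrable_expWeight (2 * γ) (gramLp ι T Y) Y).const_mul (2 * γ))).congr ?_
    filter_upwards [coeFn_gramLp ι w, coeFn_gramLp ι Y, coeFn_bcfLp (T := T) (path T η w)]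
      with s h1 h2 h3
    rw [← hY] at h3
    simp only [Pi.sub_apply, h1, h2, h3, gram_inner, real_inner_self_eq_norm_sq]
    ring
  have hmono : ∫ s in (0 : ℝ)..t, Real.exp (-(2 * γ * s)) * (⟪gramLp ι T w s, path T η w s⟫
      + ⟪ι (path T η w s), ι (w s)⟫ - 2 * γ * ‖ι (path T η w s)‖ ^ 2)
      ≤ ∫ s in (0 : ℝ)..t, (α⁻¹ * ‖F s‖ ^ 2
        - α * Real.exp (-(2 * γ * T)) * ‖path T η w s‖ ^ 2) := by
    rw [intervalIntegral.integral_of_le ht.1, intervalIntegral.integral_of_le ht.1]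
    refine integral_mono_ae (hI.mono_measure hle)
      (((hint F).const_mul _).sub (hpc.const_mul _)).1 ?_
    refine Filter.Eventually.filter_mono (ae_mono hle) ?_
    filter_upwards [coeFn_gramLp ι w, coeFn_bcfLp (T := T) (path T η w), h𝔸 Y,
      Lp.coeFn_add (gramLp ι T w) (𝔸 Y), ae_restrict_mem measurableSet_Ioc] with s h1 h2 h3 h4 h5
    rw [← hFeq, Pi.add_apply] at h4
    rw [hY, h2, ← hY] at h3
    have h6 : ⟪gramLp ι T w s, path T η w s⟫ = ⟪F s, path T η w s⟫ - ⟪𝔸 Y s, path T η w s⟫ := by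
      rw [h4, inner_add_left]; ring
    have h7 : ⟪ι (path T η w s), ι (w s)⟫ = ⟪gramLp ι T w s, path T η w s⟫ := by
      rw [h1, gram_inner, real_inner_comm]
    rw [h7, h6]
    obtain ⟨he1, he2⟩ := exp_le_of_mem (by positivity : 0 ≤ 2 * γ) h5
    have h8 : 2 * ⟪F s, path T η w s⟫ ≤ α⁻¹ * ‖F s‖ ^ 2 + α * ‖path T η w s‖ ^ 2 := by
      have h9 := real_inner_le_norm (F s) (path T η w s)
      have h10 : α⁻¹ * ‖F s‖ ^ 2 + α * ‖path T η w s‖ ^ 2 - 2 * (‖F s‖ * ‖path T η w s‖)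
          = α⁻¹ * (‖F s‖ - α * ‖path T η w s‖) ^ 2 := by field_simp; ring
      have : 0 ≤ α⁻¹ * (‖F s‖ - α * ‖path T η w s‖) ^ 2 := by positivity
      linarith
    have h11 : 0 ≤ α⁻¹ * ‖F s‖ ^ 2 := by positivity
    have h12 : 0 ≤ α * ‖path T η w s‖ ^ 2 := by positivity
    have h13 := (Real.exp_pos (-(2 * γ * s))).le
    calc _ ≤ Real.exp (-(2 * γ * s)) * (α⁻¹ * ‖F s‖ ^ 2 - α * ‖path T η w s‖ ^ 2) :=
          mul_le_mul_of_nonneg_left (by linarith) h13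
      _ ≤ _ := by nlinarith [mul_le_mul_of_nonneg_right he1 h12, mul_le_mul_of_nonneg_right he2 h11]
  rw [← hpr, intervalIntegral.integral_sub ((hint F).const_mul _) (hpc.const_mul _),
    intervalIntegral.integral_const_mul, intervalIntegral.integral_const_mul] at hmono
  have hFle : ∫ s in (0 : ℝ)..t, ‖F s‖ ^ 2 ≤ ‖F‖ ^ 2 := by
    rw [Lp_norm_sq, intervalIntegral.integral_of_le ht.1]
    exact integral_mono_measure hle (Filter.Eventually.of_forall fun _ => by positivity)
      (Lp_integrable_norm_sq F)
  have he : Real.exp (-(2 * γ * T)) ≤ Real.exp (-(2 * γ * t)) :=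
    Real.exp_le_exp.2 (by nlinarith [ht.2])
  have h1 := mul_le_mul_of_nonneg_right he (sq_nonneg ‖ι (path T η w t)‖)
  have h2 := mul_le_mul_of_nonneg_left hFle (inv_nonneg.2 hα.le)
  change Real.exp (-(2 * γ * T)) * (‖ι (path T η w t)‖ ^ 2
    + α * ∫ s in (0 : ℝ)..t, ‖path T η w s‖ ^ 2) ≤ ‖ι η‖ ^ 2 + α⁻¹ * ‖F‖ ^ 2
  linarith

/-- This bound makes the path depend only on its data, and continuously so; it is the condition for
extending `solL` from the dense range of `dataL`. -/
theorem norm_solL_le (hT : 0 ≤ T) (hα : 0 < α) (hγ : 0 ≤ γ) (h𝔸 : Garding ι 𝔸 α γ) :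
    ∃ C, ∀ p, ‖solL ι T p‖ ≤ C * ‖dataL ι 𝔸 p‖ := by
  set e := Real.exp (-(2 * γ * T))
  have he : 0 < e := Real.exp_pos _
  set D := (1 + α⁻¹) / e * (1 + α⁻¹)
  have hα' : 0 < α⁻¹ := inv_pos.2 hα
  refine ⟨Real.sqrt D, fun p => ?_⟩
  have hd1 : ‖(dataL ι 𝔸 p).1‖ ≤ ‖dataL ι 𝔸 p‖ := norm_fst_le _
  have hd2 : ‖(dataL ι 𝔸 p).2‖ ≤ ‖dataL ι 𝔸 p‖ := norm_snd_le _
  set N := ‖dataL ι 𝔸 p‖ with hN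
  have hrhs : ‖(dataL ι 𝔸 p).1‖ ^ 2 + α⁻¹ * ‖(dataL ι 𝔸 p).2‖ ^ 2 ≤ (1 + α⁻¹) * N ^ 2 := by
    have h1 := pow_le_pow_left₀ (norm_nonneg _) hd1 2
    have h2 := mul_le_mul_of_nonneg_left (pow_le_pow_left₀ (norm_nonneg _) hd2 2) hα'.le
    linarith
  have hsq : ∀ x : ℝ, 0 ≤ x → x ^ 2 ≤ D * N ^ 2 → x ≤ Real.sqrt D * N := by
    intro x hx h
    rw [← Real.sqrt_sq hx]
    refine (Real.sqrt_le_sqrt h).trans_eq ?_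
    rw [Real.sqrt_mul (by positivity), Real.sqrt_sq (norm_nonneg _)]
  have hDpos : 0 ≤ Real.sqrt D * N := by positivity
  have hD1 : (1 + α⁻¹) / e ≤ D := le_mul_of_one_le_right (by positivity) (by linarith)
  have hD2 : (1 + α⁻¹) / e * α⁻¹ ≤ D := mul_le_mul_of_nonneg_left (by linarith) (by positivity)
  have hpt : ∀ t ∈ Icc 0 T, ‖ι (pathL T p t)‖ ≤ Real.sqrt D * N := by
    intro t ht
    refine hsq _ (norm_nonneg _) ?_
    have h1 := (energy_estimate hα hγ h𝔸 p ht).trans hrhs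
    have h2 : 0 ≤ α * ∫ s in (0 : ℝ)..t, ‖pathL T p s‖ ^ 2 :=
      mul_nonneg hα.le (intervalIntegral.integral_nonneg ht.1 fun _ _ => by positivity)
    have h3 : ‖ι (pathL T p t)‖ ^ 2 ≤ (1 + α⁻¹) / e * N ^ 2 := by
      rw [div_mul_eq_mul_div, le_div_iff₀ he]
      nlinarith
    exact h3.trans (mul_le_mul_of_nonneg_right hD1 (sq_nonneg _))
  refine max_le ?_ ?_
  · refine (BoundedContinuousFunction.norm_le hDpos).2 fun t => ?_
    change ‖ι (pathL T p t)‖ ≤ _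
    -- The norm is a supremum over all of ℝ, but paths are constant outside [0,T], where the energy
    -- estimate holds.
    have : pathL T p t = pathL T p (projIcc 0 T hT t) := by
      simp only [pathL_apply, path_apply]
      rw [prim_projIcc hT]
    rw [this]
    exact hpt _ (projIcc 0 T hT t).2
  · change ‖bcfLp T (pathL T p)‖ ≤ _
    refine hsq _ (norm_nonneg _) ?_
    have h1 := (energy_estimate hα hγ h𝔸 p (right_mem_Icc.2 hT)).trans hrhs
    have h2 : ‖bcfLp T (pathL T p)‖ ^ 2 = ∫ s in (0 : ℝ)..T, ‖pathL T p s‖ ^ 2 := by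
      rw [Lp_norm_sq, ← integral_timeMeasure hT]
      refine integral_congr_ae ?_
      filter_upwards [coeFn_bcfLp (T := T) (pathL T p)] with s hs
      rw [hs]
    rw [← h2] at h1
    have h3 : ‖bcfLp T (pathL T p)‖ ^ 2 ≤ (1 + α⁻¹) / e * α⁻¹ * N ^ 2 := by
      have h4 : e * (α * ‖bcfLp T (pathL T p)‖ ^ 2) ≤ (1 + α⁻¹) * N ^ 2 := by
        nlinarith [mul_nonneg he.le (sq_nonneg ‖ι (pathL T p T)‖)]
      calc ‖bcfLp T (pathL T p)‖ ^ 2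
          = (e * (α * ‖bcfLp T (pathL T p)‖ ^ 2)) * (α⁻¹ / e) := by field_simp
        _ ≤ ((1 + α⁻¹) * N ^ 2) * (α⁻¹ / e) := mul_le_mul_of_nonneg_right h4 (by positivity)
        _ = _ := by ring
    exact h3.trans (mul_le_mul_of_nonneg_right hD2 (sq_nonneg _))

/-- The solution operator of the abstract evolution equation. -/
theorem exists_solution_operator (hT : 0 ≤ T) (hι : DenseRange ι) (hα : 0 < α) (hγ : 0 ≤ γ)
    (h𝔸 : Garding ι 𝔸 α γ) :
    ∃ G : H × Lp V 2 (timeMeasure T) →L[ℝ] (ℝ →ᵇ H) × Lp V 2 (timeMeasure T),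
      (∀ p, G (dataL ι 𝔸 p) = solL ι T p) ∧
      (∀ e, bcfLp T (G e).1 = ι.compLpL 2 (timeMeasure T) (G e).2) ∧
      (∀ e, (G e).1 0 = e.1) ∧
      ∀ e t, adjoint ι ((G e).1 t) = adjoint ι e.1 + prim T (e.2 - 𝔸 (G e).2) t := by
  have hd := denseRange_dataL hT hι hα hγ h𝔸
  have hb := norm_solL_le hT hα hγ h𝔸
  -- G is the continuous extension of data ↦ path. Each property below is a closed condition on the
  -- data e, so it is checked only on regular paths, where it is immediate.
  set G := (solL ι T).toLinearMap.extendOfNorm (dataL ι 𝔸).toLinearMap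
  have hG : ∀ p, G (dataL ι 𝔸 p) = solL ι T p := fun p =>
    LinearMap.extendOfNorm_eq (f := (solL ι T).toLinearMap) (e := (dataL ι 𝔸).toLinearMap) hd hb p
  have hev : ∀ (t : ℝ), Continuous fun e => (G e).1 t := fun t =>
    (continuous_eval_const t).comp (continuous_fst.comp G.continuous)
  have hG2 : Continuous fun e => (G e).2 := continuous_snd.comp G.continuous
  refine ⟨G, hG, fun e => ?_, fun e => ?_, fun e t => ?_⟩
  · refine hd.induction_on (p := fun e => bcfLp T (G e).1 = ι.compLpL 2 (timeMeasure T) (G e).2) e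
      (isClosed_eq ((bcfLp T).continuous.comp (continuous_fst.comp G.continuous))
        ((ι.compLpL 2 (timeMeasure T)).continuous.comp hG2)) fun p => ?_
    rw [hG]
    refine Lp.ext ?_
    filter_upwards [coeFn_bcfLp (T := T) (solL ι T p).1, ι.coeFn_compLpL (solL ι T p).2,
      coeFn_bcfLp (T := T) (pathL T p)] with s h1 h2 h3
    rw [h1, h2]
    change ι (pathL T p s) = ι (bcfLp T (pathL T p) s)
    rw [h3]
  · refine hd.induction_on (p := fun e => (G e).1 0 = e.1) e
      (isClosed_eq (hev 0) continuous_fst) fun p => ?_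
    rw [hG]
    change ι (p.1 + prim T p.2 0) = ι p.1
    rw [prim_zero, add_zero]
  · refine hd.induction_on
      (p := fun e => adjoint ι ((G e).1 t) = adjoint ι e.1 + prim T (e.2 - 𝔸 (G e).2) t) e
      (isClosed_eq ((adjoint ι).continuous.comp (hev t))
        (((adjoint ι).continuous.comp continuous_fst).add ((continuous_eval_const t).comp
          ((prim T).continuous.comp (continuous_snd.sub (𝔸.continuous.comp hG2)))))) fun p => ?_
    rw [hG]
    change gram ι (p.1 + prim T p.2 t) = gram ι p.1
      + prim T (gramLp ι T p.2 + 𝔸 (bcfLp T (pathL T p)) - 𝔸 (bcfLp T (pathL T p))) t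
    rw [add_sub_cancel_right, map_add, map_prim]
    rfl

end Existence

/-! ### Time reversal -/

section Reverse

variable {V : Type*} [NormedAddCommGroup V] [InnerProductSpace ℝ V] [CompleteSpace V] {T : ℝ}

/-- Reflection carries (0,T] to [0,T), which differs from it by a null set. -/
theorem measurePreserving_reverse (T : ℝ) :
    MeasurePreserving (fun t => T - t) (timeMeasure T) (timeMeasure T) := by
  have h := (Measure.measurePreserving_sub_left (volume : Measure ℝ) T).restrict_preimage
    (measurableSet_Ioc (a := (0 : ℝ)) (b := T))
  have h2 : (fun t => T - t) ⁻¹' Ioc 0 T = Ico 0 T := by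
    ext t; simp only [mem_preimage, mem_Ioc, mem_Ico]; constructor <;> intro h <;>
      constructor <;> linarith [h.1, h.2]
  rw [h2] at h
  rwa [timeMeasure, Measure.restrict_congr_set (Ico_ae_eq_Ioc (μ := volume)).symm,
    Measure.restrict_congr_set (Ico_ae_eq_Ioc (μ := volume))] at *

/-- Time reversal on `L²(0,T;V)`. -/
def rev (T : ℝ) : Lp V 2 (timeMeasure T) →L[ℝ] Lp V 2 (timeMeasure T) :=
  (Lp.compMeasurePreservingₗᵢ ℝ (fun t => T - t)
    (measurePreserving_reverse T)).toContinuousLinearMap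

theorem coeFn_rev (u : Lp V 2 (timeMeasure T)) : rev T u =ᵐ[timeMeasure T] fun t => u (T - t) :=
  Lp.coeFn_compMeasurePreserving u (measurePreserving_reverse T)

theorem ae_reverse {p : ℝ → Prop} (h : ∀ᵐ t ∂timeMeasure T, p t) :
    ∀ᵐ t ∂timeMeasure T, p (T - t) :=
  (measurePreserving_reverse T).quasiMeasurePreserving.ae h

theorem rev_rev (u : Lp V 2 (timeMeasure T)) : rev T (rev T u) = u := by
  refine Lp.ext ?_
  filter_upwards [coeFn_rev (rev T u), ae_reverse (coeFn_rev u)] with s h1 h2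
  rw [h1, h2, sub_sub_cancel]

theorem prim_rev (w : Lp V 2 (timeMeasure T)) {s : ℝ} (hs : s ∈ Icc 0 T) :
    prim T (rev T w) s = prim T w T - prim T w (T - s) := by
  have hs' : T - s ∈ Icc 0 T := ⟨by linarith [hs.2], by linarith [hs.1]⟩
  have hi := Lp_integrable w
  have h1 : prim T (rev T w) s = ∫ r in (0 : ℝ)..s, w (T - r) := by
    rw [← setIntegral_timeMeasure le_rfl hs.1 hs.2, prim_apply]
    exact intervalIntegral.integral_congr_ae ((coeFn_rev w).mono fun r hr _ => hr)
  rw [h1, intervalIntegral.integral_comp_sub_left (fun r => w r), sub_zero, prim_apply, prim_apply,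
    intervalIntegral.integral_interval_sub_left hi.intervalIntegrable hi.intervalIntegrable,
    setIntegral_timeMeasure hs'.1 hs'.2 le_rfl]

end Reverse

/-! ### Duality with the adjoint equation and uniqueness -/

section Duality

variable {V H : Type*} [NormedAddCommGroup V] [InnerProductSpace ℝ V] [CompleteSpace V]
  [NormedAddCommGroup H] [InnerProductSpace ℝ H] [CompleteSpace H] {T : ℝ}
  {ι : V →L[ℝ] H} {A : V →L[ℝ] V} {α γ : ℝ}

/-- The action of a fixed operator on `L²(0,T;V)`. -/
abbrev opLp (A : V →L[ℝ] V) (T : ℝ) : Lp V 2 (timeMeasure T) →L[ℝ] Lp V 2 (timeMeasure T) :=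
  A.compLpL 2 (timeMeasure T)

/-- A Gårding inequality for an operator on `V`. -/
def GardingOp (ι : V →L[ℝ] H) (A : V →L[ℝ] V) (α γ : ℝ) : Prop :=
  ∀ v, α * ‖v‖ ^ 2 ≤ ⟪A v, v⟫ + γ * ‖ι v‖ ^ 2

theorem GardingOp.opLp (h : GardingOp ι A α γ) : Garding ι (opLp A T) α γ := fun u => by
  filter_upwards [A.coeFn_compLpL u] with s hs
  rw [hs]
  exact h _

theorem GardingOp.dual (h : GardingOp ι A α γ) : GardingOp ι (adjoint A) α γ := fun v => by
  rw [ContinuousLinearMap.adjoint_inner_left, real_inner_comm]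
  exact h v

/-- `ι* y(t) + ∫₀ᵗ A Y = ι* y₀ + ∫₀ᵗ F` for `t ∈ [0,T]`, with `ι Y = y`. -/
structure IsMild (ι : V →L[ℝ] H) (A : V →L[ℝ] V) (T : ℝ) (y₀ : H) (F : Lp V 2 (timeMeasure T))
    (y : ℝ → H) (Y : Lp V 2 (timeMeasure T)) : Prop where
  coe : ∀ᵐ t ∂timeMeasure T, ι (Y t) = y t
  eqn : ∀ t ∈ Icc 0 T, adjoint ι (y t) = adjoint ι y₀ + prim T (F - opLp A T Y) t

/-- The unweighted product rule for ι*y(s) and the reversed regular path φ(T - s). The second factor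
is differentiable with values in V, so only the integrated equation of y is needed and no further
regularity of y. Moving A across the inner product produces the adjoint data of φ. -/
theorem IsMild.duality_regular (hT : 0 ≤ T) {y₀ : H} {F Y : Lp V 2 (timeMeasure T)} {y : ℝ → H}
    (h : IsMild ι A T y₀ F y Y) (p : V × Lp V 2 (timeMeasure T)) :
    ⟪y T, (dataL ι (opLp (adjoint A) T) p).1⟫ + ⟪Y, rev T (dataL ι (opLp (adjoint A) T) p).2⟫
      = ⟪y₀, (solL ι T p).1 T⟫ + ⟪F, rev T (solL ι T p).2⟫ := by
  obtain ⟨θ, w⟩ := p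
  set φ := path T θ w with hφ
  set Φ := bcfLp T φ with hΦ
  set m := F - opLp A T Y with hm
  have hpath : ∀ s ∈ Icc 0 T, path T (φ T) (-(rev T w)) s = φ (T - s) := fun s hs => by
    rw [path_apply, map_neg, BoundedContinuousFunction.neg_apply, prim_rev w hs, hφ, path_apply,
      path_apply]
    abel
  have hy : ∀ s ∈ Icc 0 T, path T (adjoint ι y₀) m s = adjoint ι (y s) := fun s hs => by
    rw [path_apply, h.eqn s hs]
  have hTm : T ∈ Icc 0 T := right_mem_Icc.2 hT
  have hpr := product_rule hT 0 (adjoint ι y₀) (φ T) m (-(rev T w))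
  rw [hpath T hTm, hy T hTm, sub_self] at hpr
  have h0 : φ 0 = θ := by rw [hφ, path_apply, prim_zero, add_zero]
  have hr : ∫ s, Real.exp (-(0 * s)) * (⟪m s, path T (φ T) (-(rev T w)) s⟫
      + ⟪path T (adjoint ι y₀) m s, (-(rev T w) : Lp V 2 (timeMeasure T)) s⟫
      - 0 * ⟪path T (adjoint ι y₀) m s, path T (φ T) (-(rev T w)) s⟫) ∂timeMeasure T
      = ⟪m, rev T Φ⟫ - ⟪Y, rev T (gramLp ι T w)⟫ := by
    rw [L2.inner_def, L2.inner_def, ← integral_sub (L2.integrable_inner (𝕜 := ℝ) _ _)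
      (L2.integrable_inner (𝕜 := ℝ) _ _)]
    refine integral_congr_ae ?_
    filter_upwards [coeFn_rev Φ, ae_reverse (coeFn_bcfLp (T := T) φ), coeFn_rev (gramLp ι T w),
      ae_reverse (coeFn_gramLp ι w), Lp.coeFn_neg (rev T w), coeFn_rev w, h.coe,
      ae_restrict_mem measurableSet_Ioc] with s h1 h2 h3 h4 h5 h6 h7 h8
    have h8 := Ioc_subset_Icc_self h8
    rw [hpath s h8, hy s h8, h1, h2, h3, h4, h5, Pi.neg_apply, h6, ← h7, inner_neg_right,
      ← real_inner_comm (Y s), gram_inner, ContinuousLinearMap.adjoint_inner_left,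
      real_inner_comm (ι (w (T - s)))]
    simp
    ring
  rw [hr, h0] at hpr
  have hA : ⟪opLp A T Y, rev T Φ⟫ = ⟪Y, rev T (opLp (adjoint A) T Φ)⟫ := by
    rw [L2.inner_def, L2.inner_def]
    refine integral_congr_ae ?_
    filter_upwards [A.coeFn_compLpL Y, coeFn_rev Φ, coeFn_rev (opLp (adjoint A) T Φ),
      ae_reverse ((adjoint A).coeFn_compLpL Φ)] with s h1 h2 h3 h4
    rw [h1, h2, h3, h4, ContinuousLinearMap.adjoint_inner_right]
  rw [hm, inner_sub_left, hA, ContinuousLinearMap.adjoint_inner_left,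
    ContinuousLinearMap.adjoint_inner_left] at hpr
  change ⟪y T, ι θ⟫ + ⟪Y, rev T (gramLp ι T w + opLp (adjoint A) T Φ)⟫
    = ⟪y₀, ι (φ T)⟫ + ⟪F, rev T Φ⟫
  rw [map_add, inner_add_right]
  simp only [zero_mul, neg_zero, Real.exp_zero, one_mul] at hpr
  linarith

/-- The standing assumptions: the embedding has dense range and the operator satisfies a Gårding
inequality. -/
structure IsParabolic (ι : V →L[ℝ] H) (A : V →L[ℝ] V) : Prop where
  dense : DenseRange ι
  garding : ∃ α γ : ℝ, 0 < α ∧ 0 ≤ γ ∧ GardingOp ι A α γ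

theorem IsParabolic.dual (h : IsParabolic ι A) : IsParabolic ι (adjoint A) :=
  ⟨h.dense, h.garding.imp fun _ ⟨γ, h1, h2, h3⟩ => ⟨γ, h1, h2, h3.dual⟩⟩

theorem adjoint_injective (hι : DenseRange ι) {x y : H} (h : adjoint ι x = adjoint ι y) :
    x = y := by
  refine hι.eq_of_inner_left (𝕜 := ℝ) fun v => ?_
  rw [← ContinuousLinearMap.adjoint_inner_left, h, ContinuousLinearMap.adjoint_inner_left]

theorem IsParabolic.exists_operator (hP : IsParabolic ι A) (hT : 0 ≤ T) :
    ∃ G : H × Lp V 2 (timeMeasure T) →L[ℝ] (ℝ →ᵇ H) × Lp V 2 (timeMeasure T),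
      (∀ p, G (dataL ι (opLp A T) p) = solL ι T p) ∧ DenseRange (dataL ι (opLp A T)) ∧
      (∀ e, (G e).1 0 = e.1) ∧ ∀ e, IsMild ι A T e.1 e.2 (G e).1 (G e).2 := by
  obtain ⟨α, γ, hα, hγ, hA⟩ := hP.garding
  obtain ⟨G, h1, h2, h3, h4⟩ := exists_solution_operator hT hP.dense hα hγ (hA.opLp (T := T))
  refine ⟨G, h1, denseRange_dataL hT hP.dense hα hγ hA.opLp, h3, fun e => ⟨?_, fun t _ => h4 e t⟩⟩
  have h5 := coeFn_bcfLp (T := T) (G e).1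
  rw [h2 e] at h5
  filter_upwards [h5, ι.coeFn_compLpL (G e).2] with s h6 h7
  rw [← h7, h6]

theorem IsMild.sub {y₀ y₀' : H} {F F' Y Y' : Lp V 2 (timeMeasure T)} {y y' : ℝ → H}
    (h : IsMild ι A T y₀ F y Y) (h' : IsMild ι A T y₀' F' y' Y') :
    IsMild ι A T (y₀ - y₀') (F - F') (fun t => y t - y' t) (Y - Y') where
  coe := by
    filter_upwards [h.coe, h'.coe, Lp.coeFn_sub Y Y'] with t h1 h2 h3
    rw [h3, Pi.sub_apply, map_sub, h1, h2]
  eqn t ht := by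
    have h3 : F - F' - opLp A T (Y - Y') = (F - opLp A T Y) - (F' - opLp A T Y') := by
      rw [map_sub]; abel
    rw [map_sub, map_sub, h.eqn t ht, h'.eqn t ht, h3]
    generalize F - opLp A T Y = m
    generalize F' - opLp A T Y' = m'
    rw [map_sub, BoundedContinuousFunction.sub_apply]
    abel

/-- Duality between a solution and the solution operator of the adjoint equation. -/
theorem IsMild.duality_operator (hP : IsParabolic ι A) (hT : 0 ≤ T) :
    ∃ G : H × Lp V 2 (timeMeasure T) →L[ℝ] (ℝ →ᵇ H) × Lp V 2 (timeMeasure T),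
      (∀ e, IsMild ι (adjoint A) T e.1 e.2 (G e).1 (G e).2) ∧
      ∀ {y₀ : H} {F Y : Lp V 2 (timeMeasure T)} {y : ℝ → H}, IsMild ι A T y₀ F y Y →
      ∀ e, ⟪y T, e.1⟫ + ⟪Y, rev T e.2⟫ = ⟪y₀, (G e).1 T⟫ + ⟪F, rev T (G e).2⟫ := by
  obtain ⟨G, h1, h2, h3, h4⟩ := hP.dual.exists_operator hT
  refine ⟨G, h4, fun {y₀ F Y y} h e => ?_⟩
  have hev : Continuous fun e => (G e).1 T :=
    (continuous_eval_const T).comp (continuous_fst.comp G.continuous)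
  have hG2 : Continuous fun e => rev T (G e).2 :=
    (rev T).continuous.comp (continuous_snd.comp G.continuous)
  have hr : Continuous fun e : H × Lp V 2 (timeMeasure T) => rev T e.2 :=
    (rev T).continuous.comp continuous_snd
  refine h2.induction_on (p := fun e => ⟪y T, e.1⟫ + ⟪Y, rev T e.2⟫
    = ⟪y₀, (G e).1 T⟫ + ⟪F, rev T (G e).2⟫) e (isClosed_eq
      ((continuous_const.inner continuous_fst).add (continuous_const.inner hr))
      ((continuous_const.inner hev).add (continuous_const.inner hG2))) fun p => ?_
  rw [h1]
  exact h.duality_regular hT p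

/-- The difference of two solutions has zero data. Pairing it with the adjoint solution whose source
is its own time reversal gives ‖Y - Y'‖² = 0; the integrated equation then gives ι*(y - y') = 0, and
ι* is injective because ι has dense range. -/
theorem IsMild.unique (hP : IsParabolic ι A) (hT : 0 ≤ T) {y₀ : H}
    {F Y Y' : Lp V 2 (timeMeasure T)} {y y' : ℝ → H} (h : IsMild ι A T y₀ F y Y)
    (h' : IsMild ι A T y₀ F y' Y') : Y = Y' ∧ ∀ t ∈ Icc 0 T, y t = y' t := by
  obtain ⟨G, -, hG⟩ := IsMild.duality_operator hP hT
  have hd := h.sub h'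
  have hY : Y - Y' = 0 := by
    have h1 := hG hd (0, rev T (Y - Y'))
    simp only [sub_self, inner_zero_left, inner_zero_right, zero_add, rev_rev] at h1
    exact inner_self_eq_zero.1 h1
  refine ⟨sub_eq_zero.1 hY, fun t ht => ?_⟩
  have h2 := hd.eqn t ht
  rw [hY] at h2
  simp only [sub_self, map_zero, BoundedContinuousFunction.coe_zero, Pi.zero_apply,
    add_zero] at h2
  exact sub_eq_zero.1 (adjoint_injective hP.dense (by rw [h2, map_zero]))

/-- By uniqueness the adjoint solution is the one given by the solution operator, for which duality
is known. -/
theorem IsMild.duality (hP : IsParabolic ι A) (hT : 0 ≤ T) {y₀ z₀ : H}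
    {F Y K Z : Lp V 2 (timeMeasure T)} {y z : ℝ → H} (h : IsMild ι A T y₀ F y Y)
    (h' : IsMild ι (adjoint A) T z₀ K z Z) :
    ⟪y T, z₀⟫ + ⟪Y, rev T K⟫ = ⟪y₀, z T⟫ + ⟪F, rev T Z⟫ := by
  obtain ⟨G, hG1, hG2⟩ := IsMild.duality_operator hP hT
  obtain ⟨h1, h2⟩ := h'.unique hP.dual hT (hG1 (z₀, K))
  rw [h1, h2 T (right_mem_Icc.2 hT)]
  exact hG2 h (z₀, K)

end Duality

/-! ### Weak solutions tested against elements of V -/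

section Weak

variable {V H : Type*} [NormedAddCommGroup V] [InnerProductSpace ℝ V] [CompleteSpace V]
  [NormedAddCommGroup H] [InnerProductSpace ℝ H] [CompleteSpace H] {T : ℝ}
  {ι : V →L[ℝ] H} {A : V →L[ℝ] V}

/-- Weak solutions of `y' + A y = g`, `y(0) = y₀` on `[0,T]`. -/
structure IsWeak (ι : V →L[ℝ] H) (A : V →L[ℝ] V) (T : ℝ) (g : ℝ → H) (y₀ : H) (y : ℝ → H) :
    Prop where
  source_memLp : MemLp g 2 (timeMeasure T)
  continuousOn : ContinuousOn y (Icc 0 T)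
  initial : y 0 = y₀
  weak : ∃ Y : Lp V 2 (timeMeasure T), (∀ᵐ t ∂timeMeasure T, ι (Y t) = y t) ∧
    ∀ v, ∀ t ∈ Icc 0 T, ⟪y t, ι v⟫ - ⟪y₀, ι v⟫ + ∫ s in (0 : ℝ)..t, ⟪A (Y s), v⟫
      = ∫ s in (0 : ℝ)..t, ⟪g s, ι v⟫

theorem inner_prim (u : Lp V 2 (timeMeasure T)) (v : V) {t : ℝ} (ht : t ∈ Icc 0 T) :
    ⟪prim T u t, v⟫ = ∫ s in (0 : ℝ)..t, ⟪u s, v⟫ := by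
  rw [prim_apply, ← setIntegral_timeMeasure le_rfl ht.1 ht.2]
  have := ((innerSL ℝ) v).intervalIntegral_comp_comm (a := 0) (b := t) (μ := timeMeasure T)
    (Lp_integrable u).intervalIntegrable
  simp only [innerSL_apply_apply] at this
  rw [real_inner_comm, ← this]
  simp only [real_inner_comm v]

/-- The functional `v ↦ ⟪g, ι v⟫` as an element of `L²(0,T;V)`. -/
def sourceLp (ι : V →L[ℝ] H) {g : ℝ → H} (hg : MemLp g 2 (timeMeasure T)) :
    Lp V 2 (timeMeasure T) :=
  (adjoint ι).compLpL 2 (timeMeasure T) (hg.toLp g)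

theorem coeFn_sourceLp (ι : V →L[ℝ] H) {g : ℝ → H} (hg : MemLp g 2 (timeMeasure T)) :
    sourceLp ι hg =ᵐ[timeMeasure T] fun t => adjoint ι (g t) := by
  filter_upwards [(adjoint ι).coeFn_compLpL (hg.toLp g), hg.coeFn_toLp] with t h1 h2
  rw [sourceLp, h1, h2]

theorem inner_prim_sub {g : ℝ → H} (hg : MemLp g 2 (timeMeasure T))
    (Y : Lp V 2 (timeMeasure T)) (v : V) {t : ℝ} (ht : t ∈ Icc 0 T) :
    ⟪prim T (sourceLp ι hg - opLp A T Y) t, v⟫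
      = (∫ s in (0 : ℝ)..t, ⟪g s, ι v⟫) - ∫ s in (0 : ℝ)..t, ⟪A (Y s), v⟫ := by
  rw [map_sub, BoundedContinuousFunction.sub_apply, inner_sub_left, inner_prim _ _ ht,
    inner_prim _ _ ht, ← setIntegral_timeMeasure le_rfl ht.1 ht.2,
    ← setIntegral_timeMeasure le_rfl ht.1 ht.2, ← setIntegral_timeMeasure le_rfl ht.1 ht.2,
    ← setIntegral_timeMeasure le_rfl ht.1 ht.2]
  congr 1 <;> refine intervalIntegral.integral_congr_ae ?_
  · filter_upwards [coeFn_sourceLp ι hg] with s hs _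
    rw [hs, ContinuousLinearMap.adjoint_inner_left]
  · filter_upwards [A.coeFn_compLpL Y] with s hs _
    rw [hs]

/-- Under the Riesz identification of V' with V, the equation tested against every v is a single
identity in V, with the source g represented by ι*g. -/
theorem isMild_iff {g : ℝ → H} (hg : MemLp g 2 (timeMeasure T)) {y₀ : H} {y : ℝ → H}
    {Y : Lp V 2 (timeMeasure T)} :
    IsMild ι A T y₀ (sourceLp ι hg) y Y ↔ (∀ᵐ t ∂timeMeasure T, ι (Y t) = y t) ∧
      ∀ v, ∀ t ∈ Icc 0 T, ⟪y t, ι v⟫ - ⟪y₀, ι v⟫ + ∫ s in (0 : ℝ)..t, ⟪A (Y s), v⟫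
        = ∫ s in (0 : ℝ)..t, ⟪g s, ι v⟫ := by
  constructor
  · rintro ⟨h1, h2⟩
    refine ⟨h1, fun v t ht => ?_⟩
    have h3 := congrArg (fun u => ⟪u, v⟫) (h2 t ht)
    simp only [inner_add_left, ContinuousLinearMap.adjoint_inner_left, inner_prim_sub hg Y v ht]
      at h3
    linarith
  · rintro ⟨h1, h2⟩
    refine ⟨h1, fun t ht => ext_inner_right ℝ fun v => ?_⟩
    rw [inner_add_left, ContinuousLinearMap.adjoint_inner_left,
      ContinuousLinearMap.adjoint_inner_left, inner_prim_sub hg Y v ht]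
    have := h2 v t ht
    linarith

theorem IsWeak.mild {g : ℝ → H} {y₀ : H} {y : ℝ → H} (h : IsWeak ι A T g y₀ y) :
    ∃ Y, IsMild ι A T y₀ (sourceLp ι h.source_memLp) y Y :=
  h.weak.imp fun _ hY => (isMild_iff h.source_memLp).2 hY

theorem IsWeak.unique (hP : IsParabolic ι A) (hT : 0 ≤ T) {g : ℝ → H} {y₀ : H} {y y' : ℝ → H}
    (h : IsWeak ι A T g y₀ y) (h' : IsWeak ι A T g y₀ y') : EqOn y y' (Icc 0 T) := by
  obtain ⟨Y, hY⟩ := h.mild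
  obtain ⟨Y', hY'⟩ := h'.mild
  exact (hY.unique hP hT hY').2

theorem IsWeak.duality (hP : IsParabolic ι A) (hT : 0 ≤ T) {g k : ℝ → H} {y₀ z₀ : H}
    {y z : ℝ → H} (h : IsWeak ι A T g y₀ y) (h' : IsWeak ι (adjoint A) T k z₀ z) :
    ⟪y T, z₀⟫ + ∫ t, ⟪y t, k (T - t)⟫ ∂timeMeasure T
      = ⟪y₀, z T⟫ + ∫ t, ⟪g t, z (T - t)⟫ ∂timeMeasure T := by
  obtain ⟨Y, hY⟩ := h.mild
  obtain ⟨Z, hZ⟩ := h'.mild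
  have hd := hY.duality hP hT hZ
  rw [L2.inner_def, L2.inner_def] at hd
  convert hd using 2 <;> refine integral_congr_ae ?_
  · filter_upwards [hY.coe, coeFn_rev (sourceLp ι h'.source_memLp),
      ae_reverse (coeFn_sourceLp ι h'.source_memLp)] with t h1 h2 h3
    rw [h2, h3, ContinuousLinearMap.adjoint_inner_right, h1]
  · filter_upwards [ae_reverse hZ.coe, coeFn_rev Z, coeFn_sourceLp ι h.source_memLp]
      with t h1 h2 h3
    rw [h2, h3, ContinuousLinearMap.adjoint_inner_left, h1]

theorem IsWeak.sub {g g' : ℝ → H} {y₀ y₀' : H} {y y' : ℝ → H} (h : IsWeak ι A T g y₀ y)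
    (h' : IsWeak ι A T g' y₀' y') :
    IsWeak ι A T (fun t => g t - g' t) (y₀ - y₀') (fun t => y t - y' t) := by
  obtain ⟨Y, hY⟩ := h.mild
  obtain ⟨Y', hY'⟩ := h'.mild
  have hg := h.source_memLp.sub h'.source_memLp
  have hs : sourceLp ι hg = sourceLp ι h.source_memLp - sourceLp ι h'.source_memLp := by
    rw [sourceLp, sourceLp, sourceLp, ← map_sub, ← MemLp.toLp_sub]
  refine ⟨hg, h.continuousOn.sub h'.continuousOn, by simp [h.initial, h'.initial], Y - Y', ?_⟩
  have := hY.sub hY'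
  rw [← hs] at this
  exact (isMild_iff hg).1 this

theorem IsWeak.congr {g g' : ℝ → H} {y₀ : H} {y : ℝ → H} (h : IsWeak ι A T g y₀ y)
    (hg : g =ᵐ[timeMeasure T] g') : IsWeak ι A T g' y₀ y := by
  obtain ⟨Y, h1, h2⟩ := h.weak
  refine ⟨h.source_memLp.ae_eq hg, h.continuousOn, h.initial, Y, h1, fun v t ht => ?_⟩
  rw [h2 v t ht, ← setIntegral_timeMeasure le_rfl ht.1 ht.2,
    ← setIntegral_timeMeasure le_rfl ht.1 ht.2]
  refine intervalIntegral.integral_congr_ae ?_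
  filter_upwards [hg] with s hs _
  rw [hs]

/-- The weak solution is given by a bounded linear operator of the initial datum and the source. -/
theorem IsParabolic.exists_weak (hP : IsParabolic ι A) (hT : 0 ≤ T) :
    ∃ S : H × Lp H 2 (timeMeasure T) →L[ℝ] (ℝ →ᵇ H), ∀ (y₀ : H) (g : Lp H 2 (timeMeasure T)), IsWeak ι A T g y₀ (S (y₀, g)) := by
  obtain ⟨G, -, -, h3, h4⟩ := hP.exists_operator hT
  refine ⟨(ContinuousLinearMap.fst ℝ _ _).comp (G.comp ((ContinuousLinearMap.fst ℝ _ _).prod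
    (((adjoint ι).compLpL 2 (timeMeasure T)).comp (ContinuousLinearMap.snd ℝ _ _)))),
    fun y₀ g => ?_⟩
  set e : H × Lp V 2 (timeMeasure T) := (y₀, (adjoint ι).compLpL 2 (timeMeasure T) g) with he
  have h5 := h4 e
  have h6 : e.2 = sourceLp ι (Lp.memLp g) := by rw [he, sourceLp, Lp.toLp_coeFn]
  rw [h6] at h5
  exact ⟨Lp.memLp g, (G e).1.continuous.continuousOn, h3 e, (G e).2, (isMild_iff _).1 h5⟩

/-- Stationary solutions. -/
theorem isWeak_const {u : V} {g : H} (h : ∀ v, ⟪A u, v⟫ = ⟪g, ι v⟫) :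
    IsWeak ι A T (fun _ => g) (ι u) (fun _ => ι u) := by
  refine ⟨memLp_const _, continuousOn_const, rfl, (memLp_const u).toLp _, ?_, fun v t ht => ?_⟩
  · filter_upwards [(memLp_const (μ := timeMeasure T) (p := 2) u).coeFn_toLp] with t h1
    rw [h1]
  · rw [sub_self, zero_add]
    rw [← setIntegral_timeMeasure le_rfl ht.1 ht.2, ← setIntegral_timeMeasure le_rfl ht.1 ht.2]
    refine intervalIntegral.integral_congr_ae ?_
    filter_upwards [(memLp_const (μ := timeMeasure T) (p := 2) u).coeFn_toLp] with t h1 _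
    rw [h1, h v]

end Weak

/-! ### Restriction, translation in time, and backward equations -/

section Shift

variable {V H : Type*} [NormedAddCommGroup V] [InnerProductSpace ℝ V] [CompleteSpace V]
  [NormedAddCommGroup H] [InnerProductSpace ℝ H] [CompleteSpace H] {T : ℝ}
  {ι : V →L[ℝ] H} {A : V →L[ℝ] V}

theorem IsWeak.restrict {g : ℝ → H} {y₀ : H} {y : ℝ → H} (h : IsWeak ι A T g y₀ y) {τ : ℝ}
    (hτ : τ ≤ T) : IsWeak ι A τ g y₀ y := by
  obtain ⟨Y, h1, h2⟩ := h.weak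
  have hle := timeMeasure_mono hτ
  have hY := (Lp.memLp Y).mono_measure hle
  refine ⟨h.source_memLp.mono_measure hle, h.continuousOn.mono (Icc_subset_Icc_right hτ),
    h.initial, hY.toLp Y, ?_, fun v t ht => ?_⟩
  · filter_upwards [hY.coeFn_toLp, h1.filter_mono (ae_mono hle)] with t h3 h4
    rw [h3, h4]
  · rw [← h2 v t ⟨ht.1, ht.2.trans hτ⟩, ← setIntegral_timeMeasure le_rfl ht.1 ht.2,
      ← setIntegral_timeMeasure le_rfl ht.1 ht.2]
    congr 1
    refine intervalIntegral.integral_congr_ae ?_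
    filter_upwards [hY.coeFn_toLp] with s hs _
    rw [hs]

theorem measurePreserving_shift (T t₀ : ℝ) :
    MeasurePreserving (fun s => t₀ + s) (timeMeasure (T - t₀))
      (volume.restrict (Ioc t₀ T)) := by
  have h := (measurePreserving_add_left (volume : Measure ℝ) t₀).restrict_preimage
    (measurableSet_Ioc (a := t₀) (b := T))
  have h2 : (fun s => t₀ + s) ⁻¹' Ioc t₀ T = Ioc 0 (T - t₀) := by
    ext t; simp only [mem_preimage, mem_Ioc]; constructor <;> intro h <;>
      constructor <;> linarith [h.1, h.2]
  rwa [h2] at h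

theorem restrict_le_timeMeasure {t₀ : ℝ} (ht₀ : 0 ≤ t₀) :
    (volume : Measure ℝ).restrict (Ioc t₀ T) ≤ timeMeasure T :=
  Measure.restrict_mono (Ioc_subset_Ioc_left ht₀) le_rfl

theorem ae_shift {p : ℝ → Prop} (h : ∀ᵐ t ∂timeMeasure T, p t) {t₀ : ℝ} (ht₀ : 0 ≤ t₀) :
    ∀ᵐ s ∂timeMeasure (T - t₀), p (t₀ + s) :=
  (measurePreserving_shift T t₀).quasiMeasurePreserving.ae
    (h.filter_mono (ae_mono (restrict_le_timeMeasure ht₀)))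

theorem memLp_shift {W : Type*} [NormedAddCommGroup W] {f : ℝ → W}
    (h : MemLp f 2 (timeMeasure T)) {t₀ : ℝ} (ht₀ : 0 ≤ t₀) :
    MemLp (fun s => f (t₀ + s)) 2 (timeMeasure (T - t₀)) :=
  (h.mono_measure (restrict_le_timeMeasure ht₀)).comp_measurePreserving
    (measurePreserving_shift T t₀)

theorem intervalIntegrable_inner_of_memLp {W : Type*} [NormedAddCommGroup W]
    [InnerProductSpace ℝ W] {f : ℝ → W}
    (h : MemLp f 2 (timeMeasure T)) (v : W) {a b : ℝ} (ha : 0 ≤ a) (hab : a ≤ b) (hb : b ≤ T) :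
    IntervalIntegrable (fun s => ⟪f s, v⟫) volume a b := by
  rw [intervalIntegrable_iff_integrableOn_Ioc_of_le hab]
  have h1 : Integrable (fun s => ⟪f s, v⟫) (timeMeasure T) :=
    (h.integrable one_le_two).inner_const v
  exact h1.mono_measure (Measure.restrict_mono (Ioc_subset_Ioc ha hb) le_rfl)

/-- The equation integrated up to t₀ is subtracted from the one integrated up to t₀ + t; what
remains is the equation on (t₀, t₀ + t) with initial value y(t₀). -/
theorem IsWeak.shift {g : ℝ → H} {y₀ : H} {y : ℝ → H} (h : IsWeak ι A T g y₀ y) {t₀ : ℝ}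
    (ht₀ : t₀ ∈ Icc 0 T) :
    IsWeak ι A (T - t₀) (fun s => g (t₀ + s)) (y t₀) (fun s => y (t₀ + s)) := by
  obtain ⟨Y, h1, h2⟩ := h.weak
  have hY := memLp_shift (Lp.memLp Y) ht₀.1
  refine ⟨memLp_shift h.source_memLp ht₀.1, ?_, by simp, hY.toLp _, ?_, fun v t ht => ?_⟩
  · exact h.continuousOn.comp (by fun_prop) fun s hs =>
      ⟨by linarith [hs.1, ht₀.1], by linarith [hs.2]⟩
  · filter_upwards [hY.coeFn_toLp, ae_shift h1 ht₀.1] with t h3 h4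
    rw [h3, h4]
  · have h3 : ∫ s in (0 : ℝ)..t, ⟪A (hY.toLp _ s), v⟫ = ∫ s in t₀..(t₀ + t), ⟪A (Y s), v⟫ := by
      have := intervalIntegral.integral_comp_add_left (a := 0) (b := t)
        (fun s => ⟪A (Y s), v⟫) t₀
      rw [add_zero] at this
      rw [← this, ← setIntegral_timeMeasure le_rfl ht.1 ht.2,
        ← setIntegral_timeMeasure le_rfl ht.1 ht.2]
      refine intervalIntegral.integral_congr_ae ?_
      filter_upwards [hY.coeFn_toLp] with s hs _
      rw [hs]
    have h4 : ∫ s in (0 : ℝ)..t, ⟪g (t₀ + s), ι v⟫ = ∫ s in t₀..(t₀ + t), ⟪g s, ι v⟫ := by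
      have := intervalIntegral.integral_comp_add_left (a := 0) (b := t)
        (fun s => ⟪g s, ι v⟫) t₀
      rwa [add_zero] at this
    have hb : t₀ + t ≤ T := by linarith [ht.2]
    have hAY : MemLp (fun s => A (Y s)) 2 (timeMeasure T) := A.comp_memLp' (Lp.memLp Y)
    have ha : t₀ ≤ t₀ + t := by linarith [ht.1]
    rw [h3, h4, ← intervalIntegral.integral_interval_sub_left
      (intervalIntegrable_inner_of_memLp hAY v le_rfl (ht₀.1.trans ha) hb)
      (intervalIntegrable_inner_of_memLp hAY v le_rfl ht₀.1 ht₀.2),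
      ← intervalIntegral.integral_interval_sub_left
      (intervalIntegrable_inner_of_memLp h.source_memLp (ι v) le_rfl (ht₀.1.trans ha) hb)
      (intervalIntegrable_inner_of_memLp h.source_memLp (ι v) le_rfl ht₀.1 ht₀.2),
      ← h2 v (t₀ + t) ⟨ht₀.1.trans ha, hb⟩, ← h2 v t₀ ht₀]
    ring

theorem memLp_of_continuousOn {y : ℝ → H} (h : ContinuousOn y (Icc 0 T)) :
    MemLp y 2 (timeMeasure T) := by
  obtain ⟨M, hM⟩ := isCompact_Icc.exists_bound_of_continuousOn h
  refine MemLp.of_bound ?_ M ?_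
  · exact (h.mono Ioc_subset_Icc_self).aestronglyMeasurable measurableSet_Ioc
  · filter_upwards [ae_restrict_mem measurableSet_Ioc] with t ht
    exact hM t (Ioc_subset_Icc_self ht)

theorem IsWeak.memLp {g : ℝ → H} {y₀ : H} {y : ℝ → H} (h : IsWeak ι A T g y₀ y) :
    MemLp y 2 (timeMeasure T) := memLp_of_continuousOn h.continuousOn

theorem IsParabolic.exists_isWeak (hP : IsParabolic ι A) (hT : 0 ≤ T) {g : ℝ → H}
    (hg : MemLp g 2 (timeMeasure T)) (y₀ : H) : ∃ y, IsWeak ι A T g y₀ y := by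
  obtain ⟨S, hS⟩ := hP.exists_weak hT
  exact ⟨_, (hS y₀ (hg.toLp g)).congr hg.coeFn_toLp⟩

/-- Weak solutions of the backward equation `-ψ' + A* ψ = g`, `ψ(T) = ψ₁`. -/
def IsBack (ι : V →L[ℝ] H) (A : V →L[ℝ] V) (T : ℝ) (g : ℝ → H) (ψ₁ : H) (ψ : ℝ → H) : Prop :=
  IsWeak ι (adjoint A) T (fun t => g (T - t)) ψ₁ (fun t => ψ (T - t))

theorem memLp_reverse {W : Type*} [NormedAddCommGroup W] {g : ℝ → W}
    (hg : MemLp g 2 (timeMeasure T)) : MemLp (fun t => g (T - t)) 2 (timeMeasure T) :=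
  hg.comp_measurePreserving (measurePreserving_reverse T)

theorem IsParabolic.exists_isBack (hP : IsParabolic ι A) (hT : 0 ≤ T) {g : ℝ → H}
    (hg : MemLp g 2 (timeMeasure T)) (ψ₁ : H) : ∃ ψ, IsBack ι A T g ψ₁ ψ := by
  obtain ⟨z, hz⟩ := hP.dual.exists_isWeak hT (memLp_reverse hg) ψ₁
  exact ⟨fun t => z (T - t), by simpa only [IsBack, sub_sub_cancel] using hz⟩

theorem IsBack.duality (hP : IsParabolic ι A) (hT : 0 ≤ T) {g k : ℝ → H} {y₀ ψ₁ : H}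
    {y ψ : ℝ → H} (h : IsWeak ι A T g y₀ y) (h' : IsBack ι A T k ψ₁ ψ) :
    ⟪y T, ψ₁⟫ + ∫ t, ⟪y t, k t⟫ ∂timeMeasure T
      = ⟪y₀, ψ 0⟫ + ∫ t, ⟪g t, ψ t⟫ ∂timeMeasure T := by
  have := h.duality hP hT h'
  simpa only [sub_sub_cancel, sub_self] using this

theorem IsBack.terminal {g : ℝ → H} {ψ₁ : H} {ψ : ℝ → H} (h : IsBack ι A T g ψ₁ ψ) :
    ψ T = ψ₁ := by simpa using h.initial

theorem IsBack.congr {g g' : ℝ → H} {ψ₁ : H} {ψ : ℝ → H} (h : IsBack ι A T g ψ₁ ψ)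
    (hg : g =ᵐ[timeMeasure T] g') : IsBack ι A T g' ψ₁ ψ :=
  IsWeak.congr h (ae_reverse hg)

theorem IsBack.sub {g g' : ℝ → H} {y₀ y₀' : H} {y y' : ℝ → H} (h : IsBack ι A T g y₀ y)
    (h' : IsBack ι A T g' y₀' y') :
    IsBack ι A T (fun t => g t - g' t) (y₀ - y₀') (fun t => y t - y' t) :=
  IsWeak.sub h h'

theorem sub_mem_Icc {t : ℝ} (ht : t ∈ Icc 0 T) : T - t ∈ Icc 0 T :=
  ⟨by linarith [ht.2], by linarith [ht.1]⟩

theorem IsBack.unique (hP : IsParabolic ι A) (hT : 0 ≤ T) {g : ℝ → H} {y₀ : H} {y y' : ℝ → H}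
    (h : IsBack ι A T g y₀ y) (h' : IsBack ι A T g y₀ y') : EqOn y y' (Icc 0 T) := fun t ht => by
  simpa only [sub_sub_cancel] using IsWeak.unique hP.dual hT h h' (sub_mem_Icc ht)

theorem IsBack.continuousOn {g : ℝ → H} {ψ₁ : H} {ψ : ℝ → H} (h : IsBack ι A T g ψ₁ ψ) :
    ContinuousOn ψ (Icc 0 T) := by
  have h1 := IsWeak.continuousOn h
  have h2 := h1.comp (f := fun t => T - t) (by fun_prop) fun t ht => sub_mem_Icc ht
  simpa only [Function.comp_def, sub_sub_cancel] using h2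

theorem IsBack.memLp {g : ℝ → H} {ψ₁ : H} {ψ : ℝ → H} (h : IsBack ι A T g ψ₁ ψ) :
    MemLp ψ 2 (timeMeasure T) := memLp_of_continuousOn h.continuousOn

theorem IsBack.shift {g : ℝ → H} {ψ₁ : H} {ψ : ℝ → H} (h : IsBack ι A T g ψ₁ ψ) {t₀ : ℝ}
    (ht₀ : 0 ≤ t₀) :
    IsBack ι A (T - t₀) (fun s => g (t₀ + s)) ψ₁ (fun s => ψ (t₀ + s)) := by
  have h1 := IsWeak.restrict h (τ := T - t₀) (by linarith)
  have h2 : ∀ s, t₀ + (T - t₀ - s) = T - s := fun s => by ring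
  simpa only [IsBack, h2] using h1

theorem isBack_const {u : V} {g : H} (h : ∀ v, ⟪A v, u⟫ = ⟪g, ι v⟫) :
    IsBack ι A T (fun _ => g) (ι u) (fun _ => ι u) :=
  isWeak_const fun v => by
    rw [ContinuousLinearMap.adjoint_inner_left, real_inner_comm, h v]

end Shift

/-! ### The linear quadratic problem and its optimality system -/

section OptimalControl

variable {V H : Type*} [NormedAddCommGroup V] [InnerProductSpace ℝ V] [CompleteSpace V]
  [NormedAddCommGroup H] [InnerProductSpace ℝ H] [CompleteSpace H] {T : ℝ}
  {ι : V →L[ℝ] H} {A : V →L[ℝ] V} {C : H →L[ℝ] H}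

/-- The cost `½ ∫₀ᵀ ‖f‖² + ‖y - y_d‖²` in an abstract Hilbert space. -/
def costFn (T : ℝ) (yd : H) (f : Lp H 2 (timeMeasure T)) (y : ℝ → H) : ℝ :=
  1 / 2 * ∫ t, (‖f t‖ ^ 2 + ‖y t - yd‖ ^ 2) ∂timeMeasure T

/-- Optimal pairs of the abstract linear quadratic problem with control operator `C`. -/
def IsOptimal (ι : V →L[ℝ] H) (A : V →L[ℝ] V) (C : H →L[ℝ] H) (T : ℝ) (y₀ yd : H) (y : ℝ → H)
    (f : Lp H 2 (timeMeasure T)) : Prop :=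
  IsWeak ι A T (fun t => C (f t)) y₀ y ∧
    ∀ (f' : Lp H 2 (timeMeasure T)) (y' : ℝ → H), IsWeak ι A T (fun t => C (f' t)) y₀ y' →
      costFn T yd f y ≤ costFn T yd f' y'

theorem costFn_eq {yd : H} {f : Lp H 2 (timeMeasure T)} {y : ℝ → H}
    {u : Lp H 2 (timeMeasure T)} (hu : u =ᵐ[timeMeasure T] fun t => y t - yd) :
    costFn T yd f y = 1 / 2 * (‖f‖ ^ 2 + ‖u‖ ^ 2) := by
  rw [costFn, Lp_norm_sq, Lp_norm_sq, ← integral_add (Lp_integrable_norm_sq f)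
    (Lp_integrable_norm_sq u)]
  congr 1
  refine integral_congr_ae ?_
  filter_upwards [hu] with t ht
  rw [ht]

/-- The optimal control problem as a least squares problem. -/
theorem exists_control_operator (hP : IsParabolic ι A) (hT : 0 ≤ T) (C : H →L[ℝ] H) (y₀ yd : H) :
    ∃ (L : Lp H 2 (timeMeasure T) →L[ℝ] Lp H 2 (timeMeasure T)) (b : Lp H 2 (timeMeasure T)),
      (∀ g, ∃ z, IsWeak ι A T (fun t => C (g t)) 0 z ∧ L g =ᵐ[timeMeasure T] z) ∧
      ∀ f, (∃ y, IsWeak ι A T (fun t => C (f t)) y₀ y) ∧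
        ∀ y, IsWeak ι A T (fun t => C (f t)) y₀ y → L f - b =ᵐ[timeMeasure T] fun t => y t - yd := by
  obtain ⟨S, hS⟩ := hP.exists_weak hT
  set CL : Lp H 2 (timeMeasure T) →L[ℝ] Lp H 2 (timeMeasure T) := C.compLpL 2 (timeMeasure T)
  have hSC : ∀ (y₀ : H) (f : Lp H 2 (timeMeasure T)),
      IsWeak ι A T (fun t => C (f t)) y₀ (S (y₀, CL f)) := fun y₀ f =>
    (hS y₀ (CL f)).congr (C.coeFn_compLpL f)
  -- L sends a control to the state with zero initial datum, and b is y_d minus the uncontrolled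
  -- evolution of y₀; by linearity Lf - b is y - y_d.
  refine ⟨(bcfLp T).comp (S.comp ((ContinuousLinearMap.inr ℝ H _).comp CL)),
    bcfLp T (constB yd - S (y₀, 0)), fun g => ⟨S (0, CL g), hSC 0 g, coeFn_bcfLp _⟩,
    fun f => ⟨⟨S (y₀, CL f), hSC y₀ f⟩, fun y hy => ?_⟩⟩
  have h1 : (bcfLp T).comp (S.comp ((ContinuousLinearMap.inr ℝ H _).comp CL)) f
      - bcfLp T (constB yd - S (y₀, 0)) = bcfLp T (S (y₀, CL f) - constB yd) := by
    have h2 : S (y₀, CL f) = S (0, CL f) + S (y₀, 0) := by rw [← map_add]; simp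
    rw [h2]
    simp only [map_sub, map_add, ContinuousLinearMap.comp_apply, ContinuousLinearMap.inr_apply]
    abel
  rw [h1]
  filter_upwards [coeFn_bcfLp (T := T) (S (y₀, CL f) - constB yd),
    ae_restrict_mem measurableSet_Ioc] with t h3 h4
  rw [h3, BoundedContinuousFunction.sub_apply, constB_apply,
    hy.unique hP hT (hSC y₀ f) (Ioc_subset_Icc_self h4)]

theorem isOptimal_iff_quadratic (hP : IsParabolic ι A) (hT : 0 ≤ T) (C : H →L[ℝ] H) (y₀ yd : H) :
    ∃ (L : Lp H 2 (timeMeasure T) →L[ℝ] Lp H 2 (timeMeasure T)) (b : Lp H 2 (timeMeasure T)),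
      (∀ g, ∃ z, IsWeak ι A T (fun t => C (g t)) 0 z ∧ L g =ᵐ[timeMeasure T] z) ∧
      (∀ f y, IsWeak ι A T (fun t => C (f t)) y₀ y →
        L f - b =ᵐ[timeMeasure T] fun t => y t - yd) ∧
      (∀ f y, IsOptimal ι A C T y₀ yd y f ↔ IsWeak ι A T (fun t => C (f t)) y₀ y ∧
        ∀ g, ⟪f, g⟫ + ⟪L f - b, L g⟫ = 0) := by
  obtain ⟨L, b, h1, h2⟩ := exists_control_operator hP hT C y₀ yd
  refine ⟨L, b, h1, fun f => (h2 f).2, fun f y => and_congr_right fun hy => ?_⟩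
  rw [← quadratic_min_iff]
  constructor
  · intro h f'
    obtain ⟨y', hy'⟩ := (h2 f').1
    have := h f' y' hy'
    rw [costFn_eq ((h2 f).2 y hy), costFn_eq ((h2 f').2 y' hy')] at this
    linarith
  · intro h f' y' hy'
    rw [costFn_eq ((h2 f).2 y hy), costFn_eq ((h2 f').2 y' hy')]
    linarith [h f']

theorem existsUnique_optimal (hP : IsParabolic ι A) (hT : 0 ≤ T) (C : H →L[ℝ] H) (y₀ yd : H) :
    ∃! f, ∃ y, IsOptimal ι A C T y₀ yd y f := by
  obtain ⟨L, b, h1, h2, h3⟩ := isOptimal_iff_quadratic hP hT C y₀ yd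
  obtain ⟨f, hf, hu⟩ := existsUnique_quadratic_min L b
  obtain ⟨y, hy⟩ := hP.exists_isWeak hT (C.comp_memLp' (Lp.memLp f)) y₀
  refine ⟨f, ⟨y, (h3 f y).2 ⟨hy, hf⟩⟩, fun f' ⟨y', hy'⟩ => hu f' ((h3 f' y').1 hy').2⟩

/-- The optimality system. -/
theorem isOptimal_iff (hP : IsParabolic ι A) (hT : 0 ≤ T) (hC : ∀ x y, ⟪C x, y⟫ = ⟪x, C y⟫)
    {y₀ yd : H} {y ψ : ℝ → H} {f : Lp H 2 (timeMeasure T)}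
    (hψ : IsBack ι A T (fun t => y t - yd) 0 ψ) :
    IsOptimal ι A C T y₀ yd y f ↔ IsWeak ι A T (fun t => C (f t)) y₀ y ∧
      f =ᵐ[timeMeasure T] fun t => -C (ψ t) := by
  obtain ⟨L, b, h1, h2, h3⟩ := isOptimal_iff_quadratic hP hT C y₀ yd
  rw [h3]
  refine and_congr_right fun hy => ?_
  set Ψ : Lp H 2 (timeMeasure T) := (C.comp_memLp' hψ.memLp).toLp _ with hΨ
  have hΨc : Ψ =ᵐ[timeMeasure T] fun t => C (ψ t) := MemLp.coeFn_toLp _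
  -- Lg is the state z driven by Cg from 0. Duality with ψ turns ∫⟪z, y - y_d⟫ into ∫⟪Cg, ψ⟫ = ∫⟪g,
  -- Cψ⟫, so the derivative of the cost is f + Cψ.
  have key : ∀ g, ⟪f, g⟫ + ⟪L f - b, L g⟫ = ⟪f + Ψ, g⟫ := by
    intro g
    obtain ⟨z, hz, hzL⟩ := h1 g
    have hd := hψ.duality hP hT hz
    rw [inner_zero_left, inner_zero_right, zero_add, zero_add] at hd
    rw [inner_add_left]
    congr 1
    rw [L2.inner_def, L2.inner_def]
    refine Eq.trans ?_ (hd.trans ?_) <;> refine integral_congr_ae ?_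
    · filter_upwards [h2 f y hy, hzL] with t h4 h5
      rw [h4, h5, real_inner_comm]
    · filter_upwards [hΨc] with t h4
      rw [h4, hC, real_inner_comm]
  simp only [key]
  constructor
  · intro h
    have h4 : f = -Ψ := eq_neg_of_add_eq_zero_left (inner_self_eq_zero.1 (h _))
    rw [h4]
    filter_upwards [Lp.coeFn_neg Ψ, hΨc] with t h5 h6
    rw [h5, Pi.neg_apply, h6]
  · intro h g
    have h4 : f + Ψ = 0 := by
      refine Lp.ext ?_
      filter_upwards [Lp.coeFn_add f Ψ, hΨc, h, Lp.coeFn_zero H 2 (timeMeasure T)]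
        with t h5 h6 h7 h8
      rw [h5, h8, Pi.add_apply, h6, h7]
      simp
    rw [h4, inner_zero_left]

/-- The optimality system of the problem with target `0`. -/
def IsRiccatiSystem (ι : V →L[ℝ] H) (A : V →L[ℝ] V) (C : H →L[ℝ] H) (τ : ℝ) (η : H)
    (y ψ : ℝ → H) : Prop :=
  IsWeak ι A τ (fun t => -C (ψ t)) η y ∧ IsBack ι A τ y 0 ψ

/-- The optimal control is f = -Cψ, and idempotence of C makes the forcing Cf equal to -Cψ as well.
This removes f from the system. -/
theorem isRiccatiSystem_iff (hP : IsParabolic ι A) (hT : 0 ≤ T)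
    (hC : ∀ x y, ⟪C x, y⟫ = ⟪x, C y⟫) (hCC : ∀ x, C (C x) = C x) {η : H} {y ψ : ℝ → H} :
    IsRiccatiSystem ι A C T η y ψ ↔
      (∃ f, IsOptimal ι A C T η 0 y f) ∧ IsBack ι A T y 0 ψ := by
  refine and_congr_left fun hψ => ?_
  have hψ' : IsBack ι A T (fun t => y t - 0) 0 ψ := by simpa only [sub_zero] using hψ
  simp only [isOptimal_iff hP hT hC hψ']
  constructor
  · intro h
    have hm : MemLp (fun t => -C (ψ t)) 2 (timeMeasure T) := (C.comp_memLp' hψ.memLp).neg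
    refine ⟨hm.toLp _, h.congr ?_, hm.coeFn_toLp⟩
    filter_upwards [hm.coeFn_toLp] with t ht
    rw [ht, map_neg, hCC]
  · rintro ⟨f, hf, hfψ⟩
    refine hf.congr ?_
    filter_upwards [hfψ] with t ht
    rw [ht, map_neg, hCC]

theorem exists_riccatiSystem (hP : IsParabolic ι A) (hT : 0 ≤ T)
    (hC : ∀ x y, ⟪C x, y⟫ = ⟪x, C y⟫) (hCC : ∀ x, C (C x) = C x) (η : H) :
    ∃ y ψ, IsRiccatiSystem ι A C T η y ψ := by
  obtain ⟨f, ⟨y, hy⟩, -⟩ := existsUnique_optimal hP hT C η 0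
  obtain ⟨ψ, hψ⟩ := hP.exists_isBack hT hy.1.memLp 0
  exact ⟨y, ψ, (isRiccatiSystem_iff hP hT hC hCC).2 ⟨⟨f, hy⟩, hψ⟩⟩

theorem IsRiccatiSystem.unique (hP : IsParabolic ι A) (hT : 0 ≤ T)
    (hC : ∀ x y, ⟪C x, y⟫ = ⟪x, C y⟫) (hCC : ∀ x, C (C x) = C x) {η : H} {y y' ψ ψ' : ℝ → H}
    (h : IsRiccatiSystem ι A C T η y ψ) (h' : IsRiccatiSystem ι A C T η y' ψ') :
    EqOn ψ ψ' (Icc 0 T) := by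
  obtain ⟨⟨f, hf⟩, hψ⟩ := (isRiccatiSystem_iff hP hT hC hCC).1 h
  obtain ⟨⟨f', hf'⟩, hψ'⟩ := (isRiccatiSystem_iff hP hT hC hCC).1 h'
  have hff : f = f' := (existsUnique_optimal hP hT C η 0).unique ⟨y, hf⟩ ⟨y', hf'⟩
  subst hff
  have hyy := hf.1.unique hP hT hf'.1
  refine hψ.unique hP hT (hψ'.congr ?_)
  filter_upwards [ae_restrict_mem measurableSet_Ioc] with t ht
  exact (hyy (Ioc_subset_Icc_self ht)).symm

/-- Duality between ψ and the state z, whose forcing is -Cφ; symmetry and idempotence give ⟪Cφ, ψ⟫ =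
⟪Cφ, Cψ⟫. The right side is symmetric in the two systems, which is the source of the symmetry and
positivity of the Riccati operator. -/
theorem IsRiccatiSystem.inner_eq (hP : IsParabolic ι A) (hT : 0 ≤ T)
    (hC : ∀ x y, ⟪C x, y⟫ = ⟪x, C y⟫) (hCC : ∀ x, C (C x) = C x) {η ζ : H} {y z ψ φ : ℝ → H}
    (h : IsRiccatiSystem ι A C T η y ψ) (h' : IsRiccatiSystem ι A C T ζ z φ) :
    ⟪ζ, ψ 0⟫ = ∫ t, (⟪z t, y t⟫ + ⟪C (φ t), C (ψ t)⟫) ∂timeMeasure T := by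
  have hd := h.2.duality hP hT h'.1
  have h1 : ∫ t, ⟪-C (φ t), ψ t⟫ ∂timeMeasure T
      = -∫ t, ⟪C (φ t), C (ψ t)⟫ ∂timeMeasure T := by
    rw [← integral_neg]
    congr 1
    ext t
    rw [inner_neg_left, ← hC, hCC]
  rw [h1, inner_zero_right, zero_add] at hd
  have hi : ∀ {u v : ℝ → H}, MemLp u 2 (timeMeasure T) → MemLp v 2 (timeMeasure T) →
      Integrable (fun t => ⟪u t, v t⟫) (timeMeasure T) := fun {u v} hu hv => by
    refine (L2.integrable_inner (𝕜 := ℝ) (hu.toLp u) (hv.toLp v)).congr ?_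
    filter_upwards [hu.coeFn_toLp, hv.coeFn_toLp] with t h1 h2
    rw [h1, h2]
  have h2 : Integrable (fun t => ⟪C (φ t), C (ψ t)⟫) (timeMeasure T) :=
    hi (C.comp_memLp' h'.2.memLp) (C.comp_memLp' h.2.memLp)
  rw [integral_add (hi h'.1.memLp h.1.memLp) h2]
  linarith

theorem IsRiccatiSystem.shift {η : H} {y ψ : ℝ → H} (h : IsRiccatiSystem ι A C T η y ψ) {t₀ : ℝ}
    (ht₀ : t₀ ∈ Icc 0 T) :
    IsRiccatiSystem ι A C (T - t₀) (y t₀) (fun s => y (t₀ + s)) (fun s => ψ (t₀ + s)) :=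
  ⟨h.1.shift ht₀, h.2.shift ht₀.1⟩

/-- `2 × cost` of the optimal pair is `⟪η, ψ(0)⟫`. -/
theorem IsRiccatiSystem.two_mul_cost (hP : IsParabolic ι A) (hT : 0 ≤ T)
    (hC : ∀ x y, ⟪C x, y⟫ = ⟪x, C y⟫) (hCC : ∀ x, C (C x) = C x) {η : H} {y ψ : ℝ → H}
    (h : IsRiccatiSystem ι A C T η y ψ) {f : Lp H 2 (timeMeasure T)}
    (hf : IsOptimal ι A C T η 0 y f) : ⟪η, ψ 0⟫ = 2 * costFn T 0 f y := by
  have hψ' : IsBack ι A T (fun t => y t - 0) 0 ψ := by simpa only [sub_zero] using h.2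
  have hfψ := ((isOptimal_iff hP hT hC hψ').1 hf).2
  rw [h.inner_eq hP hT hC hCC h, costFn, ← mul_assoc]
  norm_num
  refine integral_congr_ae ?_
  filter_upwards [hfψ] with t ht
  rw [ht, norm_neg]
  ring

/-- The optimal pair on the longer interval, restricted to the shorter one, is an admissible
competitor there, and its running cost is nonnegative. -/
theorem IsRiccatiSystem.mono (hP : IsParabolic ι A) (hT : 0 ≤ T)
    (hC : ∀ x y, ⟪C x, y⟫ = ⟪x, C y⟫) (hCC : ∀ x, C (C x) = C x) {η : H} {τ : ℝ}
    (hτ : T ≤ τ) {y z ψ φ : ℝ → H} (h : IsRiccatiSystem ι A C T η y ψ)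
    (h' : IsRiccatiSystem ι A C τ η z φ) : ⟪η, ψ 0⟫ ≤ ⟪η, φ 0⟫ := by
  obtain ⟨f, hf⟩ := ((isRiccatiSystem_iff hP hT hC hCC).1 h).1
  rw [h.two_mul_cost hP hT hC hCC hf, h'.inner_eq hP (hT.trans hτ) hC hCC h']
  have hle := timeMeasure_mono hτ
  have hm : MemLp (fun t => -C (φ t)) 2 (timeMeasure T) :=
    ((C.comp_memLp' h'.2.memLp).neg).mono_measure hle
  have h1 : IsWeak ι A T (fun t => C (hm.toLp _ t)) η z := by
    refine (h'.1.restrict hτ).congr ?_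
    filter_upwards [hm.coeFn_toLp] with t ht
    rw [ht, map_neg, hCC]
  have h2 := hf.2 _ _ h1
  have h3 : costFn T 0 (hm.toLp _) z
      = 1 / 2 * ∫ t, (⟪z t, z t⟫ + ⟪C (φ t), C (φ t)⟫) ∂timeMeasure T := by
    rw [costFn]
    congr 1
    refine integral_congr_ae ?_
    filter_upwards [hm.coeFn_toLp] with t ht
    rw [ht, norm_neg, sub_zero, real_inner_self_eq_norm_sq, real_inner_self_eq_norm_sq]
    ring
  have h4 : ∫ t, (⟪z t, z t⟫ + ⟪C (φ t), C (φ t)⟫) ∂timeMeasure T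
      ≤ ∫ t, (⟪z t, z t⟫ + ⟪C (φ t), C (φ t)⟫) ∂timeMeasure τ := by
    refine integral_mono_measure hle (Filter.Eventually.of_forall fun t => ?_) ?_
    · exact add_nonneg real_inner_self_nonneg real_inner_self_nonneg
    · simp only [real_inner_self_eq_norm_sq]
      exact h'.1.memLp.integrable_norm_pow two_ne_zero |>.add
        ((C.comp_memLp' h'.2.memLp).integrable_norm_pow two_ne_zero)
  linarith

end OptimalControl

/-! ### The Riccati operators and the equation of h -/

section RiccatiFamily

variable {V H : Type*} [NormedAddCommGroup V] [InnerProductSpace ℝ V] [CompleteSpace V]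
  [NormedAddCommGroup H] [InnerProductSpace ℝ H] [CompleteSpace H] {T : ℝ}
  {ι : V →L[ℝ] H} {A : V →L[ℝ] V} {C : H →L[ℝ] H} {R : ℝ → H → H}

/-- A uniform bound for a symmetric operator in terms of its quadratic form. -/
theorem norm_le_of_quadratic_le (P : H →L[ℝ] H) (hs : ∀ x y, ⟪P x, y⟫ = ⟪x, P y⟫) {M : ℝ}
    (h0 : ∀ x, 0 ≤ ⟪x, P x⟫) (hM : ∀ x, ⟪x, P x⟫ ≤ M * ‖x‖ ^ 2) (x : H) :
    ‖P x‖ ≤ M * ‖x‖ := by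
  have key : ∀ y, 4 * ⟪P x, y⟫ ≤ M * ‖x + y‖ ^ 2 := by
    intro y
    have h1 := hM (x + y)
    have h2 := h0 (x - y)
    simp only [map_add, map_sub, inner_add_left, inner_add_right, inner_sub_left,
      inner_sub_right] at h1 h2
    have h3 : ⟪x, P y⟫ = ⟪P x, y⟫ := (hs x y).symm
    have h4 : ⟪y, P x⟫ = ⟪P x, y⟫ := real_inner_comm _ _
    linarith
  by_cases hP : P x = 0
  · rw [hP, norm_zero]
    by_cases hx : x = 0
    · simp [hx]
    · have h1 := (h0 x).trans (hM x)
      have hx' : 0 < ‖x‖ := norm_pos_iff.2 hx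
      by_contra! h
      nlinarith
  · have hp : 0 < ‖P x‖ := norm_pos_iff.2 hP
    have hx : 0 < ‖x‖ := norm_pos_iff.2 fun h => hP (by rw [h, map_zero])
    have hM0 : 0 ≤ M := by
      have := (h0 x).trans (hM x)
      by_contra! h
      nlinarith [pow_pos hx 2]
    -- The test vector is parallel to P x and has the length of x, so ‖x + y‖ ≤ 2‖x‖, and the
    -- factors 4 on the two sides of the polarization inequality cancel.
    have h1 := key ((‖x‖ / ‖P x‖) • P x)
    rw [inner_smul_right, real_inner_self_eq_norm_sq] at h1
    have h2 : ‖x + (‖x‖ / ‖P x‖) • P x‖ ≤ 2 * ‖x‖ := by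
      refine (norm_add_le _ _).trans_eq ?_
      rw [norm_smul, Real.norm_of_nonneg (by positivity), div_mul_cancel₀ _ hp.ne']
      ring
    have h3 := mul_le_mul_of_nonneg_left (pow_le_pow_left₀ (norm_nonneg _) h2 2) hM0
    have h4 : ‖x‖ / ‖P x‖ * ‖P x‖ ^ 2 = ‖x‖ * ‖P x‖ := by field_simp
    rw [h4] at h1
    have h5 : ‖x‖ * ‖P x‖ ≤ ‖x‖ * (M * ‖x‖) := by nlinarith
    exact le_of_mul_le_mul_left h5 hx

/-- `R τ η` is the value at time `0` of the dual state of the optimal trajectory on `(0,τ)`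
that starts at `η`. -/
def IsRiccatiFamily (ι : V →L[ℝ] H) (A : V →L[ℝ] V) (C : H →L[ℝ] H) (R : ℝ → H → H) : Prop :=
  ∀ τ, 0 < τ → ∀ η, ∃ y ψ, IsRiccatiSystem ι A C τ η y ψ ∧ ψ 0 = R τ η

/-- The structural assumptions on the control problem. -/
structure IsControlSystem (ι : V →L[ℝ] H) (A : V →L[ℝ] V) (C : H →L[ℝ] H) : Prop where
  parabolic : IsParabolic ι A
  symm : ∀ x y, ⟪C x, y⟫ = ⟪x, C y⟫
  idem : ∀ x, C (C x) = C x

theorem IsRiccatiFamily.eq (hS : IsControlSystem ι A C) (hR : IsRiccatiFamily ι A C R) {τ : ℝ}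
    (hτ : 0 < τ) {η : H} {y ψ : ℝ → H} (h : IsRiccatiSystem ι A C τ η y ψ) : ψ 0 = R τ η := by
  obtain ⟨y', ψ', h', h0⟩ := hR τ hτ η
  rw [← h0]
  exact h.unique hS.parabolic hτ.le hS.symm hS.idem h' (left_mem_Icc.2 hτ.le)

/-- Both sides are given by `IsRiccatiSystem.inner_eq`, with the two trajectories interchanged. -/
theorem IsRiccatiFamily.symm (hS : IsControlSystem ι A C) (hR : IsRiccatiFamily ι A C R) {τ : ℝ}
    (hτ : 0 < τ) (η ζ : H) : ⟪R τ η, ζ⟫ = ⟪η, R τ ζ⟫ := by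
  obtain ⟨y, ψ, h, h0⟩ := hR τ hτ η
  obtain ⟨z, φ, h', h0'⟩ := hR τ hτ ζ
  rw [← h0, ← h0', real_inner_comm, h.inner_eq hS.parabolic hτ.le hS.symm hS.idem h',
    h'.inner_eq hS.parabolic hτ.le hS.symm hS.idem h]
  congr 1
  ext t
  rw [real_inner_comm, real_inner_comm (C (φ t))]

theorem IsRiccatiFamily.nonneg (hS : IsControlSystem ι A C) (hR : IsRiccatiFamily ι A C R) {τ : ℝ}
    (hτ : 0 < τ) (η : H) : 0 ≤ ⟪η, R τ η⟫ := by
  obtain ⟨y, ψ, h, h0⟩ := hR τ hτ η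
  rw [← h0, h.inner_eq hS.parabolic hτ.le hS.symm hS.idem h]
  exact integral_nonneg fun t => add_nonneg real_inner_self_nonneg real_inner_self_nonneg

theorem IsRiccatiFamily.mono (hS : IsControlSystem ι A C) (hR : IsRiccatiFamily ι A C R) (η : H) :
    MonotoneOn (fun τ => ⟪η, R τ η⟫) (Ioi 0) := by
  intro τ hτ τ' hτ' hle
  obtain ⟨y, ψ, h, h0⟩ := hR τ hτ η
  obtain ⟨z, φ, h', h0'⟩ := hR τ' hτ' η
  simp only
  rw [← h0, ← h0']
  exact h.mono hS.parabolic (le_of_lt hτ) hS.symm hS.idem hle h'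

/-- The Riccati operators are bounded, uniformly on bounded intervals. -/
theorem IsRiccatiFamily.exists_clm (hS : IsControlSystem ι A C) (hR : IsRiccatiFamily ι A C R)
    (hT : 0 < T) :
    ∃ (P : ℝ → H →L[ℝ] H) (M : ℝ), 0 ≤ M ∧ (∀ τ, 0 < τ → ∀ η, P τ η = R τ η) ∧
      ∀ τ ∈ Ioc 0 T, ‖P τ‖ ≤ M := by
  have hlin : ∀ τ, 0 < τ → ∃ P : H →L[ℝ] H, ∀ η, P η = R τ η := by
    intro τ hτ
    -- Symmetry alone gives linearity, and a symmetric operator defined on all of H is bounded by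
    -- the Hellinger–Toeplitz theorem.
    let L : H →ₗ[ℝ] H :=
      { toFun := R τ
        map_add' := fun x y => ext_inner_right ℝ fun z => by
          simp only [inner_add_left, hR.symm hS hτ]
        map_smul' := fun c x => ext_inner_right ℝ fun z => by
          simp only [inner_smul_left, hR.symm hS hτ, RingHom.id_apply] }
    have hL : L.IsSymmetric := fun x y => hR.symm hS hτ x y
    exact ⟨⟨L, hL.continuous⟩, fun η => rfl⟩
  choose! P hP using hlin
  -- The quadratic forms increase with τ, so the norm at τ = T bounds all of them on (0,T].
  refine ⟨P, ‖P T‖, norm_nonneg _, hP, fun τ hτ => ?_⟩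
  refine ContinuousLinearMap.opNorm_le_bound _ (norm_nonneg _) fun x => ?_
  refine norm_le_of_quadratic_le (P τ) (fun x y => ?_) (fun x => ?_) (fun x => ?_) x
  · rw [hP τ hτ.1, hP τ hτ.1, hR.symm hS hτ.1]
  · rw [hP τ hτ.1]; exact hR.nonneg hS hτ.1 x
  · rw [hP τ hτ.1]
    refine (hR.mono hS x hτ.1 hT hτ.2).trans ?_
    simp only
    rw [← hP T hT]
    refine (real_inner_le_norm _ _).trans ?_
    nlinarith [(P T).le_opNorm x, norm_nonneg x]

/-- The function s ↦ ⟪x, R(s)x⟫ is monotone, hence measurable. Polarization gives weak measurability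
of R(s)x, and symmetry moves R(s) onto the test vector, so weak measurability of R(s)u(s) follows;
separability of H makes it strong. -/
theorem IsRiccatiFamily.aestronglyMeasurable [SecondCountableTopology H]
    (hS : IsControlSystem ι A C) (hR : IsRiccatiFamily ι A C R) {u : ℝ → H}
    (hu : AEStronglyMeasurable u (timeMeasure T)) :
    AEStronglyMeasurable (fun s => R s (u s)) (timeMeasure T) := by
  have hq : ∀ x, AEStronglyMeasurable (fun s => ⟪x, R s x⟫) (timeMeasure T) := fun x =>
    (aemeasurable_restrict_of_monotoneOn measurableSet_Ioc
      ((hR.mono hS x).mono fun _ hs => hs.1)).aestronglyMeasurable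
  have hx : ∀ x, AEStronglyMeasurable (fun s => R s x) (timeMeasure T) := by
    intro x
    refine aestronglyMeasurable_of_inner fun z => ?_
    refine (((hq (z + x)).sub (hq z)).sub (hq x)).const_mul (1 / 2 : ℝ) |>.congr ?_
    filter_upwards [ae_restrict_mem measurableSet_Ioc] with s hs
    simp only [Pi.sub_apply]
    have h1 : ⟪z + x, R s (z + x)⟫ = ⟪z, R s z⟫ + ⟪x, R s x⟫ + 2 * ⟪z, R s x⟫ := by
      rw [inner_add_left, ← hR.symm hS hs.1 z, ← hR.symm hS hs.1 x, inner_add_right,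
        inner_add_right, hR.symm hS hs.1 z x, real_inner_comm z (R s x), hR.symm hS hs.1 z z,
        hR.symm hS hs.1 x x]
      ring
    rw [h1]
    ring
  refine aestronglyMeasurable_of_inner fun z => ((hx z).inner hu).congr ?_
  filter_upwards [ae_restrict_mem measurableSet_Ioc] with s hs
  exact hR.symm hS hs.1 z (u s)

/-- Dynamic programming: the dual state is the Riccati operator applied to the state. -/
theorem IsRiccatiFamily.eq_shift (hS : IsControlSystem ι A C) (hR : IsRiccatiFamily ι A C R)
    {τ : ℝ} {η : H} {y ψ : ℝ → H} (h : IsRiccatiSystem ι A C τ η y ψ) {s : ℝ} (hs : s ∈ Ico 0 τ) :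
    ψ s = R (τ - s) (y s) := by
  have := hR.eq hS (sub_pos.2 hs.2) (h.shift ⟨hs.1, hs.2.le⟩)
  simpa using this

/-- `-h' + A* h + R(T-t) (C h) = 0`, `h(T) = h₁`. -/
def IsFeedback (ι : V →L[ℝ] H) (A : V →L[ℝ] V) (C : H →L[ℝ] H) (R : ℝ → H → H) (T : ℝ) (h₁ : H)
    (h : ℝ → H) : Prop :=
  IsBack ι A T (fun t => -R (T - t) (C (h t))) h₁ h

/-- The right endpoint is discarded because there the remaining horizon is 0, and `IsRiccatiFamily`
prescribes R only for positive times. -/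
theorem ae_lt (τ : ℝ) : ∀ᵐ s ∂timeMeasure τ, s ∈ Ioo 0 τ := by
  filter_upwards [ae_restrict_mem measurableSet_Ioc, ae_restrict_of_ae (Measure.ae_ne volume τ)]
    with s h1 h2
  exact ⟨h1.1, lt_of_le_of_ne h1.2 h2⟩

/-- Pair h with the optimal trajectory w with target 0 issued from η at time t₀. Its forcing is -Cφ
with φ(s) = R(T - t₀ - s)w(s), so by symmetry of R and C the integral of this forcing against h
cancels the integral of the feedback term against w. Only boundary terms remain. -/
theorem IsFeedback.inner_eq (hS : IsControlSystem ι A C) (hR : IsRiccatiFamily ι A C R) {h₁ : H}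
    {h : ℝ → H} (hh : IsFeedback ι A C R T h₁ h) {t₀ : ℝ} (ht₀ : t₀ ∈ Ico 0 T) {η : H}
    {w φ : ℝ → H} (hw : IsRiccatiSystem ι A C (T - t₀) η w φ) :
    ⟪η, h t₀⟫ = ⟪w (T - t₀), h₁⟫ := by
  have hτ : 0 < T - t₀ := sub_pos.2 ht₀.2
  have hd := (IsBack.shift hh ht₀.1).duality hS.parabolic hτ.le hw.1
  have h1 : ∫ s, ⟪w s, -R (T - (t₀ + s)) (C (h (t₀ + s)))⟫ ∂timeMeasure (T - t₀)
      = ∫ s, ⟪-C (φ s), h (t₀ + s)⟫ ∂timeMeasure (T - t₀) := by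
    refine integral_congr_ae ?_
    filter_upwards [ae_lt (T - t₀)] with s hs
    have h2 : T - (t₀ + s) = T - t₀ - s := by ring
    rw [h2, inner_neg_right, inner_neg_left, ← hR.symm hS (sub_pos.2 hs.2),
      ← hR.eq_shift hS hw ⟨hs.1.le, hs.2⟩, hS.symm]
  rw [h1] at hd
  simpa using (add_right_cancel hd).symm

theorem IsFeedback.unique (hS : IsControlSystem ι A C) (hR : IsRiccatiFamily ι A C R) {h₁ : H}
    {h h' : ℝ → H} (hh : IsFeedback ι A C R T h₁ h) (hh' : IsFeedback ι A C R T h₁ h') :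
    EqOn h h' (Icc 0 T) := by
  intro t ht
  rcases ht.2.eq_or_lt with rfl | hlt
  · rw [IsBack.terminal hh, IsBack.terminal hh']
  · refine ext_inner_left ℝ fun η => ?_
    obtain ⟨w, φ, hw, -⟩ := hR (T - t) (sub_pos.2 hlt) η
    rw [hh.inner_eq hS hR ⟨ht.1, hlt⟩ hw, hh'.inner_eq hS hR ⟨ht.1, hlt⟩ hw]

/-- Decoupling of the optimality system: `q = R(T-t) z + h`. -/
theorem IsFeedback.decouple (hS : IsControlSystem ι A C) (hR : IsRiccatiFamily ι A C R)
    {h₁ z₀ : H} {h z q : ℝ → H} (hh : IsFeedback ι A C R T h₁ h)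
    (hz : IsWeak ι A T (fun t => -C (q t)) z₀ z) (hq : IsBack ι A T z h₁ q) {t : ℝ}
    (ht : t ∈ Ico 0 T) : q t = R (T - t) (z t) + h t := by
  have hτ : 0 < T - t := sub_pos.2 ht.2
  refine ext_inner_left ℝ fun η => ?_
  obtain ⟨w, φ, hw, hφ⟩ := hR (T - t) hτ η
  have hz' := hz.shift ⟨ht.1, ht.2.le⟩
  have hq' := hq.shift ht.1
  -- Two dualities, q against w and φ against z. Their integral terms coincide by symmetry of C, so
  -- ⟪η, q(t)⟫ is ⟪w(T - t), h₁⟫ = ⟪η, h(t)⟫ plus ⟪z(t), R(T - t)η⟫.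
  have h1 := hq'.duality hS.parabolic hτ.le hw.1
  have h2 := hw.2.duality hS.parabolic hτ.le hz'
  have h3 : ∫ s, ⟪w s, z (t + s)⟫ ∂timeMeasure (T - t)
      = ∫ s, ⟪z (t + s), w s⟫ ∂timeMeasure (T - t) := by
    congr 1; ext s; exact real_inner_comm _ _
  have h4 : ∫ s, ⟪-C (φ s), q (t + s)⟫ ∂timeMeasure (T - t)
      = ∫ s, ⟪-C (q (t + s)), φ s⟫ ∂timeMeasure (T - t) := by
    congr 1; ext s; rw [inner_neg_left, inner_neg_left, hS.symm, real_inner_comm]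
  rw [h3, h4] at h1
  rw [inner_zero_right, zero_add, hφ] at h2
  rw [add_zero] at h1
  rw [inner_add_right, hh.inner_eq hS hR ht hw, ← hR.symm hS hτ, real_inner_comm (z t)]
  linarith

/-- In the reversed time s = T - t the equation is z' + (A* + R(s)C)z = 0 with z(0) = h₁. The added
term is measurable in s and bounded on H, so it only raises the Gårding constant γ by M‖C‖, and the
time dependent solution operator applies. -/
theorem exists_feedback [SecondCountableTopology H] (hS : IsControlSystem ι A C)
    (hR : IsRiccatiFamily ι A C R) (hT : 0 < T) (h₁ : H) : ∃ h, IsFeedback ι A C R T h₁ h := by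
  obtain ⟨P, M, hM, hP, hPM⟩ := hR.exists_clm hS hT
  obtain ⟨α, γ, hα, hγ, hA⟩ := hS.parabolic.garding
  set Q : ℝ → V →L[ℝ] V := fun s => (adjoint ι).comp ((P s).comp (C.comp ι))
  have hPmeas : ∀ u : ℝ → H, AEStronglyMeasurable u (timeMeasure T) →
      AEStronglyMeasurable (fun s => P s (u s)) (timeMeasure T) := fun u hu => by
    refine (hR.aestronglyMeasurable hS hu).congr ?_
    filter_upwards [ae_restrict_mem measurableSet_Ioc] with s hs
    rw [hP s hs.1]
  have hQm : ∀ u : Lp V 2 (timeMeasure T),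
      AEStronglyMeasurable (fun s => Q s (u s)) (timeMeasure T) := fun u =>
    (adjoint ι).continuous.comp_aestronglyMeasurable (hPmeas _
      ((C.comp ι).continuous.comp_aestronglyMeasurable (Lp.aestronglyMeasurable u)))
  have hQb : ∀ᵐ s ∂timeMeasure T, ‖Q s‖ ≤ ‖adjoint ι‖ * (M * ‖C.comp ι‖) := by
    filter_upwards [ae_restrict_mem measurableSet_Ioc] with s hs
    refine (ContinuousLinearMap.opNorm_comp_le _ _).trans ?_
    refine mul_le_mul_of_nonneg_left ?_ (norm_nonneg _)
    refine (ContinuousLinearMap.opNorm_comp_le _ _).trans ?_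
    exact mul_le_mul_of_nonneg_right (hPM s hs) (norm_nonneg _)
  set 𝔸 := opLp (adjoint A) T + pointwiseL Q _ hQm hQb with h𝔸
  have h𝔸u : ∀ u : Lp V 2 (timeMeasure T), 𝔸 u =ᵐ[timeMeasure T]
      fun s => adjoint A (u s) + adjoint ι (P s (C (ι (u s)))) := fun u => by
    filter_upwards [Lp.coeFn_add (opLp (adjoint A) T u) (pointwiseL Q _ hQm hQb u),
      (adjoint A).coeFn_compLpL u, coeFn_pointwiseL Q _ hQm hQb u] with s h1 h2 h3
    rw [h𝔸, add_apply, h1, Pi.add_apply, h2, h3]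
    rfl
  have hG : Garding ι 𝔸 α (γ + M * ‖C‖) := fun u => by
    filter_upwards [h𝔸u u, ae_restrict_mem measurableSet_Ioc] with s h1 hs
    rw [h1, inner_add_left, ContinuousLinearMap.adjoint_inner_left (A := ι)]
    have h2 := hA.dual (u s)
    have h3 : |⟪P s (C (ι (u s))), ι (u s)⟫| ≤ M * ‖C‖ * ‖ι (u s)‖ ^ 2 := by
      refine (abs_real_inner_le_norm _ _).trans ?_
      have h4 := (P s).le_of_opNorm_le (hPM s hs) (C (ι (u s)))
      have h5 := mul_le_mul_of_nonneg_left (C.le_opNorm (ι (u s))) hM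
      nlinarith [norm_nonneg (ι (u s))]
    have := neg_abs_le ⟪P s (C (ι (u s))), ι (u s)⟫
    linarith
  obtain ⟨G, -, hG2, hG3, hG4⟩ := exists_solution_operator hT.le hS.parabolic.dense hα
    (by positivity : 0 ≤ γ + M * ‖C‖) hG
  set e : H × Lp V 2 (timeMeasure T) := (h₁, 0) with he
  set z := (G e).1
  set Z := (G e).2
  have hZz : ∀ᵐ s ∂timeMeasure T, ι (Z s) = z s := by
    have h5 := coeFn_bcfLp (T := T) z
    rw [hG2 e] at h5
    filter_upwards [h5, ι.coeFn_compLpL Z] with s h6 h7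
    rw [← h7, h6]
  have hzm : MemLp z 2 (timeMeasure T) := memLp_of_continuousOn z.continuous.continuousOn
  have hg : MemLp (fun s => -R s (C (z s))) 2 (timeMeasure T) := by
    refine hzm.of_le_mul (c := M * ‖C‖) ?_ ?_
    · exact (hR.aestronglyMeasurable hS
        (C.continuous.comp_aestronglyMeasurable hzm.aestronglyMeasurable)).neg
    · filter_upwards [ae_restrict_mem measurableSet_Ioc] with s hs
      rw [norm_neg, ← hP s hs.1, mul_assoc]
      exact ((P s).le_of_opNorm_le (hPM s hs) _).trans
        (mul_le_mul_of_nonneg_left (C.le_opNorm _) hM)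
  -- The perturbation is moved from the operator to the source, which gives a solution of the
  -- equation for A* alone.
  have hF : e.2 - 𝔸 Z = sourceLp ι hg - opLp (adjoint A) T Z := by
    refine Lp.ext ?_
    filter_upwards [Lp.coeFn_sub e.2 (𝔸 Z), Lp.coeFn_sub (sourceLp ι hg) (opLp (adjoint A) T Z),
      h𝔸u Z, coeFn_sourceLp ι hg, (adjoint A).coeFn_compLpL Z, hZz,
      ae_restrict_mem measurableSet_Ioc, Lp.coeFn_zero V 2 (timeMeasure T)]
      with s h1 h2 h3 h4 h5 h6 h7 h8
    rw [h1, h2, Pi.sub_apply, Pi.sub_apply, h3, h4, h5, h6, hP s h7.1, h8, map_neg]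
    simp only [Pi.zero_apply]
    abel
  have hmild : IsMild ι (adjoint A) T h₁ (sourceLp ι hg) z Z :=
    ⟨hZz, fun t _ => by rw [← hF]; exact hG4 e t⟩
  refine ⟨fun t => z (T - t), ?_⟩
  rw [IsFeedback, IsBack]
  simp only [sub_sub_cancel]
  exact ⟨hg, z.continuous.continuousOn, hG3 e, Z, (isMild_iff hg).1 hmild⟩

end RiccatiFamily

/-! ### Approximation of smooth functions by averages over small cubes -/

section Rellich

/-- The Cauchy–Schwarz inequality for the square of an integral. -/
theorem sq_lintegral_le {α : Type*} [MeasurableSpace α] {μ : Measure α} {f : α → ℝ≥0∞}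
    (hf : AEMeasurable f μ) : (∫⁻ x, f x ∂μ) ^ 2 ≤ μ univ * ∫⁻ x, f x ^ 2 ∂μ := by
  have h := ENNReal.lintegral_mul_le_Lp_mul_Lq μ Real.HolderConjugate.two_two
    (aemeasurable_const (b := (1 : ℝ≥0∞))) hf
  simp only [Pi.mul_apply, one_mul, ENNReal.one_rpow, lintegral_const] at h
  have h2 := pow_le_pow_left₀ zero_le h 2
  have h3 : ∀ x : ℝ≥0∞, (x ^ (1 / 2 : ℝ)) ^ 2 = x := fun x => by
    rw [← ENNReal.rpow_natCast, ← ENNReal.rpow_mul]; norm_num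
  rw [mul_pow, h3, h3] at h2
  simpa only [ENNReal.rpow_two] using h2

variable {n : ℕ}

theorem enorm_gradient (φ : E n → ℝ) (x : E n) : ‖gradient φ x‖ₑ = ‖fderiv ℝ φ x‖ₑ := by
  rw [gradient, ← ofReal_norm, ← ofReal_norm, LinearIsometryEquiv.norm_map]

theorem continuous_gradient {φ : E n → ℝ} (hφ : ContDiff ℝ 1 φ) : Continuous (gradient φ) :=
  (InnerProductSpace.toDual ℝ (E n)).symm.continuous.comp (hφ.continuous_fderiv one_ne_zero)

/-- The `L²` modulus of continuity of a smooth function. -/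
theorem lintegral_translate_sub_le {φ : E n → ℝ} (hφ : ContDiff ℝ 1 φ) (z : E n) :
    ∫⁻ x, ‖φ (x + z) - φ x‖ₑ ^ 2 ≤ ‖z‖ₑ ^ 2 * ∫⁻ x, ‖gradient φ x‖ₑ ^ 2 := by
  have hg := continuous_gradient hφ
  -- The increment is the integral of ∇φ(x + tz)·z over t in (0,1), and Cauchy–Schwarz gives the
  -- pointwise bound. Integration in x then removes the shift tz by Tonelli and translation
  -- invariance.
  have hpt : ∀ x, ‖φ (x + z) - φ x‖ₑ ^ 2
      ≤ ‖z‖ₑ ^ 2 * ∫⁻ t in Ioc (0 : ℝ) 1, ‖gradient φ (x + t • z)‖ₑ ^ 2 := by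
    intro x
    have hderiv : ∀ t ∈ uIcc (0 : ℝ) 1, HasDerivAt (fun t : ℝ => φ (x + t • z))
        (fderiv ℝ φ (x + t • z) z) t := by
      intro t _
      have h1 : HasDerivAt (fun t : ℝ => x + t • z) z t := by
        simpa using ((hasDerivAt_id t).smul_const z).const_add x
      exact ((hφ.differentiable one_ne_zero _).hasFDerivAt).comp_hasDerivAt t h1
    have hcont : Continuous fun t : ℝ => fderiv ℝ φ (x + t • z) z :=
      ((hφ.continuous_fderiv one_ne_zero).comp (by fun_prop)).clm_apply continuous_const
    have h2 := intervalIntegral.integral_eq_sub_of_hasDerivAt hderiv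
      (hcont.intervalIntegrable _ _)
    simp only [one_smul, zero_smul, add_zero] at h2
    rw [← h2, intervalIntegral.integral_of_le zero_le_one]
    have h3 : ‖∫ t in Ioc (0 : ℝ) 1, fderiv ℝ φ (x + t • z) z‖ₑ
        ≤ ∫⁻ t in Ioc (0 : ℝ) 1, ‖gradient φ (x + t • z)‖ₑ * ‖z‖ₑ := by
      refine (enorm_integral_le_lintegral_enorm _).trans (lintegral_mono fun t => ?_)
      rw [enorm_gradient]
      exact ContinuousLinearMap.le_opENorm _ _
    have hm : Measurable fun t : ℝ => ‖gradient φ (x + t • z)‖ₑ :=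
      (hg.comp (by fun_prop)).enorm.measurable
    rw [lintegral_mul_const _ hm] at h3
    calc _ ≤ ((∫⁻ t in Ioc (0 : ℝ) 1, ‖gradient φ (x + t • z)‖ₑ) * ‖z‖ₑ) ^ 2 :=
          pow_le_pow_left₀ zero_le h3 2
      _ ≤ _ := by
          rw [mul_pow, mul_comm]
          refine mul_le_mul_right ?_ _
          refine (sq_lintegral_le hm.aemeasurable).trans ?_
          simp
  calc ∫⁻ x, ‖φ (x + z) - φ x‖ₑ ^ 2
      ≤ ∫⁻ x, ‖z‖ₑ ^ 2 * ∫⁻ t in Ioc (0 : ℝ) 1, ‖gradient φ (x + t • z)‖ₑ ^ 2 :=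
        lintegral_mono hpt
    _ = ‖z‖ₑ ^ 2 * ∫⁻ x, ∫⁻ t in Ioc (0 : ℝ) 1, ‖gradient φ (x + t • z)‖ₑ ^ 2 :=
        lintegral_const_mul' _ _ (by simp)
    _ = ‖z‖ₑ ^ 2 * ∫⁻ t in Ioc (0 : ℝ) 1, ∫⁻ x, ‖gradient φ (x + t • z)‖ₑ ^ 2 := by
        rw [lintegral_lintegral_swap]
        refine Measurable.aemeasurable ?_
        have : Continuous fun p : E n × ℝ => gradient φ (p.1 + p.2 • z) :=
          hg.comp (by fun_prop)
        exact this.enorm.measurable.pow_const 2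
    _ = ‖z‖ₑ ^ 2 * ∫⁻ x, ‖gradient φ x‖ₑ ^ 2 := by
        simp only [lintegral_add_right_eq_self fun x => ‖gradient φ x‖ₑ ^ 2]
        simp

/-- The index of the cube of side `ε` that contains `x`. -/
def cubeIndex (ε : ℝ) (x : E n) : Fin n → ℤ := fun i => ⌊x i / ε⌋

/-- The half open cube of side `ε` with index `k`. -/
def cube (ε : ℝ) (k : Fin n → ℤ) : Set (E n) := cubeIndex ε ⁻¹' {k}

theorem measurable_cubeIndex (ε : ℝ) : Measurable (cubeIndex ε : E n → Fin n → ℤ) :=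
  measurable_pi_lambda _ fun i => Int.measurable_floor.comp
    ((EuclideanSpace.proj (𝕜 := ℝ) i).continuous.measurable.div_const ε)

theorem measurableSet_cube (ε : ℝ) (k : Fin n → ℤ) : MeasurableSet (cube ε k) :=
  measurable_cubeIndex ε (measurableSet_singleton k)

theorem volume_cube {ε : ℝ} (hε : 0 < ε) (k : Fin n → ℤ) :
    volume (cube ε k) = ENNReal.ofReal (ε ^ n) := by
  have h1 : cube ε k = (MeasurableEquiv.toLp 2 (Fin n → ℝ)).symm ⁻¹'
      (univ.pi fun i => Ico (k i * ε) ((k i + 1) * ε)) := by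
    ext x
    simp only [cube, cubeIndex, mem_preimage, mem_singleton_iff, funext_iff, Int.floor_eq_iff,
      mem_univ_pi, mem_Ico, le_div_iff₀ hε, div_lt_iff₀ hε]
    rfl
  rw [h1, (EuclideanSpace.volume_preserving_symm_measurableEquiv_toLp (Fin n)).measure_preimage
    (MeasurableSet.univ_pi fun i => measurableSet_Ico).nullMeasurableSet, Real.volume_pi_Ico]
  have : ∀ i : Fin n, (k i + 1) * ε - k i * ε = ε := fun i => by ring
  simp [this, ENNReal.ofReal_pow hε.le]

theorem norm_sub_le_of_cubeIndex {ε : ℝ} (hε : 0 < ε) {x y : E n}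
    (h : cubeIndex ε x = cubeIndex ε y) : ‖y - x‖ ≤ Real.sqrt n * ε := by
  rw [EuclideanSpace.norm_eq]
  refine Real.sqrt_le_iff.2 ⟨by positivity, ?_⟩
  rw [mul_pow, Real.sq_sqrt (Nat.cast_nonneg _)]
  have : ∀ i ∈ Finset.univ, ‖(y - x) i‖ ^ 2 ≤ ε ^ 2 := by
    intro i _
    have h1 := congrFun h i
    simp only [cubeIndex] at h1
    have h2 := Int.abs_sub_lt_one_of_floor_eq_floor h1
    rw [← sub_div, abs_div, abs_of_pos hε, div_lt_one hε, abs_sub_comm] at h2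
    rw [Real.norm_eq_abs]
    exact pow_le_pow_left₀ (abs_nonneg _) h2.le 2
  refine (Finset.sum_le_sum this).trans ?_
  simp

/-- φ(x) minus the average is an average of φ(x) - φ(y); Cauchy–Schwarz is applied on Q. -/
theorem enorm_sub_average_sq_le {φ : E n → ℝ} (hφ : Continuous φ) (hc : HasCompactSupport φ)
    {Q : Set (E n)} (hQ0 : volume Q ≠ 0) (hQ : volume Q ≠ ∞) (x : E n) :
    ‖φ x - ⨍ y in Q, φ y‖ₑ ^ 2 ≤ (volume Q)⁻¹ * ∫⁻ y in Q, ‖φ y - φ x‖ₑ ^ 2 := by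
  have hi : IntegrableOn φ Q := (hφ.integrable_of_hasCompactSupport hc).integrableOn
  have h1 : φ x - ⨍ y in Q, φ y = -((volume.real Q)⁻¹ • ∫ y in Q, (φ y - φ x)) := by
    rw [integral_sub hi (integrableOn_const hQ), setAverage_eq, setIntegral_const, smul_sub,
      smul_smul, inv_mul_cancel₀ (by rw [measureReal_def]; exact ENNReal.toReal_ne_zero.2 ⟨hQ0, hQ⟩),
      one_smul]
    ring
  have h2 : ‖(volume.real Q)⁻¹‖ₑ = (volume Q)⁻¹ := by
    rw [measureReal_def, ← ENNReal.toReal_inv, Real.enorm_of_nonneg ENNReal.toReal_nonneg,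
      ENNReal.ofReal_toReal (ENNReal.inv_ne_top.2 hQ0)]
  have h3 : ‖∫ y in Q, (φ y - φ x)‖ₑ ^ 2 ≤ volume Q * ∫⁻ y in Q, ‖φ y - φ x‖ₑ ^ 2 := by
    refine (pow_le_pow_left₀ zero_le (enorm_integral_le_lintegral_enorm _) 2).trans ?_
    refine (sq_lintegral_le ?_).trans_eq ?_
    · exact (hφ.sub continuous_const).enorm.measurable.aemeasurable
    · rw [Measure.restrict_apply_univ]
  rw [h1, enorm_neg, enorm_smul, mul_pow, h2]
  calc (volume Q)⁻¹ ^ 2 * ‖∫ y in Q, (φ y - φ x)‖ₑ ^ 2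
      ≤ (volume Q)⁻¹ ^ 2 * (volume Q * ∫⁻ y in Q, ‖φ y - φ x‖ₑ ^ 2) := by gcongr
    _ = (volume Q)⁻¹ * ((volume Q)⁻¹ * volume Q) * ∫⁻ y in Q, ‖φ y - φ x‖ₑ ^ 2 := by ring
    _ = _ := by rw [ENNReal.inv_mul_cancel hQ0 hQ, mul_one]

/-- The `L²` distance of a test function to its averages over cubes of side `ε`. -/
theorem exists_lintegral_sub_average_le (n : ℕ) : ∃ K : ℝ, 0 ≤ K ∧ ∀ ε : ℝ, 0 < ε →
    ∀ φ : E n → ℝ, ContDiff ℝ 1 φ → HasCompactSupport φ →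
      ∫⁻ x, ‖φ x - ⨍ y in cube ε (cubeIndex ε x), φ y‖ₑ ^ 2
        ≤ ENNReal.ofReal (K * ε ^ 2) * ∫⁻ x, ‖gradient φ x‖ₑ ^ 2 := by
  set κ := volume (Metric.ball (0 : E n) 1)
  have hκ : κ ≠ ∞ := measure_ball_lt_top.ne
  -- A cube of side ε lies in the closed ball of radius r = √n ε about each of its points. The ratio
  -- of the volumes of ball and cube is √nⁿ κ, and the modulus of continuity over |z| ≤ r
  -- contributes r² = √n² ε².
  refine ⟨Real.sqrt n ^ n * κ.toReal * Real.sqrt n ^ 2, by positivity, fun ε hε φ hφ hc => ?_⟩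
  set r := Real.sqrt n * ε with hr
  have hr0 : 0 ≤ r := by positivity
  set v := ENNReal.ofReal (ε ^ n) with hv
  have hv0 : v ≠ 0 := by rw [hv]; simpa using by positivity
  have hvt : v ≠ ∞ := ENNReal.ofReal_ne_top
  set B := Metric.closedBall (0 : E n) r
  have hB : volume B = ENNReal.ofReal (r ^ n) * κ := by
    have := Measure.addHaar_closedBall (volume : Measure (E n)) 0 hr0
    rwa [finrank_euclideanSpace_fin] at this
  have hpt : ∀ x, ‖φ x - ⨍ y in cube ε (cubeIndex ε x), φ y‖ₑ ^ 2
      ≤ v⁻¹ * ∫⁻ z in B, ‖φ (x + z) - φ x‖ₑ ^ 2 := by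
    intro x
    have hvol := volume_cube hε (cubeIndex ε x)
    have h1 := enorm_sub_average_sq_le hφ.continuous hc (Q := cube ε (cubeIndex ε x))
      (by rw [hvol]; exact hv0) (by rw [hvol]; exact hvt) x
    rw [hvol] at h1
    refine h1.trans (mul_le_mul_right ?_ _)
    have h2 : ∫⁻ z in B, ‖φ (x + z) - φ x‖ₑ ^ 2
        = ∫⁻ y in Metric.closedBall x r, ‖φ y - φ x‖ₑ ^ 2 := by
      rw [← lintegral_indicator Metric.isClosed_closedBall.measurableSet,
        ← lintegral_indicator Metric.isClosed_closedBall.measurableSet]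
      refine Eq.trans ?_ (lintegral_add_left_eq_self _ x)
      congr 1
      ext z
      simp only [indicator, Metric.mem_closedBall, dist_zero_right, dist_self_add_left]
    rw [h2]
    refine lintegral_mono_set fun y hy => ?_
    rw [Metric.mem_closedBall, dist_eq_norm]
    exact norm_sub_le_of_cubeIndex hε (Eq.symm hy)
  calc ∫⁻ x, ‖φ x - ⨍ y in cube ε (cubeIndex ε x), φ y‖ₑ ^ 2
      ≤ ∫⁻ x, v⁻¹ * ∫⁻ z in B, ‖φ (x + z) - φ x‖ₑ ^ 2 := lintegral_mono hpt
    _ = v⁻¹ * ∫⁻ z in B, ∫⁻ x, ‖φ (x + z) - φ x‖ₑ ^ 2 := by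
        rw [lintegral_const_mul' _ _ (ENNReal.inv_ne_top.2 hv0), lintegral_lintegral_swap]
        refine Measurable.aemeasurable ?_
        have : Continuous fun p : E n × E n => φ (p.1 + p.2) - φ p.1 :=
          (hφ.continuous.comp (by fun_prop)).sub (hφ.continuous.comp continuous_fst)
        exact this.enorm.measurable.pow_const 2
    _ ≤ v⁻¹ * ∫⁻ z in B, ENNReal.ofReal (r ^ 2) * ∫⁻ x, ‖gradient φ x‖ₑ ^ 2 := by
        refine mul_le_mul_right (setLIntegral_mono' Metric.isClosed_closedBall.measurableSet
          fun z hz => (lintegral_translate_sub_le hφ z).trans (mul_le_mul_left ?_ _)) _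
        rw [ENNReal.ofReal_pow hr0, ← ofReal_norm]
        exact pow_le_pow_left₀ zero_le (ENNReal.ofReal_le_ofReal
          (by simpa [B] using hz)) 2
    _ = _ := by
        rw [setLIntegral_const, hB]
        have h3 : v⁻¹ * ENNReal.ofReal (r ^ n) = ENNReal.ofReal (Real.sqrt n ^ n) := by
          rw [hr, mul_pow, ENNReal.ofReal_mul (by positivity), ← hv, mul_comm, mul_assoc,
            ENNReal.mul_inv_cancel hv0 hvt, mul_one]
        have h4 : ENNReal.ofReal (Real.sqrt n ^ n * κ.toReal * Real.sqrt n ^ 2 * ε ^ 2)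
            = ENNReal.ofReal (Real.sqrt n ^ n) * κ * ENNReal.ofReal (r ^ 2) := by
          rw [hr, mul_pow, mul_assoc _ (Real.sqrt n ^ 2), ENNReal.ofReal_mul (by positivity),
            ENNReal.ofReal_mul (by positivity), ENNReal.ofReal_toReal hκ]
        rw [h4, ← h3]
        ring

end Rellich

/-! ### The embedding of H¹₀(Ω) in L²(Ω): density and compactness -/

section Embedding

variable {n : ℕ} {Ω : Set (E n)}

/-- The embedding of `H¹₀(Ω)` into `L²(Ω)`. -/
def valL (Ω : Set (E n)) : H10 Ω →L[ℝ] L2 Ω :=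
  (WithLp.fstL 2 ℝ (L2 Ω) (L2V Ω)).comp (testGraph Ω).topologicalClosure.subtypeL

/-- The weak gradient on `H¹₀(Ω)`. -/
def gradL (Ω : Set (E n)) : H10 Ω →L[ℝ] L2V Ω :=
  (WithLp.sndL 2 ℝ (L2 Ω) (L2V Ω)).comp (testGraph Ω).topologicalClosure.subtypeL

theorem valL_apply (w : H10 Ω) : valL Ω w = w.val := rfl

theorem gradL_apply (w : H10 Ω) : gradL Ω w = w.grad := rfl

theorem norm_sq_H10 (w : H10 Ω) : ‖w‖ ^ 2 = ‖w.val‖ ^ 2 + ‖w.grad‖ ^ 2 :=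
  WithLp.prod_norm_sq_eq_of_L2 w.1

theorem IsTestFunction.contDiff_one {φ : E n → ℝ} (hφ : IsTestFunction Ω φ) : ContDiff ℝ 1 φ :=
  hφ.smooth.of_le (by simp)

theorem IsTestFunction.hasCompactSupport_gradient {φ : E n → ℝ} (hφ : IsTestFunction Ω φ) :
    HasCompactSupport (gradient φ) :=
  (hφ.compactSupport.fderiv ℝ).comp_left (map_zero _)

theorem IsTestFunction.eq_zero {φ : E n → ℝ} (hφ : IsTestFunction Ω φ) {x : E n} (hx : x ∉ Ω) :
    φ x = 0 :=
  image_eq_zero_of_notMem_tsupport fun h => hx (hφ.tsupport_subset h)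

theorem IsTestFunction.gradient_eq_zero {φ : E n → ℝ} (hφ : IsTestFunction Ω φ) {x : E n}
    (hx : x ∉ Ω) : gradient φ x = 0 := by
  have h : fderiv ℝ φ x = 0 := by
    by_contra h
    exact hx (hφ.tsupport_subset (support_fderiv_subset ℝ h))
  rw [gradient, h, map_zero]

theorem IsTestFunction.memLp {φ : E n → ℝ} (hφ : IsTestFunction Ω φ) :
    MemLp φ 2 (volume.restrict Ω) :=
  (hφ.contDiff_one.continuous.memLp_of_hasCompactSupport hφ.compactSupport).restrict _

theorem IsTestFunction.memLp_gradient {φ : E n → ℝ} (hφ : IsTestFunction Ω φ) :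
    MemLp (gradient φ) 2 (volume.restrict Ω) :=
  ((continuous_gradient hφ.contDiff_one).memLp_of_hasCompactSupport
    hφ.hasCompactSupport_gradient).restrict _

/-- A test function as an element of `H¹₀(Ω)`. -/
def IsTestFunction.toH10 {φ : E n → ℝ} (hφ : IsTestFunction Ω φ) : H10 Ω :=
  ⟨WithLp.toLp 2 (hφ.memLp.toLp φ, hφ.memLp_gradient.toLp _),
    Submodule.le_topologicalClosure _
      ⟨φ, hφ, hφ.memLp.coeFn_toLp, hφ.memLp_gradient.coeFn_toLp⟩⟩

theorem IsTestFunction.val_toH10 {φ : E n → ℝ} (hφ : IsTestFunction Ω φ) :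
    hφ.toH10.val =ᵐ[volume.restrict Ω] φ :=
  hφ.memLp.coeFn_toLp

/-- `H¹₀(Ω)` is dense in `L²(Ω)`. -/
theorem denseRange_valL (hΩ : IsOpen Ω) : DenseRange (valL Ω) := by
  refine denseRange_of_orthogonal _ fun u hu => ?_
  have hloc : LocallyIntegrableOn u Ω := by
    exact locallyIntegrableOn_of_locallyIntegrable_restrict
      ((Lp.memLp u).locallyIntegrable one_le_two)
  have h := hΩ.ae_eq_zero_of_integral_contDiff_smul_eq_zero hloc fun φ h1 h2 h3 => by
    have hφ : IsTestFunction Ω φ := ⟨h1, h2, h3⟩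
    have h4 := hu hφ.toH10
    rw [valL_apply, L2.inner_def] at h4
    have h5 : ∫ x, φ x • u x = ∫ x in Ω, φ x • u x := by
      refine (setIntegral_eq_integral_of_forall_compl_eq_zero fun x hx => ?_).symm
      rw [hφ.eq_zero hx, zero_smul]
    rw [h5, ← h4]
    refine integral_congr_ae ?_
    filter_upwards [hφ.val_toH10] with x hx
    rw [hx]
    simp [mul_comm]
  refine (Lp.eq_zero_iff_ae_eq_zero).2 ?_
  rw [← ae_restrict_iff' hΩ.measurableSet] at h
  exact h

theorem volume_restrict_cube_ne_top {ε : ℝ} (hε : 0 < ε) (k : Fin n → ℤ) :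
    (volume.restrict Ω) (cube ε k) ≠ ∞ :=
  ((Measure.restrict_apply_le _ _).trans_lt
    ((volume_cube hε k).trans_lt ENNReal.ofReal_lt_top)).ne

/-- The indicator function of a cube as an element of `L²(Ω)`. -/
def cubeFn (Ω : Set (E n)) {ε : ℝ} (hε : 0 < ε) (k : Fin n → ℤ) : L2 Ω :=
  indicatorConstLp 2 (measurableSet_cube ε k) (volume_restrict_cube_ne_top hε k) 1

/-- The operator that averages over the cubes of side `ε` with index in `S`. -/
def averageL (Ω : Set (E n)) {ε : ℝ} (hε : 0 < ε) (S : Finset (Fin n → ℤ)) : L2 Ω →L[ℝ] L2 Ω :=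
  ∑ k ∈ S, (ContinuousLinearMap.toSpanSingleton ℝ ((ε ^ n)⁻¹ • cubeFn Ω hε k)).comp
    (innerSL ℝ (cubeFn Ω hε k))

theorem isCompactOperator_averageL {ε : ℝ} (hε : 0 < ε) (S : Finset (Fin n → ℤ)) :
    IsCompactOperator (averageL Ω hε S) := by
  unfold averageL
  induction S using Finset.cons_induction with
  | empty => simpa using isCompactOperator_zero
  | cons k S hk ih =>
    rw [Finset.sum_cons]
    exact ((isCompactOperator_of_locallyCompactSpace_dom (innerSL ℝ (cubeFn Ω hε k))).clm_comp
      (ContinuousLinearMap.toSpanSingleton ℝ ((ε ^ n)⁻¹ • cubeFn Ω hε k))).add ih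

theorem coeFn_averageL {ε : ℝ} (hε : 0 < ε) (S : Finset (Fin n → ℤ)) (u : L2 Ω) :
    averageL Ω hε S u =ᵐ[volume.restrict Ω] fun x =>
      ∑ k ∈ S, ⟪cubeFn Ω hε k, u⟫ * ((ε ^ n)⁻¹ * (cube ε k).indicator 1 x) := by
  unfold averageL
  induction S using Finset.cons_induction with
  | empty =>
    simp only [Finset.sum_empty]
    exact Lp.coeFn_zero _ _ _
  | cons k S hk ih =>
    simp only [Finset.sum_cons]
    rw [add_apply]
    refine (Lp.coeFn_add _ _).trans ?_
    simp only [ContinuousLinearMap.comp_apply, ContinuousLinearMap.toSpanSingleton_apply,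
      innerSL_apply_apply]
    filter_upwards [ih, Lp.coeFn_smul ⟪cubeFn Ω hε k, u⟫ ((ε ^ n)⁻¹ • cubeFn Ω hε k),
      Lp.coeFn_smul (ε ^ n)⁻¹ (cubeFn Ω hε k), indicatorConstLp_coeFn (p := 2)
        (hs := measurableSet_cube ε k) (hμs := volume_restrict_cube_ne_top (Ω := Ω) hε k)
        (c := (1 : ℝ))] with x h1 h2 h3 h4
    rw [Pi.add_apply, h1, h2, Pi.smul_apply, h3, Pi.smul_apply, cubeFn, h4]
    rfl

/-- Boundedness of Ω enters here: finitely many cubes meet Ω, so averaging over all of them is an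
operator of finite rank. -/
theorem finite_image_cubeIndex {ε : ℝ} (hΩb : Bornology.IsBounded Ω) :
    (cubeIndex ε '' Ω).Finite := by
  obtain ⟨R, hR⟩ := hΩb.exists_norm_le
  refine (Set.finite_Icc (fun _ : Fin n => ⌊-|R / ε|⌋) (fun _ => ⌊|R / ε|⌋)).subset ?_
  rintro _ ⟨x, hx, rfl⟩
  have h : ∀ i, |x i / ε| ≤ |R / ε| := fun i => by
    rw [abs_div, abs_div]
    refine div_le_div_of_nonneg_right ?_ (abs_nonneg _)
    exact ((PiLp.norm_apply_le x i).trans (hR x hx)).trans (le_abs_self R)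
  exact ⟨fun i => Int.floor_le_floor (abs_le.1 (h i)).1,
    fun i => Int.floor_le_floor (abs_le.1 (h i)).2⟩

theorem inner_cubeFn {ε : ℝ} (hε : 0 < ε) (k : Fin n → ℤ) {φ : E n → ℝ} (hφ : IsTestFunction Ω φ)
    {u : L2 Ω} (hu : u =ᵐ[volume.restrict Ω] φ) :
    ⟪cubeFn Ω hε k, u⟫ = ∫ x in cube ε k, φ x := by
  rw [cubeFn, L2.inner_indicatorConstLp_one, Measure.restrict_restrict (measurableSet_cube ε k)]
  have h1 : ∀ᵐ x ∂volume.restrict (cube ε k ∩ Ω), u x = φ x :=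
    ae_mono (Measure.restrict_mono inter_subset_right le_rfl) hu
  rw [integral_congr_ae h1]
  exact (setIntegral_eq_of_subset_of_forall_sdiff_eq_zero (measurableSet_cube ε k)
    inter_subset_left fun x hx => hφ.eq_zero fun h => hx.2 ⟨hx.1, h⟩).symm

theorem enorm_sq_eq_lintegral {α F : Type*} [MeasurableSpace α] {μ : Measure α}
    [NormedAddCommGroup F] (u : Lp F 2 μ) : ‖u‖ₑ ^ 2 = ∫⁻ x, ‖u x‖ₑ ^ 2 ∂μ := by
  have h := eLpNorm_nnreal_pow_eq_lintegral (μ := μ) (f := u) (p := 2) two_ne_zero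
  simp only [NNReal.coe_ofNat, ENNReal.rpow_two] at h
  rw [Lp.enorm_def]
  exact h

/-- The averages over cubes of side `ε` approximate `H¹₀` functions uniformly in `L²`. -/
theorem exists_norm_sub_averageL_le (hΩ : IsOpen Ω) (hΩb : Bornology.IsBounded Ω) :
    ∃ K : ℝ, 0 ≤ K ∧ ∀ (ε : ℝ) (hε : 0 < ε), ∃ S : Finset (Fin n → ℤ),
      ∀ w : H10 Ω, ‖w.val - averageL Ω hε S w.val‖ ≤ K * ε * ‖w‖ := by
  obtain ⟨K, hK, h⟩ := exists_lintegral_sub_average_le n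
  refine ⟨Real.sqrt K, Real.sqrt_nonneg _, fun ε hε =>
    ⟨(finite_image_cubeIndex (ε := ε) hΩb).toFinset, ?_⟩⟩
  set S := (finite_image_cubeIndex (ε := ε) hΩb).toFinset
  set f : WithLp 2 (L2 Ω × L2V Ω) →L[ℝ] L2 Ω :=
    (ContinuousLinearMap.id ℝ _ - averageL Ω hε S).comp (WithLp.fstL 2 ℝ (L2 Ω) (L2V Ω)) with hf
  -- The estimate is a closed condition on w, so it passes from test functions to the closure, which
  -- is H¹₀(Ω).
  suffices hs : ∀ w ∈ testGraph Ω, ‖f w‖ ≤ Real.sqrt K * ε * ‖w‖ by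
    intro w
    have hcl : IsClosed {w | ‖f w‖ ≤ Real.sqrt K * ε * ‖w‖} :=
      isClosed_le f.continuous.norm (continuous_const.mul continuous_norm)
    exact closure_minimal hs hcl w.2
  rintro w ⟨φ, hφ, h1, h2⟩
  have h3 : ‖f w‖ₑ ^ 2 ≤ ENNReal.ofReal (K * ε ^ 2) * ‖w.snd‖ₑ ^ 2 := by
    rw [enorm_sq_eq_lintegral, enorm_sq_eq_lintegral]
    calc ∫⁻ x in Ω, ‖f w x‖ₑ ^ 2
        = ∫⁻ x in Ω, ‖φ x - ⨍ y in cube ε (cubeIndex ε x), φ y‖ₑ ^ 2 := by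
          refine lintegral_congr_ae ?_
          filter_upwards [Lp.coeFn_sub w.fst (averageL Ω hε S w.fst), coeFn_averageL hε S w.fst, h1,
            ae_restrict_mem hΩ.measurableSet] with x h4 h5 h6 hx
          have h7 : f w = w.fst - averageL Ω hε S w.fst := rfl
          rw [h7, h4, Pi.sub_apply, h5, h6, Finset.sum_eq_single (cubeIndex ε x)]
          · rw [inner_cubeFn hε _ hφ h1, indicator_of_mem (show x ∈ cube ε (cubeIndex ε x) from rfl), setAverage_eq, measureReal_def,
              volume_cube hε, ENNReal.toReal_ofReal (by positivity), Pi.one_apply, mul_one,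
              smul_eq_mul, mul_comm]
          · intro k _ hk
            rw [indicator_of_notMem (show x ∉ cube ε k from fun h => hk (Eq.symm h)), mul_zero, mul_zero]
          · intro h
            exact absurd ((Set.Finite.mem_toFinset _).2 (mem_image_of_mem _ hx)) h
      _ ≤ ∫⁻ x, ‖φ x - ⨍ y in cube ε (cubeIndex ε x), φ y‖ₑ ^ 2 :=
          setLIntegral_le_lintegral _ _
      _ ≤ _ := h ε hε φ hφ.contDiff_one hφ.compactSupport
      _ = ENNReal.ofReal (K * ε ^ 2) * ∫⁻ x in Ω, ‖gradient φ x‖ₑ ^ 2 := by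
          congr 1
          rw [← lintegral_indicator hΩ.measurableSet]
          congr 1
          ext x
          by_cases hx : x ∈ Ω
          · rw [indicator_of_mem hx]
          · rw [indicator_of_notMem hx, hφ.gradient_eq_zero hx]; simp
      _ = _ := by
          congr 1
          exact lintegral_congr_ae (h2.mono fun x hx => by simp only [hx])
  have h4 : ‖f w‖ ^ 2 ≤ K * ε ^ 2 * ‖w.snd‖ ^ 2 := by
    have := ENNReal.toReal_mono (by simp [ENNReal.mul_eq_top]) h3
    simpa [ENNReal.toReal_ofReal (show 0 ≤ K * ε ^ 2 by positivity)] using this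
  refine abs_le_of_sq_le_sq' ?_ (by positivity) |>.2
  rw [mul_pow, mul_pow, Real.sq_sqrt hK, WithLp.prod_norm_sq_eq_of_L2]
  refine h4.trans (mul_le_mul_of_nonneg_left ?_ (by positivity))
  exact le_add_of_nonneg_left (sq_nonneg _)

/-- The Rellich theorem: `H¹₀(Ω)` is compactly embedded in `L²(Ω)` if `Ω` is bounded. -/
theorem isCompactOperator_valL (hΩ : IsOpen Ω) (hΩb : Bornology.IsBounded Ω) :
    IsCompactOperator (valL Ω) := by
  obtain ⟨K, hK, h⟩ := exists_norm_sub_averageL_le hΩ hΩb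
  have hε : ∀ m : ℕ, (0 : ℝ) < 1 / (m + 1) := fun m => Nat.one_div_pos_of_nat
  choose S hS using fun m : ℕ => h (1 / (m + 1)) (hε m)
  -- The embedding is the limit in operator norm of its compositions with the finite rank averages,
  -- with error at most K/(m + 1).
  refine isCompactOperator_of_tendsto (l := Filter.atTop)
    (F := fun m => (averageL Ω (hε m) (S m)).comp (valL Ω)) ?_
    (Filter.Eventually.of_forall fun m => (isCompactOperator_averageL (hε m) (S m)).comp_clm _)
  refine (tendsto_iff_norm_sub_tendsto_zero (E := H10 Ω →L[ℝ] L2 Ω)).2 ?_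
  refine squeeze_zero (fun _ => by positivity) (fun m => ?_)
    (g := fun m : ℕ => K * (1 / (m + 1))) ?_
  · refine ContinuousLinearMap.opNorm_le_bound _ (by have := hε m; positivity) fun w => ?_
    rw [← norm_neg]
    simpa [valL_apply] using hS m w
  · simpa using tendsto_one_div_add_atTop_nhds_zero_nat.const_mul K

end Embedding

/-- Backward weak solutions in terms of the equation integrated from `t` to `T`. -/
theorem isBack_iff {V H : Type*} [NormedAddCommGroup V] [InnerProductSpace ℝ V] [CompleteSpace V]
    [NormedAddCommGroup H] [InnerProductSpace ℝ H] [CompleteSpace H] {T : ℝ}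
    {ι : V →L[ℝ] H} {A : V →L[ℝ] V} {g : ℝ → H} {ψ₁ : H} {ψ : ℝ → H} :
    IsBack ι A T g ψ₁ ψ ↔ MemLp g 2 (timeMeasure T) ∧ ContinuousOn ψ (Icc 0 T) ∧ ψ T = ψ₁ ∧
      ∃ Y : Lp V 2 (timeMeasure T), (∀ᵐ t ∂timeMeasure T, ι (Y t) = ψ t) ∧
        ∀ v, ∀ t ∈ Icc 0 T, ⟪ψ t, ι v⟫ - ⟪ψ₁, ι v⟫ + ∫ s in t..T, ⟪A v, Y s⟫
          = ∫ s in t..T, ⟪g s, ι v⟫ := by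
  have key : ∀ (Y : Lp V 2 (timeMeasure T)) (v : V), ∀ t ∈ Icc 0 T,
      ∫ s in (0 : ℝ)..t, ⟪adjoint A (rev T Y s), v⟫ = ∫ s in (T - t)..T, ⟪A v, Y s⟫ := by
    intro Y v t ht
    have h1 := intervalIntegral.integral_comp_sub_left (a := 0) (b := t)
      (fun s => ⟪A v, Y s⟫) T
    rw [sub_zero] at h1
    rw [← h1, ← setIntegral_timeMeasure le_rfl ht.1 ht.2,
      ← setIntegral_timeMeasure le_rfl ht.1 ht.2]
    refine intervalIntegral.integral_congr_ae ?_
    filter_upwards [coeFn_rev Y] with s hs _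
    rw [hs, ContinuousLinearMap.adjoint_inner_left, real_inner_comm]
  have key2 : ∀ (v : V) (t : ℝ),
      ∫ s in (0 : ℝ)..t, ⟪g (T - s), ι v⟫ = ∫ s in (T - t)..T, ⟪g s, ι v⟫ := by
    intro v t
    have h1 := intervalIntegral.integral_comp_sub_left (a := 0) (b := t)
      (fun s => ⟪g s, ι v⟫) T
    rwa [sub_zero] at h1
  constructor
  · intro h
    obtain ⟨Y, h1, h2⟩ := IsWeak.weak h
    have hg := memLp_reverse (IsWeak.source_memLp h)
    simp only [sub_sub_cancel] at hg
    refine ⟨hg, IsBack.continuousOn h, IsBack.terminal h, rev T Y, ?_, fun v t ht => ?_⟩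
    · filter_upwards [coeFn_rev Y, ae_reverse h1] with t h3 h4
      rw [h3, h4, sub_sub_cancel]
    · have h3 := h2 v (T - t) (sub_mem_Icc ht)
      have h4 := key (rev T Y) v (T - t) (sub_mem_Icc ht)
      rw [rev_rev] at h4
      rw [h4, key2, sub_sub_cancel] at h3
      exact h3
  · rintro ⟨hg, hc, h0, Y, h1, h2⟩
    refine ⟨memLp_reverse hg, hc.comp (by fun_prop) fun t ht => sub_mem_Icc ht, by simpa using h0,
      rev T Y, ?_, fun v t ht => ?_⟩
    · filter_upwards [coeFn_rev Y, ae_reverse h1] with t h3 h4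
      rw [h3, h4]
    · rw [key Y v t ht, key2]
      exact h2 v (T - t) (sub_mem_Icc ht)

/-! ### Multiplication operators by bounded coefficients -/

section Multiplication

variable {α F : Type*} [MeasurableSpace α] {μ : Measure α} [NormedAddCommGroup F]
  [InnerProductSpace ℝ F]

theorem ae_norm_le_toReal_eLpNorm {f : α → F} (hf : MemLp f ∞ μ) :
    ∀ᵐ x ∂μ, ‖f x‖ ≤ (eLpNorm f ∞ μ).toReal := by
  filter_upwards [enorm_ae_le_eLpNormEssSup f μ] with x hx
  rw [← eLpNorm_exponent_top] at hx
  rw [← toReal_enorm]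
  exact ENNReal.toReal_mono hf.2.ne hx

/-- Multiplication by an essentially bounded function. -/
def mulL {a : α → ℝ} (ha : MemLp a ∞ μ) : Lp F 2 μ →L[ℝ] Lp F 2 μ :=
  pointwiseL (fun x => a x • ContinuousLinearMap.id ℝ F) (eLpNorm a ∞ μ).toReal
    (fun u => ha.1.smul (Lp.aestronglyMeasurable u))
    ((ae_norm_le_toReal_eLpNorm ha).mono fun x hx => by
      rw [norm_smul]
      exact (mul_le_of_le_one_right (norm_nonneg _) ContinuousLinearMap.norm_id_le).trans hx)

theorem coeFn_mulL {a : α → ℝ} (ha : MemLp a ∞ μ) (u : Lp F 2 μ) :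
    mulL ha u =ᵐ[μ] fun x => a x • u x :=
  coeFn_pointwiseL _ _ _ _ u

theorem inner_mulL {a : α → ℝ} (ha : MemLp a ∞ μ) (u v : Lp F 2 μ) :
    ⟪mulL ha u, v⟫ = ∫ x, a x * ⟪u x, v x⟫ ∂μ := by
  rw [L2.inner_def]
  refine integral_congr_ae ?_
  filter_upwards [coeFn_mulL ha u] with x hx
  rw [hx, real_inner_smul_left]

theorem integrable_mul_inner {a : α → ℝ} (ha : MemLp a ∞ μ) (u v : Lp F 2 μ) :
    Integrable (fun x => a x * ⟪u x, v x⟫) μ := by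
  refine (L2.integrable_inner (𝕜 := ℝ) (mulL ha u) v).congr ?_
  filter_upwards [coeFn_mulL ha u] with x hx
  rw [hx, real_inner_smul_left]

theorem inner_mulL_comm {a : α → ℝ} (ha : MemLp a ∞ μ) (u v : Lp F 2 μ) :
    ⟪mulL ha u, v⟫ = ⟪u, mulL ha v⟫ := by
  rw [inner_mulL, real_inner_comm, inner_mulL]
  simp only [real_inner_comm]

/-- The scalar product with an essentially bounded vector field. -/
def dotL {b : α → F} (hb : MemLp b ∞ μ) : Lp F 2 μ →L[ℝ] Lp ℝ 2 μ :=
  pointwiseL (fun x => innerSL ℝ (b x)) (eLpNorm b ∞ μ).toReal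
    (fun u => hb.1.inner (𝕜 := ℝ) (Lp.aestronglyMeasurable u))
    ((ae_norm_le_toReal_eLpNorm hb).mono fun x hx => by rwa [innerSL_apply_norm])

theorem coeFn_dotL {b : α → F} (hb : MemLp b ∞ μ) (u : Lp F 2 μ) :
    dotL hb u =ᵐ[μ] fun x => ⟪b x, u x⟫ :=
  coeFn_pointwiseL _ _ _ _ u

theorem inner_dotL {b : α → F} (hb : MemLp b ∞ μ) (u : Lp F 2 μ) (v : Lp ℝ 2 μ) :
    ⟪dotL hb u, v⟫ = ∫ x, ⟪b x, u x⟫ * v x ∂μ := by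
  rw [L2.inner_def]
  refine integral_congr_ae ?_
  filter_upwards [coeFn_dotL hb u] with x hx
  rw [hx]
  simp [mul_comm]

theorem integrable_inner_mul {b : α → F} (hb : MemLp b ∞ μ) (u : Lp F 2 μ) (v : Lp ℝ 2 μ) :
    Integrable (fun x => ⟪b x, u x⟫ * v x) μ := by
  refine (L2.integrable_inner (𝕜 := ℝ) (dotL hb u) v).congr ?_
  filter_upwards [coeFn_dotL hb u] with x hx
  rw [hx]
  simp [mul_comm]

end Multiplication

/-! ### The operator 𝒜 and the control operator in the abstract setting -/

section Operators

variable {n : ℕ} {Ω ω : Set (E n)} {c : Coeffs n}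

/-- The operator on `H¹₀(Ω)` that represents the bilinear form of `𝒜`. -/
def Coeffs.MemClass.op (hc : c.MemClass Ω) : H10 Ω →L[ℝ] H10 Ω :=
  (adjoint (gradL Ω)).comp ((mulL hc.a_mem.1).comp (gradL Ω))
    + (adjoint (valL Ω)).comp ((dotL hc.b_mem).comp (gradL Ω))
    + (adjoint (valL Ω)).comp ((mulL hc.p_mem).comp (valL Ω))

theorem Coeffs.MemClass.inner_op (hc : c.MemClass Ω) (u v : H10 Ω) :
    ⟪hc.op u, v⟫ = ⟪mulL hc.a_mem.1 u.grad, v.grad⟫ + ⟪dotL hc.b_mem u.grad, v.val⟫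
      + ⟪mulL hc.p_mem u.val, v.val⟫ := by
  simp only [Coeffs.MemClass.op, add_apply, ContinuousLinearMap.comp_apply, inner_add_left,
    ContinuousLinearMap.adjoint_inner_left, valL_apply, gradL_apply]

theorem Coeffs.MemClass.form_eq (hc : c.MemClass Ω) (u v : H10 Ω) :
    c.form u v = ⟪hc.op u, v⟫ := by
  have h1 := integrable_mul_inner hc.a_mem.1 u.grad v.grad
  have h2 := integrable_inner_mul hc.b_mem u.grad v.val
  have h12 : Integrable (fun x => c.a x * ⟪u.grad x, v.grad x⟫ + ⟪c.b x, u.grad x⟫ * v.val x)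
    (volume.restrict Ω) := h1.add h2
  have h3 := integrable_mul_inner hc.p_mem u.val v.val
  rw [hc.inner_op, inner_mulL, inner_dotL, inner_mulL, ← integral_add h1 h2,
    ← integral_add h12 h3, Coeffs.form]
  congr 1
  ext x
  simp only [Real.inner_apply]
  ring

/-- Half of the ellipticity absorbs the drift term by Young's inequality, which costs ‖D‖²/(2a₀),
and the potential costs ‖P‖. The last a₀/2 in γ supplies the part ‖v‖²_{L²} of the H¹ norm and keeps
γ positive. -/
theorem Coeffs.MemClass.garding (hc : c.MemClass Ω) {a₀ : ℝ} (ha₀ : 0 < a₀)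
    (hell : ∀ᵐ x ∂(volume.restrict Ω), a₀ ≤ c.a x) :
    ∃ γ, 0 < γ ∧ GardingOp (valL Ω) hc.op (a₀ / 2) γ := by
  set D : L2V Ω →L[ℝ] L2 Ω := dotL hc.b_mem
  set P : L2 Ω →L[ℝ] L2 Ω := mulL hc.p_mem
  refine ⟨‖D‖ ^ 2 / (2 * a₀) + ‖P‖ + a₀ / 2, by positivity, fun v => ?_⟩
  have h1 : a₀ * ‖v.grad‖ ^ 2 ≤ ⟪mulL hc.a_mem.1 v.grad, v.grad⟫ := by
    rw [inner_mulL, ← real_inner_self_eq_norm_sq, L2.inner_def, ← integral_const_mul]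
    refine integral_mono_ae ((L2.integrable_inner (𝕜 := ℝ) v.grad v.grad).const_mul _)
      (integrable_mul_inner hc.a_mem.1 _ _) ?_
    filter_upwards [hell] with x hx
    exact mul_le_mul_of_nonneg_right hx real_inner_self_nonneg
  have h2 : -(‖D‖ * ‖v.grad‖ * ‖v.val‖) ≤ ⟪D v.grad, v.val⟫ := by
    refine (neg_le_neg ?_).trans (neg_abs_le _)
    exact (abs_real_inner_le_norm _ _).trans
      (mul_le_mul_of_nonneg_right (D.le_opNorm _) (norm_nonneg _))
  have h3 : -(‖P‖ * ‖v.val‖ * ‖v.val‖) ≤ ⟪P v.val, v.val⟫ := by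
    refine (neg_le_neg ?_).trans (neg_abs_le _)
    exact (abs_real_inner_le_norm _ _).trans
      (mul_le_mul_of_nonneg_right (P.le_opNorm _) (norm_nonneg _))
  have h4 : ‖D‖ * ‖v.grad‖ * ‖v.val‖
      ≤ a₀ / 2 * ‖v.grad‖ ^ 2 + ‖D‖ ^ 2 / (2 * a₀) * ‖v.val‖ ^ 2 := by
    have h5 : 0 ≤ (a₀ * ‖v.grad‖ - ‖D‖ * ‖v.val‖) ^ 2 / (2 * a₀) := by positivity
    have h6 : (a₀ * ‖v.grad‖ - ‖D‖ * ‖v.val‖) ^ 2 / (2 * a₀) = a₀ / 2 * ‖v.grad‖ ^ 2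
        + ‖D‖ ^ 2 / (2 * a₀) * ‖v.val‖ ^ 2 - ‖D‖ * ‖v.grad‖ * ‖v.val‖ := by
      field_simp
      ring
    linarith
  rw [hc.inner_op, norm_sq_H10, valL_apply]
  linarith

theorem Coeffs.MemClass.isParabolic (hc : c.MemClass Ω) (hΩ : IsOpen Ω) {a₀ : ℝ} (ha₀ : 0 < a₀)
    (hell : ∀ᵐ x ∂(volume.restrict Ω), a₀ ≤ c.a x) : IsParabolic (valL Ω) hc.op := by
  obtain ⟨γ, hγ, h⟩ := hc.garding ha₀ hell
  exact ⟨denseRange_valL hΩ, a₀ / 2, γ, by positivity, hγ.le, h⟩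

/-- Under the assumption `Ker 𝒜* = {0}` the operator is invertible. -/
theorem Coeffs.MemClass.isUnit_op (hc : c.MemClass Ω) (hΩ : IsOpen Ω)
    (hΩb : Bornology.IsBounded Ω) {a₀ : ℝ} (ha₀ : 0 < a₀)
    (hell : ∀ᵐ x ∂(volume.restrict Ω), a₀ ≤ c.a x) (hker : c.AdjointKernelTrivial Ω) :
    IsUnit (adjoint hc.op) := by
  obtain ⟨γ, hγ, h⟩ := hc.garding ha₀ hell
  refine isUnit_of_garding (valL Ω) (isCompactOperator_valL hΩ hΩb) _ (half_pos ha₀) hγ h.dual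
    fun ψ hψ => hker ψ fun v => ?_
  rw [hc.form_eq, ← ContinuousLinearMap.adjoint_inner_right, hψ, inner_zero_right]

theorem memLp_indicator_one (hω : MeasurableSet ω) :
    MemLp (ω.indicator (1 : E n → ℝ)) ∞ (volume.restrict Ω) :=
  (memLp_top_const (1 : ℝ)).indicator hω

/-- Multiplication by `χ_ω` as a continuous linear operator. -/
def chiL (Ω : Set (E n)) (hω : MeasurableSet ω) : L2 Ω →L[ℝ] L2 Ω :=
  mulL (memLp_indicator_one hω)

theorem chiL_apply (hω : MeasurableSet ω) (u : L2 Ω) : chiL Ω hω u = chi hω u := by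
  refine Lp.ext ?_
  filter_upwards [coeFn_mulL (memLp_indicator_one (Ω := Ω) hω) u,
    ((Lp.memLp u).indicator hω).coeFn_toLp] with x h1 h2
  rw [chiL, h1, chi, h2]
  by_cases hx : x ∈ ω <;> simp [hx]

theorem chiL_chiL (hω : MeasurableSet ω) (u : L2 Ω) : chiL Ω hω (chiL Ω hω u) = chiL Ω hω u := by
  refine Lp.ext ?_
  filter_upwards [coeFn_mulL (memLp_indicator_one (Ω := Ω) hω) u,
    coeFn_mulL (memLp_indicator_one (Ω := Ω) hω) (chiL Ω hω u)] with x h1 h2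
  rw [chiL] at h2 ⊢
  rw [h2, h1]
  by_cases hx : x ∈ ω <;> simp [hx]

theorem Coeffs.MemClass.isControlSystem (hc : c.MemClass Ω) (hΩ : IsOpen Ω)
    (hω : MeasurableSet ω) {a₀ : ℝ} (ha₀ : 0 < a₀)
    (hell : ∀ᵐ x ∂(volume.restrict Ω), a₀ ≤ c.a x) :
    IsControlSystem (valL Ω) hc.op (chiL Ω hω) :=
  ⟨hc.isParabolic hΩ ha₀ hell, inner_mulL_comm _, chiL_chiL hω⟩

variable {T : ℝ}

theorem Coeffs.MemClass.isForwardSol_iff (hc : c.MemClass Ω) {g : ℝ → L2 Ω} {y₀ : L2 Ω}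
    {y : ℝ → L2 Ω} : IsForwardSol c T g y₀ y ↔ IsWeak (valL Ω) hc.op T g y₀ y := by
  constructor
  · rintro ⟨h1, h2, h3, Y, h4, h5⟩
    simp only [hc.form_eq] at h5
    exact ⟨h1, h2, h3, Y, h4, h5⟩
  · rintro ⟨h1, h2, h3, Y, h4, h5⟩
    refine ⟨h1, h2, h3, Y, h4, ?_⟩
    simp only [hc.form_eq]
    exact h5

theorem Coeffs.MemClass.isBackwardSol_iff (hc : c.MemClass Ω) {g : ℝ → L2 Ω} {ψ₁ : L2 Ω}
    {ψ : ℝ → L2 Ω} : IsBackwardSol c T g ψ₁ ψ ↔ IsBack (valL Ω) hc.op T g ψ₁ ψ := by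
  rw [isBack_iff]
  constructor
  · rintro ⟨h1, h2, h3, Y, h4, h5⟩
    simp only [hc.form_eq] at h5
    exact ⟨h1, h2, h3, Y, h4, h5⟩
  · rintro ⟨h1, h2, h3, Y, h4, h5⟩
    refine ⟨h1, h2, h3, Y, h4, ?_⟩
    simp only [hc.form_eq]
    exact h5

theorem Coeffs.MemClass.isOptimalPair_iff (hc : c.MemClass Ω) (hω : MeasurableSet ω)
    {y₀ yd : L2 Ω} {y : ℝ → L2 Ω} {f : Control Ω T} :
    IsOptimalPair c hω T y₀ yd y f ↔ IsOptimal (valL Ω) hc.op (chiL Ω hω) T y₀ yd y f := by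
  simp only [IsOptimalPair, IsOptimal, IsState, hc.isForwardSol_iff, chiL_apply]
  rfl

variable {a₀ : ℝ}

theorem Coeffs.MemClass.isRiccatiValue_iff (hc : c.MemClass Ω) (hΩ : IsOpen Ω)
    (hω : MeasurableSet ω) (ha₀ : 0 < a₀) (hell : ∀ᵐ x ∂(volume.restrict Ω), a₀ ≤ c.a x)
    (hT : 0 ≤ T) {η ξ : L2 Ω} :
    IsRiccatiValue c hω T η ξ ↔
      ∃ y ψ, IsRiccatiSystem (valL Ω) hc.op (chiL Ω hω) T η y ψ ∧ ψ 0 = ξ := by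
  have hS := hc.isControlSystem hΩ hω ha₀ hell
  simp only [IsRiccatiValue, hc.isOptimalPair_iff, hc.isBackwardSol_iff,
    isRiccatiSystem_iff hS.parabolic hT hS.symm hS.idem]
  constructor
  · rintro ⟨y, f, ψ, h1, h2, h3⟩
    exact ⟨y, ψ, ⟨⟨f, h1⟩, h2⟩, h3⟩
  · rintro ⟨y, ψ, ⟨⟨f, h1⟩, h2⟩, h3⟩
    exact ⟨y, f, ψ, h1, h2, h3⟩

theorem Coeffs.MemClass.existsUnique_isRiccatiValue (hc : c.MemClass Ω) (hΩ : IsOpen Ω)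
    (hω : MeasurableSet ω) (ha₀ : 0 < a₀) (hell : ∀ᵐ x ∂(volume.restrict Ω), a₀ ≤ c.a x)
    (hT : 0 ≤ T) (η : L2 Ω) : ∃! ξ, IsRiccatiValue c hω T η ξ := by
  have hS := hc.isControlSystem hΩ hω ha₀ hell
  simp only [hc.isRiccatiValue_iff hΩ hω ha₀ hell hT]
  obtain ⟨y, ψ, h⟩ := exists_riccatiSystem hS.parabolic hT hS.symm hS.idem η
  refine ⟨ψ 0, ⟨y, ψ, h, rfl⟩, ?_⟩
  rintro _ ⟨y', ψ', h', rfl⟩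
  exact h'.unique hS.parabolic hT hS.symm hS.idem h (left_mem_Icc.2 hT)

theorem Coeffs.MemClass.isRiccatiFamily (hc : c.MemClass Ω) (hΩ : IsOpen Ω)
    (hω : MeasurableSet ω) (ha₀ : 0 < a₀) (hell : ∀ᵐ x ∂(volume.restrict Ω), a₀ ≤ c.a x) :
    IsRiccatiFamily (valL Ω) hc.op (chiL Ω hω) (riccati c hω) := fun _ hτ η =>
  (hc.isRiccatiValue_iff hΩ hω ha₀ hell hτ.le).1
    (Classical.epsilon_spec (hc.existsUnique_isRiccatiValue hΩ hω ha₀ hell hτ.le η).exists)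

theorem Coeffs.MemClass.isFeedbackSol_iff (hc : c.MemClass Ω) (hω : MeasurableSet ω)
    {h₁ : L2 Ω} {h : ℝ → L2 Ω} : IsFeedbackSol c hω T h₁ h ↔
      IsFeedback (valL Ω) hc.op (chiL Ω hω) (riccati c hω) T h₁ h := by
  simp only [IsFeedbackSol, IsFeedback, hc.isBackwardSol_iff, chiL_apply]

/-- Separability of L²(Ω) is what makes the weakly measurable Riccati terms strongly measurable. -/
instance (Ω : Set (E n)) : SecondCountableTopology (L2 Ω) :=
  haveI : Fact ((2 : ℝ≥0∞) ≠ ∞) := ⟨ENNReal.ofNat_ne_top⟩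
  inferInstance

end Operators

/-! ### The stationary optimal control problem -/

section Stationary

variable {V H : Type*} [NormedAddCommGroup V] [InnerProductSpace ℝ V] [CompleteSpace V]
  [NormedAddCommGroup H] [InnerProductSpace ℝ H] [CompleteSpace H]
  {ι : V →L[ℝ] H} {A : V →L[ℝ] V} {C : H →L[ℝ] H}

/-- Optimal pairs of the abstract stationary problem. -/
def IsStationaryOptimal (ι : V →L[ℝ] H) (A : V →L[ℝ] V) (C : H →L[ℝ] H) (yd : H) (y : V)
    (f : H) : Prop :=
  A y = adjoint ι (C f) ∧ ∀ f' y', A y' = adjoint ι (C f') →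
    ‖f‖ ^ 2 + ‖ι y - yd‖ ^ 2 ≤ ‖f'‖ ^ 2 + ‖ι y' - yd‖ ^ 2

/-- As A is invertible, the state is a bounded linear function B = A⁻¹ι*C of the control, and the
problem becomes the unconstrained least squares problem for ι B. -/
theorem isStationaryOptimal_iff (hA : IsUnit A) :
    ∃ B : H →L[ℝ] V, (∀ f, A (B f) = adjoint ι (C f)) ∧
      ∀ yd y f, IsStationaryOptimal ι A C yd y f ↔
        y = B f ∧ ∀ g, ⟪f, g⟫ + ⟪ι (B f) - yd, ι (B g)⟫ = 0 := by
  have hinj := (ContinuousLinearMap.isUnit_iff_bijective.1 hA).1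
  obtain ⟨u, rfl⟩ := hA
  set B : H →L[ℝ] V := (↑u⁻¹ : V →L[ℝ] V).comp ((adjoint ι).comp C) with hB
  have h1 : ∀ f, (u : V →L[ℝ] V) (B f) = adjoint ι (C f) := fun f =>
    congrArg (fun S : V →L[ℝ] V => S (adjoint ι (C f))) u.mul_inv
  refine ⟨B, h1, fun yd y f => ?_⟩
  have h2 : ∀ f y, (u : V →L[ℝ] V) y = adjoint ι (C f) ↔ y = B f := fun f y =>
    ⟨fun h => hinj (h.trans (h1 f).symm), fun h => h ▸ h1 f⟩
  simp only [IsStationaryOptimal, h2]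
  refine and_congr_right fun hy => ?_
  rw [hy, ← ContinuousLinearMap.comp_apply ι B]
  simp only [← ContinuousLinearMap.comp_apply ι B]
  rw [← quadratic_min_iff]
  exact ⟨fun h f' => h f' _ rfl, fun h f' y' hy' => hy' ▸ h f'⟩

theorem existsUnique_isStationaryOptimal (hA : IsUnit A) (yd : H) :
    ∃! f, ∃ y, IsStationaryOptimal ι A C yd y f := by
  obtain ⟨B, -, h⟩ := isStationaryOptimal_iff (ι := ι) (C := C) hA
  obtain ⟨f, hf, hu⟩ := existsUnique_quadratic_min (ι.comp B) yd
  exact ⟨f, ⟨B f, (h yd _ f).2 ⟨rfl, hf⟩⟩, fun f' ⟨y', h'⟩ => hu f' ((h yd y' f').1 h').2⟩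

/-- The optimality condition of the stationary problem. -/
theorem IsStationaryOptimal.control_eq (hA : IsUnit A) (hC : ∀ x y, ⟪C x, y⟫ = ⟪x, C y⟫)
    {yd f : H} {y ψ : V} (h : IsStationaryOptimal ι A C yd y f)
    (hψ : adjoint A ψ = adjoint ι (ι y - yd)) : f = -C (ι ψ) := by
  obtain ⟨B, hB, hiff⟩ := isStationaryOptimal_iff (ι := ι) (C := C) hA
  obtain ⟨rfl, h2⟩ := (hiff yd y f).1 h
  refine ext_inner_right ℝ fun g => ?_
  have h3 := h2 g
  rw [← ContinuousLinearMap.adjoint_inner_left, ← hψ, ContinuousLinearMap.adjoint_inner_left, hB,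
    ContinuousLinearMap.adjoint_inner_right, ← hC] at h3
  rw [inner_neg_left]
  linarith

end Stationary

/-! ### The affine feedback law -/

section Affine

variable {V H : Type*} [NormedAddCommGroup V] [InnerProductSpace ℝ V] [CompleteSpace V]
  [NormedAddCommGroup H] [InnerProductSpace ℝ H] [CompleteSpace H]
  {ι : V →L[ℝ] H} {A : V →L[ℝ] V} {C : H →L[ℝ] H} {R : ℝ → H → H} {T : ℝ}

theorem map_eq_adjoint_iff {A : V →L[ℝ] V} {u : V} {x : H} :
    A u = adjoint ι x ↔ ∀ v, ⟪A u, v⟫ = ⟪x, ι v⟫ := by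
  simp only [← ContinuousLinearMap.adjoint_inner_left]
  exact ⟨fun h v => by rw [h], fun h => ext_inner_right ℝ h⟩

/-- The affine feedback law for the abstract control problem. -/
theorem IsOptimal.feedback (hS : IsControlSystem ι A C) (hR : IsRiccatiFamily ι A C R)
    (hT : 0 ≤ T) (hA : IsUnit A) {y₀ yd fbar : H} {y h : ℝ → H} {f : Lp H 2 (timeMeasure T)}
    {ybar ψbar : V} (hy : IsOptimal ι A C T y₀ yd y f)
    (hybar : IsStationaryOptimal ι A C yd ybar fbar)
    (hψbar : adjoint A ψbar = adjoint ι (ι ybar - yd))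
    (hh : IsFeedback ι A C R T (-ι ψbar) h) :
    ∀ᵐ t ∂timeMeasure T, f t = fbar - C (R (T - t) (y t - ι ybar) + h t) := by
  obtain ⟨ψ, hψ⟩ := hS.parabolic.exists_isBack hT
    (memLp_of_continuousOn (hy.1.continuousOn.sub continuousOn_const)) (0 : H)
      (g := fun t => y t - yd)
  have hf := ((isOptimal_iff hS.parabolic hT hS.symm hψ).1 hy).2
  have hfbar : fbar = -C (ι ψbar) := hybar.control_eq hA hS.symm hψbar
  -- The stationary adjoint state is a solution constant in time. Subtracting it removes y_d from
  -- the source, at the price of the terminal value 0 - ψ̄.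
  have hq : IsBack ι A T (fun t => y t - ι ybar) (-ι ψbar) (fun t => ψ t - ι ψbar) := by
    have hb : IsBack ι A T (fun _ => ι ybar - yd) (ι ψbar) (fun _ => ι ψbar) :=
      isBack_const fun v => by
        rw [← map_eq_adjoint_iff.1 hψbar v, ContinuousLinearMap.adjoint_inner_left,
          real_inner_comm]
    have := hψ.sub hb
    simpa only [sub_sub_sub_cancel_right, zero_sub] using this
  have hz : IsWeak ι A T (fun t => -C (ψ t - ι ψbar)) (y₀ - ι ybar)
      (fun t => y t - ι ybar) := by
    have hw : IsWeak ι A T (fun _ => C fbar) (ι ybar) (fun _ => ι ybar) :=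
      isWeak_const (map_eq_adjoint_iff.1 hybar.1)
    refine (hy.1.sub hw).congr ?_
    filter_upwards [hf] with t ht
    rw [ht, hfbar, map_neg, map_neg, hS.idem, hS.idem, map_sub]
    abel
  filter_upwards [hf, ae_lt T] with t ht htT
  rw [← hh.decouple hS hR hz hq (Ioo_subset_Ico_self htT), ht, hfbar, map_sub]
  abel

end Affine

/-! ### Translation of the stationary problem and the final theorem -/

section Bridge

variable {n : ℕ} {Ω ω : Set (E n)} {c : Coeffs n}

theorem Coeffs.MemClass.isStationaryOptimalPair_iff (hc : c.MemClass Ω) (hω : MeasurableSet ω)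
    {yd f : L2 Ω} {y : H10 Ω} : IsStationaryOptimalPair c hω yd y f ↔
      IsStationaryOptimal (valL Ω) hc.op (chiL Ω hω) yd y f := by
  have h1 : ∀ f y, IsStationaryState c hω f y ↔
      hc.op y = adjoint (valL Ω) (chiL Ω hω f) := fun f y => by
    simp only [IsStationaryState, map_eq_adjoint_iff, hc.form_eq, chiL_apply, valL_apply]
  simp only [IsStationaryOptimalPair, IsStationaryOptimal, h1, stationaryCost, valL_apply,
    one_div, inv_pos, Nat.ofNat_pos, mul_le_mul_iff_right₀]

theorem Coeffs.MemClass.isStationaryAdjoint_iff (hc : c.MemClass Ω) {yd : L2 Ω} {y ψ : H10 Ω} :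
    IsStationaryAdjoint c yd y ψ ↔
      adjoint hc.op ψ = adjoint (valL Ω) (valL Ω y - yd) := by
  simp only [IsStationaryAdjoint, map_eq_adjoint_iff, hc.form_eq, valL_apply,
    ContinuousLinearMap.adjoint_inner_left]
  simp only [real_inner_comm ψ]

end Bridge

end ParabolicControl

end

theorem corollary4p7 {n : ℕ} (hn : 1 ≤ n)
    {Ω ω : Set (ParabolicControl.E n)} (hΩ : IsOpen Ω) (hΩb : Bornology.IsBounded Ω)
    (hω : IsOpen ω) (hω_ne : ω.Nonempty) (hωΩ : ω ⊆ Ω)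
    (c : ParabolicControl.Coeffs n) (hc : c.MemClass Ω)
    {a₀ : ℝ} (ha₀ : 0 < a₀) (hell : ∀ᵐ x ∂(volume.restrict Ω), a₀ ≤ c.a x)
    (hker : c.AdjointKernelTrivial Ω)
    {T : ℝ} (hT : 0 < T) (y₀ yd : ParabolicControl.L2 Ω) :
    -- the objects in the statement are well defined
    (∀ τ : ℝ, 0 < τ → ∀ η : ParabolicControl.L2 Ω,
      ∃! ξ, ParabolicControl.IsRiccatiValue c hω.measurableSet τ η ξ) ∧
    (∃! f, ∃ y, ParabolicControl.IsOptimalPair c hω.measurableSet T y₀ yd y f) ∧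
    (∃! f, ∃ y, ParabolicControl.IsStationaryOptimalPair c hω.measurableSet yd y f) ∧
    -- the affine feedback law
    ∀ y f ybar fbar,
      ParabolicControl.IsOptimalPair c hω.measurableSet T y₀ yd y f →
      ParabolicControl.IsStationaryOptimalPair c hω.measurableSet yd ybar fbar →
      ∃ ψbar : ParabolicControl.H10 Ω,
        ParabolicControl.IsStationaryAdjoint c yd ybar ψbar ∧
        (∀ ψ', ParabolicControl.IsStationaryAdjoint c yd ybar ψ' → ψ' = ψbar) ∧
        ∃ h : ℝ → ParabolicControl.L2 Ω,
          ParabolicControl.IsFeedbackSol c hω.measurableSet T (-ψbar.val) h ∧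
          (∀ h', ParabolicControl.IsFeedbackSol c hω.measurableSet T (-ψbar.val) h' →
            EqOn h' h (Icc 0 T)) ∧
          ∀ᵐ t ∂ParabolicControl.timeMeasure T,
            f t = fbar - ParabolicControl.chi hω.measurableSet
              (ParabolicControl.riccati c hω.measurableSet (T - t) (y t - ybar.val) + h t) := by
  have hu := hc.isUnit_op hΩ hΩb ha₀ hell hker
  have hA := ParabolicControl.isUnit_of_adjoint _ hu
  have hbij := ContinuousLinearMap.isUnit_iff_bijective.1 hu
  have hS := hc.isControlSystem hΩ hω.measurableSet ha₀ hell
  have hR := hc.isRiccatiFamily hΩ hω.measurableSet ha₀ hell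
  refine ⟨fun τ hτ η => hc.existsUnique_isRiccatiValue hΩ hω.measurableSet ha₀ hell hτ.le η,
    ?_, ?_, ?_⟩
  · simp only [hc.isOptimalPair_iff]
    exact ParabolicControl.existsUnique_optimal hS.parabolic hT.le _ y₀ yd
  · simp only [hc.isStationaryOptimalPair_iff]
    exact ParabolicControl.existsUnique_isStationaryOptimal hA yd
  · intro y f ybar fbar hy hybar
    rw [hc.isOptimalPair_iff] at hy
    rw [hc.isStationaryOptimalPair_iff] at hybar
    obtain ⟨ψbar, hψbar⟩ := hbij.2 (ContinuousLinearMap.adjoint (ParabolicControl.valL Ω)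
      (ParabolicControl.valL Ω ybar - yd))
    obtain ⟨h, hh⟩ := ParabolicControl.exists_feedback hS hR hT (-ψbar.val)
    refine ⟨ψbar, hc.isStationaryAdjoint_iff.2 hψbar, fun ψ' hψ' =>
      hbij.1 ((hc.isStationaryAdjoint_iff.1 hψ').trans hψbar.symm), h,
      (hc.isFeedbackSol_iff _).2 hh, fun h' hh' =>
      ((hc.isFeedbackSol_iff _).1 hh').unique hS hR hh, ?_⟩
    simp only [← ParabolicControl.chiL_apply]
    exact hy.feedback hS hR hT.le hA hybar hψbar hh
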